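/- **Theorem 3 (Multiple windows with $w=o(\log k)$).** All logarithms are to base $2$. Let $z>1$ and $c\ge 2z$ be constant integers, let $k=2^\ell$ (so $\ell=\log k$), and let $w=w(k)$ be integers with $w=o(\log k)$. *The code.* A message $\mathbf u\in\{0,1\}^k$ is cut into $\lceil k/\ell\rceil$ blocks of $\ell$ bits (the last one padded by zeros), each read as a symbol of $GF(2^\ell)$ in a polynomial basis. It is encoded by a systematic MDS code with $c$ parity symbols over $GF(2^\ell)$; the codeword consists of the $k$ message bits followed by the $c\ell$ parity bits, each repeated $zw+1$ times. Such codes (for example with a Cauchy matrix as parity part of the generator matrix) exist for all large $k$. *The channel.* A set $D$ of positions of the codeword, chosen independently of the message, is deleted; $D$ is contained in the union of $z$ windows of at most $w$ consecutive positions each (so at most $w$ bits are deleted in each window). *The decoder.* It recovers the parity bits from the repetition code. Then it goes through all guesses that assign to each of the $z$ windows two adjacent blocks of the systematic part and a number, at most $w$, of bits deleted in them, where the total number of deletions guessed is at most the number of bits missing in the received string. For each guess it chunks the received string accordingly, regards the at most $2z$ guessed blocks as erased and decodes them by means of the parities. The guess is possible if the decoded string is a message that is consistent with all $c$ parities and if,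 in every maximal run of adjacent erased blocks, the decoded bits are a supersequence of the corresponding part of the received string. If all possible guesses lead to the same message, the decoder outputs it; otherwise (in particular if there is no possible guess) it declares a failure. *The claim.* The length $n$ of the codeword satisfies exactly $$n-k=c(zw+1)\log k .$$ Moreover, for all sufficiently large $k$, with constants in $\mathcal O(\cdot)$ that depend only on $z$, $c$ and the function $w$ (not on the choice of the field representation, of the MDS code, of the message or of $D$): 1. the decoder outputs the transmitted message or declares a failure; it never outputs a wrong message; 2. encoding takes $\mathcal O(k\log k)$ steps and decoding takes $\mathcal O(k^{z+1}\log k)$ steps, by two fixed programs that depend only on $z$ and $c$ and receive a description of the code (the window size $w$, the field polynomial and the generator matrix) as part of their input (the decoding program also receives $k$ in unary); a step is one elementary operation on bits, pairs and list cells; 3. for a uniformly distributed message and every such $D$, the probability of decoding failure is $$\Pr(F)=\mathcal O\left(k^{-(c-4z)}\right).$$ -/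

import Mathlib

open Filter Asymptotics
open scoped Polynomial Matrix

namespace GC

/-! ## A step-counting model of computation

Programs are closed terms over cons cells, pairs, bits and optional values, whose only loop is
the traversal of a list. Nothing else can be done with data, there is no arithmetic on numbers,
and data are passed by reference, so that each counted step is a bounded number of operations of
a pointer machine (or of a random access machine). -/

/-- Programs with input in `α` and output in `β`. -/
inductive Prog : Type → Type → Type 1
  | id {α : Type} : Prog α α
  | comp {α β γ : Type} (p : Prog α β) (q : Prog β γ) : Prog α γ
  | unit {α : Type} : Prog α Unit
  | bit {α : Type} (b : Bool) : Prog α Bool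
  | cond {α β : Type} (p q : Prog α β) : Prog (Bool × α) β
  | fst {α β : Type} : Prog (α × β) α
  | snd {α β : Type} : Prog (α × β) β
  | pair {α β γ : Type} (p : Prog α β) (q : Prog α γ) : Prog α (β × γ)
  | none {α β : Type} : Prog α (Option β)
  | some {α : Type} : Prog α (Option α)
  | nil {α β : Type} : Prog α (List β)
  | cons {α : Type} : Prog (α × List α) (List α)
  | uncons {α β γ : Type} (p : Prog γ β) (q : Prog (α × List α × γ) β) : Prog (List α × γ) β
  | loop {α β γ : Type} (p : Prog (α × β × γ) β) : Prog (List α × β × γ) β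

/-- The output of a program. `loop p` on `(l, b, g)` runs through `l` from the left, starting
with the state `b`, and replaces the state `s` by the output of `p` on `(a, s, g)` for each
entry `a`. -/
def Prog.run : {α β : Type} → Prog α β → α → β
  | _, _, .id, x => x
  | _, _, .comp p q, x => q.run (p.run x)
  | _, _, .unit, _ => ()
  | _, _, .bit b, _ => b
  | _, _, .cond p q, x => match x.1 with
    | true => p.run x.2
    | false => q.run x.2
  | _, _, .fst, x => x.1
  | _, _, .snd, x => x.2
  | _, _, .pair p q, x => (p.run x, q.run x)
  | _, _, .none, _ => Option.none
  | _, _, .some, x => Option.some x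
  | _, _, .nil, _ => []
  | _, _, .cons, x => x.1 :: x.2
  | _, _, .uncons p q, x => match x.1 with
    | [] => p.run x.2
    | a :: t => q.run (a, t, x.2)
  | _, _, .loop p, x => x.1.foldl (fun s a => p.run (a, s, x.2.2)) x.2.1

/-- The number of steps of a program on an input: one for every instruction that is executed and
one for every passage through a loop. -/
def Prog.steps : {α β : Type} → Prog α β → α → ℕ
  | _, _, .comp p q, x => 1 + p.steps x + q.steps (p.run x)
  | _, _, .cond p q, x => match x.1 with
    | true => 1 + p.steps x.2
    | false => 1 + q.steps x.2
  | _, _, .pair p q, x => 1 + p.steps x + q.steps x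
  | _, _, .uncons p q, x => match x.1 with
    | [] => 1 + p.steps x.2
    | a :: t => 1 + q.steps (a, t, x.2)
  | _, _, .loop p, x =>
    1 + (x.1.foldl (fun s a => (p.run (a, s.1, x.2.2), s.2 + 1 + p.steps (a, s.1, x.2.2)))
      (x.2.1, 0)).2
  | _, _, _, _ => 1

/-! ## Localized deletions -/

/-- The positions in `D` (counted from `0`) lie in `z` windows of at most `w` consecutive
positions each. In particular a window holds at most `w` of them. -/
def Localized (z w : ℕ) (D : Finset ℕ) : Prop :=
  ∃ a : Fin z → ℕ, ∀ p ∈ D, ∃ j, a j ≤ p ∧ p < a j + w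

/-- The string `x` after the deletion of the entries at the positions in `D`. -/
def deleteAt (D : Finset ℕ) (x : List Bool) : List Bool :=
  (x.zipIdx.filter fun b => b.2 ∉ D).map Prod.fst

/-! ## The code -/

/-- The number `⌈k / ℓ⌉` of blocks of `ℓ` bits of a message of `k` bits. -/
def numBlocks (k ℓ : ℕ) : ℕ := (k + ℓ - 1) / ℓ

open Classical in
/-- The choices on which a Guess & Check code with `c` parity symbols depends: the field with
`2 ^ ℓ` elements, given by an irreducible polynomial, and a systematic MDS code over it with
generator matrix `[I | gen]`, that is, one with minimum distance `c + 1`. -/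
structure Code (k ℓ c : ℕ) where
  modulus : (ZMod 2)[X]
  monic : modulus.Monic
  irreducible : Irreducible modulus
  natDegree_eq : modulus.natDegree = ℓ
  gen : Matrix (Fin (numBlocks k ℓ)) (Fin c) (AdjoinRoot modulus)
  mds : ∀ U : Fin (numBlocks k ℓ) → AdjoinRoot modulus, U ≠ 0 →
    c + 1 ≤ hammingNorm U + hammingNorm (U ᵥ* gen)

namespace Code

variable {k ℓ c : ℕ} (C : Code k ℓ c)

/-- The parity part of the generator matrix is a Cauchy matrix. -/
def IsCauchy : Prop :=
  ∃ (x : Fin (numBlocks k ℓ) → AdjoinRoot C.modulus) (y : Fin c → AdjoinRoot C.modulus),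
    Function.Injective x ∧ Function.Injective y ∧ ∀ j r, C.gen j r * (x j - y r) = 1

/-- The `ℓ` bits of a symbol: its coordinates at `α ^ (ℓ - 1), …, α, 1`, where `α` is the
adjoined root. -/
noncomputable def toBits (s : AdjoinRoot C.modulus) : List Bool :=
  List.ofFn fun i : Fin ℓ =>
    decide ((AdjoinRoot.modByMonicHom C.monic s).coeff (ℓ - 1 - i) = 1)

/-- The symbols of a message: it is cut into blocks of `ℓ` bits, the last one padded by zeros,
and `b₁ … b_ℓ` becomes `b₁ α ^ (ℓ - 1) + ⋯ + b_ℓ`. -/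
noncomputable def symbols (u : Fin k → Bool) (j : Fin (numBlocks k ℓ)) : AdjoinRoot C.modulus :=
  ∑ i : Fin ℓ, if ∃ h : j * ℓ + i < k, u ⟨j * ℓ + i, h⟩ = true then
    AdjoinRoot.root C.modulus ^ (ℓ - 1 - i : ℕ) else 0

/-- The `c * ℓ` parity bits of a message. -/
noncomputable def parityBits (u : Fin k → Bool) : List Bool :=
  (List.ofFn fun r : Fin c => C.toBits ((C.symbols u ᵥ* C.gen) r)).flatten

/-- The codeword of a message: its `k` bits, followed by the parity bits, each of which is
repeated `z * w + 1` times. -/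
noncomputable def encode (z w : ℕ) (u : Fin k → Bool) : List Bool :=
  List.ofFn u ++ (C.parityBits u).flatMap fun b => List.replicate (z * w + 1) b

/-! ## The decoder -/

/-- A guess of the decoder: for each of the `z` windows the first one of the two adjacent blocks
that contain its systematic bits, and the number of systematic bits deleted in it. -/
structure Guess (z : ℕ) where
  start : Fin z → ℕ
  del : Fin z → ℕ

/-- The block `b` is considered erased. -/
def Guess.Erased {z : ℕ} (g : Guess z) (b : ℕ) : Prop :=
  ∃ j, b = g.start j ∨ b = g.start j + 1

/-- The assumed number of deletions in the blocks before `b`, for a `b` that does not split the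
two blocks of a window. -/
def Guess.shift {z : ℕ} (g : Guess z) (b : ℕ) : ℕ :=
  ∑ j : Fin z, if g.start j < b then g.del j else 0

/-- The guesses to be checked for windows of size at most `w`, if the received string is shorter
than the codeword by `d` bits. -/
def Guess.Admissible {z : ℕ} (g : Guess z) (k ℓ w d : ℕ) : Prop :=
  (∀ j, g.start j + 1 < numBlocks k ℓ ∧ g.del j ≤ w) ∧ ∑ j, g.del j ≤ d

/-- The blocks `a, …, b - 1` form a maximal run of adjacent erased blocks. -/
def Guess.IsRun {z : ℕ} (g : Guess z) (a b : ℕ) : Prop :=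
  a < b ∧ (∀ t, a ≤ t → t < b → g.Erased t) ∧ (a = 0 ∨ ¬ g.Erased (a - 1)) ∧ ¬ g.Erased b

/-- The parity bits as recovered from the received string `y`. With at most `z * w` deletions,
the entry of `y` at the first position of a group of `z * w + 1` repetitions comes from this
group. -/
def recoveredParity (k ℓ c z w : ℕ) (y : List Bool) : List Bool :=
  List.ofFn fun b : Fin (c * ℓ) => y.getD (k + b * (z * w + 1)) false

/-- The symbols of `v` outside the erased blocks are those obtained by chunking the received
string `y` according to the guess. -/
def AgreesOffErasures {z : ℕ} (ℓ : ℕ) (y : List Bool) (g : Guess z) (v : Fin k → Bool) : Prop :=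
  ∀ p : Fin k, ¬ g.Erased (p / ℓ) → y[(p : ℕ) - g.shift (p / ℓ)]? = some (v p)

/-- In each maximal run of erased blocks the bits of `v` are a supersequence of the sub-block of
the received string `y` that the guess assigns to this run. -/
def IsSupersequence {z : ℕ} (ℓ : ℕ) (y : List Bool) (g : Guess z) (v : Fin k → Bool) : Prop :=
  ∀ a b, g.IsRun a b →
    List.Sublist
      ((y.take (min (b * ℓ) k - g.shift b)).drop (a * ℓ - g.shift a))
      (((List.ofFn v).take (b * ℓ)).drop (a * ℓ))

/-- `v` is the decoded string of a possible case. Agreement off the at most `2 * z` erasures and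
with the first `2 * z` parities says that `v` is the outcome of decoding the erasures (which is
unique for `2 * z ≤ c`, as the code is MDS); agreement with the other parities is the first
criterion for being possible, the supersequence condition is the second one. -/
def Possible (z w : ℕ) (y : List Bool) (v : Fin k → Bool) : Prop :=
  C.parityBits v = recoveredParity k ℓ c z w y ∧
  ∃ g : Guess z, g.Admissible k ℓ w (k + c * (z * w + 1) * ℓ - y.length) ∧
    AgreesOffErasures ℓ y g v ∧ IsSupersequence ℓ y g v

open Classical in
/-- The decoder: if the possible cases lead to one and the same message, this message is the
output; otherwise a failure is declared (`none`). -/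
noncomputable def decode (z w : ℕ) (y : List Bool) : Option (Fin k → Bool) :=
  if h : ∃! v, C.Possible z w y v then some h.choose else none

open Classical in
/-- The probability of a decoding failure for a uniformly distributed message, if the bits at the
positions in `D` are deleted. -/
noncomputable def failureProb (z w : ℕ) (D : Finset ℕ) : ℝ :=
  ((Finset.univ.filter fun u : Fin k → Bool =>
    C.decode z w (deleteAt D (C.encode z w u)) = none).card : ℝ) / 2 ^ k

/-! ## The inputs of the programs -/

/-- The description of the code as a datum: the window size in unary, the coefficients of the
modulus at `X ^ (ℓ - 1), …, 1`, and the parity part of the generator matrix, row by row, each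
entry by its `ℓ` bits. -/
noncomputable def description (w : ℕ) : List Unit × List Bool × List (List (List Bool)) :=
  (List.replicate w (),
    List.ofFn fun i : Fin ℓ => decide (C.modulus.coeff (ℓ - 1 - i) = 1),
    List.ofFn fun j => List.ofFn fun r => C.toBits (C.gen j r))

end Code

/-- Programs for encoding: the input is the description of the code and the message. -/
abbrev EncProg : Type 1 :=
  Prog ((List Unit × List Bool × List (List (List Bool))) × List Bool) (List Bool)

/-- Programs for decoding: the input is the description of the code, the length of the message
in unary and the received string; the output is a message or `none`. -/
abbrev DecProg : Type 1 :=
  Prog ((List Unit × List Bool × List (List (List Bool))) × List Unit × List Bool)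
    (Option (List Bool))

end GC

/-! The decoder never errs because the transmitted message is always the outcome of a possible case
(`Code.possible_self`). Once `w ≤ ℓ`, the systematic deletions of one window lie in two adjacent
blocks, and the guess with these blocks and the true numbers of deletions chunks the received string
correctly. The parities are read reliably because at most `z * w` deletions cannot push the first
position of a group of `z * w + 1` copies out of the group (`Code.recoveredParity_deleteAt`). A
unique outcome is therefore the message, and failure means that some guess yields a second message.

To bound the probability of this, fix a guess. Off the erased blocks it fills position `p` with the
codeword bit at a position `source p`, and `source` is strictly increasing, since the assumed shift
changes only across the two erased blocks of a window. Call `p` moved if `source p ≠ p`. Let `v ≠ u`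
be an outcome with the right parities. As `v` and `u` agree wherever `p` is neither erased nor
moved, minimum distance `c + 1` forces more than `c - 2 * z` blocks to contain moved positions.
Choose `c - 2 * z` complete ones. A block with both moved and fixed positions contains a deletion,
and the fixed positions charged in this way to one window span at most `ℓ` places
(`Code.Guess.card_fixed_le`). So all but `z * ℓ` of the `(c - 2 * z) * ℓ` chosen positions are
moved; let `R` be the set of these.

The bits of `u` at `R` are redundant. Record the first parity bit, `u` at the positions that are not
moved, and `u + v` at the moved positions outside `R`. The difference `u + v` has zero parities and
is known off the chosen and the erased blocks, at most `c` in number, so the MDS property recovers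
it. Then `u p = (u + v) p + u (source p)` recovers `u` along the chains `p`, `source p`, `source
(source p)`, …, which run in one direction until they meet a position that is not moved or pass the
end of the message, where only copies of the first parity bit occur (`Code.eq_of_xor_eq`). This
bounds the bad messages for one guess (`Code.card_mistaken_le`). With `B` blocks there are at most
`(B * (w + 1)) ^ z ≤ k ^ z` guesses, and since `2 ^ ℓ = k` the union bound gives `2 * k ^ (-(c - 4 *
z))` (`Code.failureProb_le`).

For the running times, arithmetic in the field is replaced by linear algebra over the field with two
elements; the only multiplication needed is by the adjoined root (`Code.toBits_mul_root`,
`Code.vec_parityBits`). Encoding adds up at most `k` rows of `c * ℓ` bits. A guess costs `O(B * ℓ ^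
2 + ℓ ^ 3) = O(k * ℓ)`: the known blocks are subtracted and at most `2 * z * ℓ` unknown bits are
found by elimination. It is enough that elimination finds some solution if there is one
(`lin_solve`), because the MDS property makes it unique (`mem_tryItems`). The predicate `Eff` is
closed under composition, branching and loops, so programs and step bounds are obtained together
from the list functions, and correctness is a matter of the list functions alone. -/

namespace GC

/-! ## A calculus of programs with bounded step counts -/

/-- On the inputs in `D` the function `f` is computed by a program in `O(T + 1)` steps. -/
def Eff {α β : Type} (D : α → Prop) (T : α → ℕ) (f : α → β) : Prop :=
  ∃ (p : Prog α β) (A : ℕ), ∀ x, D x → p.run x = f x ∧ p.steps x ≤ A * (T x + 1)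

namespace Eff

variable {α β γ δ : Type} {D : γ → Prop} {T : γ → ℕ}

theorem congr {f g : γ → α} (hf : Eff D T f) (h : ∀ x, D x → g x = f x) : Eff D T g := by
  obtain ⟨p, A, hp⟩ := hf
  exact ⟨p, A, fun x hx => ⟨(hp x hx).1.trans (h x hx).symm, (hp x hx).2⟩⟩

theorem mono {D' : γ → Prop} {T' : γ → ℕ} {f : γ → α} (hf : Eff D T f) (K : ℕ)
    (hD : ∀ x, D' x → D x) (hT : ∀ x, D' x → T x ≤ K * (T' x + 1)) : Eff D' T' f := by
  obtain ⟨p, A, hp⟩ := hf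
  refine ⟨p, A * (K + 1), fun x hx => ⟨(hp x (hD x hx)).1, (hp x (hD x hx)).2.trans ?_⟩⟩
  rw [mul_assoc]
  refine Nat.mul_le_mul le_rfl ?_
  have := hT x hx
  nlinarith

theorem restrict {D' : γ → Prop} {f : γ → α} (hf : Eff D T f) (hD : ∀ x, D' x → D x) :
    Eff D' T f :=
  hf.mono 1 hD fun x _ => by omega

theorem comp {D' : α → Prop} {T' : α → ℕ} {f : γ → α} {g : α → β} (hg : Eff D' T' g)
    (hf : Eff D T f) (K : ℕ) (hD : ∀ x, D x → D' (f x))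
    (hT : ∀ x, D x → T' (f x) ≤ K * (T x + 1)) : Eff D T fun x => g (f x) := by
  obtain ⟨p, A, hp⟩ := hf
  obtain ⟨q, B, hq⟩ := hg
  refine ⟨.comp p q, 1 + A + B * (K + 1), fun x hx => ?_⟩
  have h1 := hp x hx
  have h2 := hq (f x) (hD x hx)
  refine ⟨by simp [Prog.run, h1.1, h2.1], ?_⟩
  simp only [Prog.steps, h1.1]
  have h3 : B * (T' (f x) + 1) ≤ B * ((K + 1) * (T x + 1)) := by
    refine Nat.mul_le_mul le_rfl ?_
    have := hT x hx
    nlinarith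
  have : B * ((K + 1) * (T x + 1)) = B * (K + 1) * (T x + 1) := by ring
  have : (1 + A + B * (K + 1)) * (T x + 1)
    = 1 + T x + A * (T x + 1) + B * (K + 1) * (T x + 1) := by ring
  omega

theorem of_steps_eq_one {f : γ → α} (p : Prog γ α) (h : ∀ x, p.run x = f x)
    (h1 : ∀ x, p.steps x = 1) : Eff D T f :=
  ⟨p, 1, fun x _ => ⟨h x, by rw [h1]; omega⟩⟩

theorem id : Eff D T fun x => x := of_steps_eq_one .id (fun _ => rfl) fun _ => rfl

theorem bit (b : Bool) : Eff D T fun _ => b := of_steps_eq_one (.bit b) (fun _ => rfl) fun _ => rfl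

theorem unit : Eff D T fun _ => () := of_steps_eq_one .unit (fun _ => rfl) fun _ => rfl

theorem nil : Eff D T fun _ => ([] : List α) := of_steps_eq_one .nil (fun _ => rfl) fun _ => rfl

theorem none : Eff D T fun _ => (Option.none : Option α) :=
  of_steps_eq_one .none (fun _ => rfl) fun _ => rfl

/-- A program of one step may be applied to any efficient function. -/
theorem step {f : γ → α} {g : α → β} (hf : Eff D T f) (p : Prog α β)
    (h : ∀ x, p.run x = g x) (h1 : ∀ x, p.steps x = 1) : Eff D T fun x => g (f x) :=
  comp (D' := fun _ => True) (T' := fun _ => 0) (of_steps_eq_one p h h1) hf 0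
    (fun _ _ => trivial) fun _ _ => Nat.zero_le _

theorem fst {f : γ → α × β} (hf : Eff D T f) : Eff D T fun x => (f x).1 :=
  hf.step .fst (fun _ => rfl) fun _ => rfl

theorem snd {f : γ → α × β} (hf : Eff D T f) : Eff D T fun x => (f x).2 :=
  hf.step .snd (fun _ => rfl) fun _ => rfl

theorem some {f : γ → α} (hf : Eff D T f) : Eff D T fun x => Option.some (f x) :=
  hf.step .some (fun _ => rfl) fun _ => rfl

theorem pair {f : γ → α} {g : γ → β} (hf : Eff D T f) (hg : Eff D T g) :
    Eff D T fun x => (f x, g x) := by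
  obtain ⟨p, A, hp⟩ := hf
  obtain ⟨q, B, hq⟩ := hg
  refine ⟨.pair p q, 1 + A + B, fun x hx => ⟨?_, ?_⟩⟩
  · simp [Prog.run, (hp x hx).1, (hq x hx).1]
  · have h1 := (hp x hx).2
    have h2 := (hq x hx).2
    simp only [Prog.steps]
    nlinarith

theorem cons {f : γ → α} {g : γ → List α} (hf : Eff D T f) (hg : Eff D T g) :
    Eff D T fun x => f x :: g x :=
  (hf.pair hg).step .cons (fun _ => rfl) fun _ => rfl

/-- Each branch has to be efficient only on the inputs that reach it. The result `h` is kept apart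
from the branches so that a definition by `if` or `match` can be used as it stands. -/
theorem ite {b : γ → Bool} {f g h : γ → α} (hb : Eff D T b)
    (hf : Eff (fun x => D x ∧ b x = true) T f) (hg : Eff (fun x => D x ∧ b x = false) T g)
    (h1 : ∀ x, D x → b x = true → h x = f x) (h0 : ∀ x, D x → b x = false → h x = g x) :
    Eff D T h := by
  obtain ⟨r, R, hr⟩ := hb
  obtain ⟨p, A, hp⟩ := hf
  obtain ⟨q, B, hq⟩ := hg
  refine ⟨.comp (.pair r .id) (.cond p q), 5 + R + A + B, fun x hx => ?_⟩
  have hrx := hr x hx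
  cases hbx : b x
  · have := hq x ⟨hx, hbx⟩
    simp only [Prog.run, Prog.steps, hrx.1, hbx]
    refine ⟨by rw [h0 x hx hbx, this.1], ?_⟩
    nlinarith
  · have := hp x ⟨hx, hbx⟩
    simp only [Prog.run, Prog.steps, hrx.1, hbx]
    refine ⟨by rw [h1 x hx hbx, this.1], ?_⟩
    nlinarith

theorem uncons {l : γ → List α} {f h : γ → β} {g : α × List α × γ → β} (hl : Eff D T l)
    (hf : Eff (fun x => D x ∧ l x = []) T f)
    (hg : Eff (fun q : α × List α × γ => D q.2.2 ∧ l q.2.2 = q.1 :: q.2.1) (fun q => T q.2.2) g)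
    (h0 : ∀ x, D x → l x = [] → h x = f x)
    (h1 : ∀ x a t, D x → l x = a :: t → h x = g (a, t, x)) : Eff D T h := by
  obtain ⟨r, R, hr⟩ := hl
  obtain ⟨p, A, hp⟩ := hf
  obtain ⟨q, B, hq⟩ := hg
  refine ⟨.comp (.pair r .id) (.uncons p q), 5 + R + A + B, fun x hx => ?_⟩
  have hrx := hr x hx
  cases hlx : l x with
  | nil =>
    have := hp x ⟨hx, hlx⟩
    simp only [Prog.run, Prog.steps, hrx.1, hlx]
    refine ⟨by rw [h0 x hx hlx, this.1], ?_⟩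
    nlinarith
  | cons a t =>
    have := hq (a, t, x) ⟨hx, hlx⟩
    simp only [Prog.run, Prog.steps, hrx.1, hlx]
    refine ⟨by rw [h1 x a t hx hlx, this.1], ?_⟩
    simp only at this
    nlinarith

/-- The body is controlled only on the states that really occur, namely the folds over a prefix of
the list. In the induction `pre` grows by the entry just treated, and `n` is the count of the steps
made so far. -/
theorem loop_aux (p : Prog (α × β × γ) β) (x : γ) (step : β → α → β) (A : ℕ) (l : List α) :
    ∀ (pre : List α) (b : β) (n : ℕ), (∀ pre' a suf, pre ++ l = pre' ++ a :: suf →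
      p.run (a, pre'.foldl step b, x) = step (pre'.foldl step b) a ∧
      p.steps (a, pre'.foldl step b, x) ≤ A) →
    l.foldl (fun s a => p.run (a, s, x)) (pre.foldl step b) = l.foldl step (pre.foldl step b) ∧
    (l.foldl (fun s a => (p.run (a, s.1, x), s.2 + 1 + p.steps (a, s.1, x)))
      (pre.foldl step b, n)).2 ≤ n + l.length * (A + 1) := by
  induction l with
  | nil => intro pre b n _; simp
  | cons a l ih =>
    intro pre b n h
    have h1 := h pre a l rfl
    have h2 := ih (pre ++ [a]) b (n + 1 + p.steps (a, pre.foldl step b, x))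
      (fun pre' a' suf e => h pre' a' suf (by rw [← e]; simp))
    simp only [List.foldl_append, List.foldl_cons, List.foldl_nil] at h2
    simp only [List.foldl_cons, h1.1]
    refine ⟨h2.1, h2.2.trans ?_⟩
    rw [List.length_cons]
    have := h1.2
    nlinarith

/-- In the hypothesis on the body the state is known to be the fold over a prefix of the list. This
bounds the size of states that grow during the loop, as in `blockRows` and `unitVectors`. -/
theorem foldl {l : γ → List α} {b : γ → β} {step : γ → β → α → β} {Tb : γ → ℕ} (K : ℕ)
    (hl : Eff D T l) (hb : Eff D T b)
    (hs : Eff (fun q : α × β × γ => D q.2.2 ∧ ∃ pre suf, l q.2.2 = pre ++ q.1 :: suf ∧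
        q.2.1 = pre.foldl (step q.2.2) (b q.2.2)) (fun q => Tb q.2.2)
      (fun q => step q.2.2 q.2.1 q.1))
    (hT : ∀ x, D x → (l x).length * (Tb x + 1) ≤ K * (T x + 1)) :
    Eff D T fun x => (l x).foldl (step x) (b x) := by
  obtain ⟨r, R, hr⟩ := hl
  obtain ⟨s, S, hs'⟩ := hb
  obtain ⟨p, A, hp⟩ := hs
  refine ⟨.comp (.pair r (.pair s .id)) (.loop p), 10 + R + S + (A + 1) * K, fun x hx => ?_⟩
  have hrx := hr x hx
  have hsx := hs' x hx
  have := loop_aux p x (step x) (A * (Tb x + 1)) (l x) [] (b x) 0 (fun pre a suf e =>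
    hp (a, pre.foldl (step x) (b x), x) ⟨hx, pre, suf, e, rfl⟩)
  simp only [List.foldl_nil] at this
  simp only [Prog.run, Prog.steps, hrx.1, hsx.1]
  refine ⟨this.1, ?_⟩
  have h1 := this.2
  have h2 := hT x hx
  have h3 : (l x).length * (A * (Tb x + 1) + 1) ≤ (A + 1) * (K * (T x + 1)) := by
    refine le_trans ?_ (Nat.mul_le_mul le_rfl h2)
    have : (A + 1) * ((l x).length * (Tb x + 1))
      = (l x).length * (A * (Tb x + 1) + 1) + (l x).length * Tb x := by ring
    omega
  have h4 := hrx.2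
  have h5 := hsx.2
  have : (10 + R + S + (A + 1) * K) * (T x + 1) = 10 * (T x + 1) + R * (T x + 1) + S * (T x + 1)
    + (A + 1) * (K * (T x + 1)) := by ring
  omega

/-- The rule for loops with an invariant. -/
theorem foldl_inv {l : γ → List α} {b : γ → β} {step : γ → β → α → β} {Tb : γ → ℕ} (K : ℕ)
    (I : γ → β → Prop) (hl : Eff D T l) (hb : Eff D T b)
    (hs : Eff (fun q : α × β × γ => D q.2.2 ∧ q.1 ∈ l q.2.2 ∧ I q.2.2 q.2.1) (fun q => Tb q.2.2)
      (fun q => step q.2.2 q.2.1 q.1))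
    (hI0 : ∀ x, D x → I x (b x))
    (hI : ∀ x s a, D x → a ∈ l x → I x s → I x (step x s a))
    (hT : ∀ x, D x → (l x).length * (Tb x + 1) ≤ K * (T x + 1)) :
    Eff D T fun x => (l x).foldl (step x) (b x) := by
  refine foldl K hl hb (hs.restrict ?_) hT
  rintro ⟨a, s, x⟩ ⟨hx, pre, suf, e, hs⟩
  simp only at hx e hs ⊢
  subst hs
  refine ⟨hx, by simp [e], ?_⟩
  have hsub : ∀ a' ∈ pre, a' ∈ l x := fun a' h => by simp [e, h]
  clear e
  induction pre using List.reverseRecOn with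
  | nil => exact hI0 x hx
  | append_singleton pre a' ih =>
    rw [List.foldl_append]
    exact hI x _ _ hx (hsub _ (by simp)) (ih fun a'' h => hsub _ (by simp [h]))

theorem reverse {l : γ → List α} (hl : Eff D T l) (K : ℕ)
    (hT : ∀ x, D x → (l x).length ≤ K * (T x + 1)) : Eff D T fun x => (l x).reverse := by
  refine (foldl_inv (step := fun _ s a => a :: s) (Tb := fun _ => 0) K (fun _ _ => True) hl nil
    (id.fst.cons id.snd.fst) (fun _ _ => trivial) (fun _ _ _ _ _ _ => trivial)
    (by simpa using hT)).congr fun x _ => ?_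
  simp

/-- Append to a reversed list. -/
theorem reverseAppend {l m : γ → List α} (hl : Eff D T l) (hm : Eff D T m) (K : ℕ)
    (hT : ∀ x, D x → (l x).length ≤ K * (T x + 1)) :
    Eff D T fun x => (l x).reverse ++ m x := by
  refine (foldl_inv (step := fun _ s a => a :: s) (Tb := fun _ => 0) K (fun _ _ => True) hl hm
    (id.fst.cons id.snd.fst) (fun _ _ => trivial) (fun _ _ _ _ _ _ => trivial)
    (by simpa using hT)).congr fun x _ => ?_
  simp

/-- Lists can be extended only at the front, so loops build their output backwards; appending is
done by two reversals. -/
theorem append {l m : γ → List α} (hl : Eff D T l) (hm : Eff D T m) (K : ℕ)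
    (hT : ∀ x, D x → (l x).length ≤ K * (T x + 1)) : Eff D T fun x => l x ++ m x :=
  (((hl.reverse K hT).reverseAppend hm K (by simpa using hT))).congr fun x _ => by simp

theorem foldl_reverse_append {g : α → List β} (l : List α) (s : List β) :
    l.foldl (fun s a => (g a).reverse ++ s) s = (l.flatMap g).reverse ++ s := by
  induction l generalizing s with
  | nil => simp
  | cons a l ih => simp [ih]

theorem flatMap {l : γ → List α} {f : γ → α → List β} {Tb : γ → ℕ} (K : ℕ) (hl : Eff D T l)
    (hf : Eff (fun q : α × γ => D q.2 ∧ q.1 ∈ l q.2) (fun q => Tb q.2) fun q => f q.2 q.1)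
    (hlen : ∀ x a, D x → a ∈ l x → (f x a).length ≤ Tb x + 1)
    (hT : ∀ x, D x → (l x).length * (Tb x + 1) ≤ K * (T x + 1)) :
    Eff D T fun x => (l x).flatMap (f x) := by
  have h1 : Eff D T fun x => (l x).foldl (fun s a => (f x a).reverse ++ s) [] := by
    refine foldl_inv (Tb := Tb) K (fun _ _ => True) hl nil ?_
      (fun _ _ => trivial) (fun _ _ _ _ _ _ => trivial) hT
    refine reverseAppend (hf.comp (id.fst.pair id.snd.snd) 1 (fun q hq => ⟨hq.1, hq.2.1⟩)
      fun q hq => by simp) id.snd.fst 1 ?_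
    rintro ⟨a, s, x⟩ ⟨hx, ha, -⟩
    simpa using hlen x a hx ha
  have h2 : ∀ x, D x → ((l x).flatMap (f x)).length ≤ K * (T x + 1) := fun x hx => by
    refine le_trans ?_ (hT x hx)
    rw [List.length_flatMap]
    have := List.sum_le_card_nsmul ((l x).map fun a => (f x a).length) (Tb x + 1) (by
      simp only [List.mem_map]
      rintro _ ⟨a, ha, rfl⟩
      exact hlen x a hx ha)
    simpa using this
  refine (h1.reverse K fun x hx => ?_).congr fun x hx => ?_
  · rw [foldl_reverse_append]; simpa using h2 x hx
  · rw [foldl_reverse_append]; simp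

theorem map {l : γ → List α} {f : γ → α → β} {Tb : γ → ℕ} (K : ℕ) (hl : Eff D T l)
    (hf : Eff (fun q : α × γ => D q.2 ∧ q.1 ∈ l q.2) (fun q => Tb q.2) fun q => f q.2 q.1)
    (hT : ∀ x, D x → (l x).length * (Tb x + 1) ≤ K * (T x + 1)) :
    Eff D T fun x => (l x).map (f x) := by
  refine (flatMap (f := fun x a => [f x a]) K hl (hf.cons nil) (fun x a _ _ => by simp)
    hT).congr fun x _ => ?_
  induction l x with
  | nil => rfl
  | cons a l ih => simp only [List.map_cons, List.flatMap_cons, ih]; rfl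

theorem tail {l : γ → List α} (hl : Eff D T l) : Eff D T fun x => (l x).tail :=
  uncons hl nil id.snd.fst (fun x _ h => by simp [h]) fun x a t _ h => by simp [h]

theorem headD {l : γ → List α} {d : γ → α} (hl : Eff D T l) (hd : Eff D T d) :
    Eff D T fun x => (l x).headD (d x) :=
  uncons hl (hd.restrict fun _ h => h.1) id.fst (fun x _ h => by simp [h])
    fun x a t _ h => by simp [h]

theorem isEmpty {l : γ → List α} (hl : Eff D T l) : Eff D T fun x => (l x).isEmpty :=
  uncons hl (bit true) (bit false) (fun x _ h => by simp [h]) fun x a t _ h => by simp [h]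

theorem and {f g : γ → Bool} (hf : Eff D T f) (hg : Eff D T g) :
    Eff D T fun x => f x && g x :=
  ite hf (hg.restrict fun _ h => h.1) (bit false) (fun x _ h => by simp [h])
    fun x _ h => by simp [h]

theorem not {f : γ → Bool} (hf : Eff D T f) : Eff D T fun x => !(f x) :=
  ite hf (bit false) (bit true) (fun x _ h => by simp [h]) fun x _ h => by simp [h]

theorem or {f g : γ → Bool} (hf : Eff D T f) (hg : Eff D T g) :
    Eff D T fun x => f x || g x :=
  ite hf (bit true) (hg.restrict fun _ h => h.1) (fun x _ h => by simp [h])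
    fun x _ h => by simp [h]

theorem xor {f g : γ → Bool} (hf : Eff D T f) (hg : Eff D T g) :
    Eff D T fun x => Bool.xor (f x) (g x) :=
  ite hf (hg.not.restrict fun _ h => h.1) (hg.restrict fun _ h => h.1)
    (fun x _ h => by simp [h]) fun x _ h => by simp [h]

/-- Dropping as many entries as another list has. -/
theorem drop {u : γ → List α} {l : γ → List β} (hu : Eff D T u) (hl : Eff D T l) (K : ℕ)
    (hT : ∀ x, D x → (u x).length ≤ K * (T x + 1)) :
    Eff D T fun x => (l x).drop (u x).length := by
  refine (foldl_inv (step := fun _ s (_ : α) => s.tail) (Tb := fun _ => 0) K (fun _ _ => True)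
    hu hl id.snd.fst.tail (fun _ _ => trivial) (fun _ _ _ _ _ _ => trivial)
    (by simpa using hT)).congr fun x _ => ?_
  generalize u x = v
  generalize l x = m
  induction v generalizing m with
  | nil => simp
  | cons a v ih => rw [List.foldl_cons, ← ih]; simp

/-- Taking as many entries as another list has. -/
theorem take {u : γ → List α} {l : γ → List β} (hu : Eff D T u) (hl : Eff D T l) (K : ℕ)
    (hT : ∀ x, D x → (u x).length ≤ K * (T x + 1)) :
    Eff D T fun x => (l x).take (u x).length := by
  have key : ∀ (v : List α) (m : List β) (s : List β),
      (v.foldl (fun (s : List β × List β) (_ : α) => (s.1.tail, s.1.take 1 ++ s.2)) (m, s)).2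
        = (m.take v.length).reverse ++ s := by
    intro v
    induction v with
    | nil => simp
    | cons a v ih =>
      intro m s
      rw [List.foldl_cons, ih]
      cases m <;> simp
  have h1 : Eff D T fun x => ((u x).foldl (fun (s : List β × List β) (_ : α) =>
      (s.1.tail, s.1.take 1 ++ s.2)) (l x, [])) := by
    refine foldl_inv (Tb := fun _ => 0) K (fun _ _ => True) hu (hl.pair nil)
      (id.snd.fst.fst.tail.pair ?_) (fun _ _ => trivial) (fun _ _ _ _ _ _ => trivial)
      (by simpa using hT)
    exact uncons id.snd.fst.fst (id.snd.fst.snd.restrict fun _ h => h.1)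
      (id.fst.cons id.snd.snd.snd.fst.snd)
      (fun x _ h => by simp [h]) fun x a t _ h => by simp [h]
  refine (h1.snd.reverse K fun x hx => ?_).congr fun x _ => ?_
  · rw [key]; simp only [List.append_nil, List.length_reverse, List.length_take]
    exact (min_le_left _ _).trans (hT x hx)
  · rw [key]; simp

theorem foldl_zipWith_aux (f : α → β → δ) (l : List α) : ∀ (m : List β) (s : List δ),
    (l.foldl (fun (s : List β × List δ) a =>
      (s.1.tail, (s.1.take 1).map (f a) ++ s.2)) (m, s)).2
      = (List.zipWith f l m).reverse ++ s := by
  induction l with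
  | nil => simp
  | cons a l ih =>
    intro m s
    rw [List.foldl_cons, ih]
    cases m <;> simp

theorem zipWith {l : γ → List α} {m : γ → List β} {f : γ → α → β → δ} {Tb : γ → ℕ} (K : ℕ)
    (hl : Eff D T l) (hm : Eff D T m)
    (hf : Eff (fun q : α × β × γ => D q.2.2 ∧ q.1 ∈ l q.2.2 ∧ q.2.1 ∈ m q.2.2)
      (fun q => Tb q.2.2) fun q => f q.2.2 q.1 q.2.1)
    (hT : ∀ x, D x → (l x).length * (Tb x + 1) ≤ K * (T x + 1)) :
    Eff D T fun x => List.zipWith (f x) (l x) (m x) := by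
  have h1 : Eff D T fun x => ((l x).foldl (fun (s : List β × List δ) a =>
      (s.1.tail, (s.1.take 1).map (f x a) ++ s.2)) (m x, [])) := by
    refine foldl_inv (Tb := Tb) K (fun x s => ∀ b ∈ s.1, b ∈ m x) hl (hm.pair nil)
      (id.snd.fst.fst.tail.pair ?_) (fun _ _ _ h => h)
      (fun x s a _ _ h b hb => h b (List.mem_of_mem_tail hb)) hT
    refine uncons id.snd.fst.fst (id.snd.fst.snd.restrict fun _ h => h.1)
      (Eff.cons (hf.comp (f := fun q => (q.2.2.1, q.1, q.2.2.2.2))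
        (id.snd.snd.fst.pair (id.fst.pair id.snd.snd.snd.snd)) 1 ?_ ?_) id.snd.snd.snd.fst.snd)
      (fun x _ h => by simp [h]) fun x a t _ h => by simp [h]
    · rintro ⟨b, t, a, s, x⟩ ⟨⟨hx, ha, hI⟩, e⟩
      simp only at hx ha hI e ⊢
      exact ⟨hx, ha, hI b (by simp [e])⟩
    · rintro ⟨b, t, a, s, x⟩ -
      simp
  refine (h1.snd.reverse K fun x hx => ?_).congr fun x _ => ?_
  · rw [foldl_zipWith_aux]; simp only [List.append_nil, List.length_reverse, List.length_zipWith]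
    refine (min_le_left _ _).trans (le_trans ?_ (hT x hx))
    nlinarith
  · rw [foldl_zipWith_aux]; simp

theorem all {l : γ → List α} {f : γ → α → Bool} {Tb : γ → ℕ} (K : ℕ) (hl : Eff D T l)
    (hf : Eff (fun q : α × γ => D q.2 ∧ q.1 ∈ l q.2) (fun q => Tb q.2) fun q => f q.2 q.1)
    (hT : ∀ x, D x → (l x).length * (Tb x + 1) ≤ K * (T x + 1)) :
    Eff D T fun x => (l x).all (f x) := by
  have h1 : Eff D T fun x => (l x).foldl (fun s a => s && f x a) true := by
    refine foldl_inv (Tb := Tb) K (fun _ _ => True) hl (bit true) ?_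
      (fun _ _ => trivial) (fun _ _ _ _ _ _ => trivial) hT
    exact Eff.and id.snd.fst (hf.comp (id.fst.pair id.snd.snd) 1 (fun q hq => ⟨hq.1, hq.2.1⟩)
      fun q hq => by simp)
  refine h1.congr fun x _ => ?_
  have : ∀ (m : List α) (b : Bool), m.foldl (fun s a => s && f x a) b = (b && m.all (f x)) := by
    intro m
    induction m with
    | nil => simp
    | cons a m ih => intro b; rw [List.foldl_cons, ih]; simp [Bool.and_assoc]
  simp [this]

/-- Comparison of strings. -/
theorem beqBool {l m : γ → List Bool} (hl : Eff D T l) (hm : Eff D T m) (K : ℕ)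
    (hT : ∀ x, D x → (l x).length ≤ K * (T x + 1)) : Eff D T fun x => l x == m x := by
  -- The state is the unread rest of `m` together with the verdict so far. The default in `headD` is
  -- harmless, as an empty rest already makes the verdict `false`.
  have h1 : Eff D T fun x => (l x).foldl (fun (s : List Bool × Bool) a =>
      (s.1.tail, s.2 && !s.1.isEmpty && !(Bool.xor a (s.1.headD false)))) (m x, true) := by
    refine foldl_inv (Tb := fun _ => 0) K (fun _ _ => True) hl (hm.pair (bit true))
      (id.snd.fst.fst.tail.pair ((id.snd.fst.snd.and id.snd.fst.fst.isEmpty.not).and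
        (id.fst.xor (id.snd.fst.fst.headD (bit false))).not))
      (fun _ _ => trivial) (fun _ _ _ _ _ _ => trivial) (by simpa using hT)
  refine (h1.snd.and h1.fst.isEmpty).congr fun x _ => ?_
  have key : ∀ (l m : List Bool) (b : Bool),
      ((l.foldl (fun (s : List Bool × Bool) a =>
        (s.1.tail, s.2 && !s.1.isEmpty && !(Bool.xor a (s.1.headD false)))) (m, b)).2 &&
      (l.foldl (fun (s : List Bool × Bool) a =>
        (s.1.tail, s.2 && !s.1.isEmpty && !(Bool.xor a (s.1.headD false)))) (m, b)).1.isEmpty)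
      = (b && (l == m)) := by
    intro l
    induction l with
    | nil => intro m b; cases m <;> simp
    | cons a l ih =>
      intro m b
      rw [List.foldl_cons, ih]
      cases m with
      | nil => simp
      | cons a' m => cases a <;> cases a' <;> simp
  rw [key]; simp

/-- The test for being a subsequence. -/
theorem isSublist {l m : γ → List Bool} (hl : Eff D T l) (hm : Eff D T m) (K : ℕ)
    (hT : ∀ x, D x → (m x).length ≤ K * (T x + 1)) : Eff D T fun x => (l x).isSublist (m x) := by
  -- Greedy matching: the state is the part of `l` not yet matched, and its head is matched at the
  -- first opportunity. Success means that nothing is left.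
  have h1 : Eff D T fun x => (m x).foldl (fun (s : List Bool) a =>
      if !s.isEmpty && !(Bool.xor a (s.headD false)) then s.tail else s) (l x) := by
    refine foldl_inv (Tb := fun _ => 0) K (fun _ _ => True) hm hl
      (ite (id.snd.fst.isEmpty.not.and (id.fst.xor (id.snd.fst.headD (bit false))).not)
        id.snd.fst.tail id.snd.fst (fun x _ h => by rw [if_pos h]) fun x _ h => by
          rw [if_neg (by rw [h]; simp)])
      (fun _ _ => trivial) (fun _ _ _ _ _ _ => trivial) (by simpa using hT)
  refine h1.isEmpty.congr fun x _ => ?_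
  generalize l x = l
  generalize m x = m
  induction m generalizing l with
  | nil => cases l <;> simp [List.isSublist]
  | cons a m ih =>
    rw [List.foldl_cons, ← ih]
    cases l with
    | nil => cases m <;> simp [List.isSublist]
    | cons b l => cases a <;> cases b <;> simp [List.isSublist]

end Eff

end GC

namespace GC

/-! ## The algorithms on lists -/

/-- The sum of two strings of bits over the field with two elements. -/
def xorList (a b : List Bool) : List Bool := List.zipWith Bool.xor a b

/-- The bits of `α * s` for a symbol `s`, where `m` holds the lower coefficients of the modulus. -/
def mulRoot (m s : List Bool) : List Bool :=
  if s.headD false = true then xorList (s.tail ++ [false]) m else s.tail ++ [false]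

/-- The parity bits contributed by the single bits of one block, where `g` is the row of the
generator matrix belonging to this block. -/
def blockRows (m : List Bool) (g : List (List Bool)) : List (List Bool) :=
  (m.foldl (fun s _ => (s.1.map (mulRoot m), s.1.flatten :: s.2))
    (g, ([] : List (List Bool)))).2

/-- Add to `S` the entries of `R` selected by `u`. -/
def addRows (S u : List Bool) (R : List (List Bool)) : List Bool :=
  (List.zipWith Prod.mk u R).foldl (fun S q => if q.1 = true then xorList S q.2 else S) S

/-- A map along a list with a state that is updated on the way. -/
def mapAccum {σ α β : Type} (next : σ → α → σ) (out : σ → α → β) : σ → List α → List β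
  | _, [] => []
  | s, a :: l => out s a :: mapAccum next out (next s a) l

/-- `n` copies of a list, appended to each other. -/
def copies {α : Type} (n : ℕ) (l : List α) : List α := (List.replicate n l).flatten

/-- The encoder on lists. -/
def encodeList (z c : ℕ) (w : List Unit) (m : List Bool) (gen : List (List (List Bool)))
    (u : List Bool) : List Bool :=
  u ++ (addRows ((copies c m).map fun _ => false) u (gen.flatMap (blockRows m))).flatMap
    fun b => (() :: copies z w).map fun _ => b

/-! ### Elimination over the field with two elements -/

/-- One row in an elimination step. The state consists of the pivot row, if it has been found, and
of the rows with the first entry eliminated. -/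
def elimRow (s : List (List Bool) × List (List Bool)) (v : List Bool) :
    List (List Bool) × List (List Bool) :=
  if v.headD false = true then
    match s.1 with
    | [] => ([v.tail], s.2)
    | p :: t => (p :: t, xorList v.tail p :: s.2)
  else (s.1, v.tail :: s.2)

/-- One elimination step with rows and a target. -/
def elimStep (st : List (List Bool) × List Bool) : List (List Bool) × List Bool :=
  ((st.1.foldl elimRow ([], [])).2,
    if st.2.headD false = true then
      match (st.1.foldl elimRow ([], [])).1 with
      | [] => st.2.tail
      | p :: _ => xorList st.2.tail p
    else st.2.tail)

/-- The zero vector and the unit vectors of the length of a given list. -/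
def unitVectors {α : Type} (l : List α) : List Bool × List (List Bool) :=
  l.foldl (fun s _ => (false :: s.1, (true :: s.1) :: s.2.map (false :: ·))) ([], [])

/-- A string which selects rows with sum `S`, if there is one. -/
def solve (R : List (List Bool)) (S : List Bool) : List Bool :=
  (S.foldl (fun st _ => elimStep st)
    (List.zipWith (· ++ ·) R (unitVectors R).2, S ++ (unitVectors R).1)).2

/-! ### The enumeration of the guesses -/

/-- A guess in the form used by the algorithm: for each block whether it is erased, and the number
of bits deleted in the windows that start with this block. -/
abbrev Plan : Type := List (Bool × List Unit)

/-- All numbers up to a given one. -/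
def dels (w : List Unit) : List (List Unit) :=
  w.foldl (fun s _ => (() :: s.headD []) :: s) [[]]

/-- The trivial plan and the plans for a single window. -/
def singlePlans {α : Type} (w : List Unit) (B : List α) : Plan × List Plan :=
  B.foldl (fun s _ => ((false, []) :: s.1,
    ((dels w).flatMap fun m =>
      if s.1.isEmpty = true then [] else [(true, m) :: (true, []) :: s.1.tail]) ++
    s.2.map ((false, []) :: ·))) ([], [])

/-- The superposition of two plans. -/
def combine (P Q : Plan) : Plan := List.zipWith (fun a b => (a.1 || b.1, a.2 ++ b.2)) P Q

/-- The plans for a number of windows. -/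
def plans {α : Type} (w : List Unit) (B : List α) : ℕ → List Plan
  | 0 => [(singlePlans w B).1]
  | z + 1 => (singlePlans w B).2.flatMap fun P => (plans w B z).map (combine P)

/-! ### The treatment of a guess -/

/-- Shorten a list of blocks to a given total length. -/
def cutBlocks {α : Type} (k : List Unit) (B : List (List α)) : List (List α) :=
  mapAccum (fun k b => k.drop b.length) (fun k b => b.take k.length) k B

/-- A block with the information whether it is erased, its rows, and the received bits. -/
abbrev Item : Type := Bool × List (List Bool) × List Bool

/-- Chunk the received string. -/
def chunk (y : List Bool) (P : Plan) (B : List (List (List Bool))) : List Item :=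
  mapAccum (fun y q => y.drop (q.2.drop q.1.2.length).length)
    (fun y q => (q.1.1, q.2, y.take (q.2.drop q.1.2.length).length)) y (List.zipWith Prod.mk P B)

/-- Subtract the contribution of the blocks that are not erased. -/
def knownPart (S : List Bool) (I : List Item) : List Bool :=
  I.foldl (fun S q => if q.1 = true then S else addRows S q.2.2 q.2.1) S

/-- The rows of the erased blocks. -/
def unknownRows (I : List Item) : List (List Bool) :=
  I.flatMap fun q => if q.1 = true then q.2.1 else []

/-- Fill in the erased blocks. -/
def fill (s : List Bool) (I : List Item) : List (Bool × List Bool × List Bool) :=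
  mapAccum (fun s q => if q.1 = true then s.drop q.2.1.length else s)
    (fun s q => (q.1, q.2.2, if q.1 = true then s.take q.2.1.length else q.2.2)) s I

/-- One block in the check of the runs of erased blocks. -/
def runStep (s : Bool × List Bool × List Bool) (q : Bool × List Bool × List Bool) :
    Bool × List Bool × List Bool :=
  if q.1 = true then (s.1, s.2.1 ++ q.2.1, s.2.2 ++ q.2.2)
  else (s.1 && s.2.1.isSublist s.2.2, [], [])

/-- Check the runs of erased blocks. -/
def runsOk (I : List (Bool × List Bool × List Bool)) : Bool :=
  (I.foldl runStep (true, [], [])).1 &&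
    (I.foldl runStep (true, [], [])).2.1.isSublist (I.foldl runStep (true, [], [])).2.2

/-- The result of decoding with a guess: the decoded string, if the guess is possible. -/
def tryItems (par : List Bool) (I : List Item) : List (List Bool) :=
  if ((addRows (knownPart par I) (solve (unknownRows I) (knownPart par I)) (unknownRows I)).all
      (fun b => !b) && runsOk (fill (solve (unknownRows I) (knownPart par I)) I)) = true
  then [(fill (solve (unknownRows I) (knownPart par I)) I).flatMap fun q => q.2.2] else []

/-- The result of decoding with a plan, where `d` is the number of missing bits. -/
def tryPlan (B : List (List (List Bool))) (par : List Bool) (d : List Unit) (y : List Bool)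
    (P : Plan) : List (List Bool) :=
  if ((P.flatMap Prod.snd).drop d.length).isEmpty = true then tryItems par (chunk y P B) else []

/-- The common value of the entries of a list. -/
def agree : List (List Bool) → Option (List Bool)
  | [] => none
  | v :: t => if (t.all fun v' => v == v') = true then some v else none

/-- The parity bits from the received string, starting at the first one. -/
def readParity (z c : ℕ) (w : List Unit) (m : List Bool) (y : List Bool) : List Bool :=
  mapAccum (fun y _ => y.drop (() :: copies z w).length) (fun y _ => y.headD false) y (copies c m)

/-- The decoded strings of the possible cases. -/
def candidates (z c : ℕ) (w : List Unit) (m : List Bool) (gen : List (List (List Bool)))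
    (k : List Unit) (y : List Bool) : List (List Bool) :=
  (plans w gen z).flatMap (tryPlan (cutBlocks k (gen.map (blockRows m)))
    (readParity z c w m (y.drop k.length))
    ((k ++ (copies c m).flatMap fun _ => () :: copies z w).drop y.length) y)

end GC

/-! ### Sizes and running times of the basic operations on strings -/

namespace GC

theorem length_mapAccum {σ α β : Type} (next : σ → α → σ) (out : σ → α → β) (l : List α) :
    ∀ s, (mapAccum next out s l).length = l.length := by
  induction l with
  | nil => intro s; rfl
  | cons a l ih => intro s; simp [mapAccum, ih]

theorem length_copies {α : Type} (n : ℕ) (l : List α) :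
    (copies n l).length = n * l.length := by simp [copies]

theorem length_xorList (a b : List Bool) : (xorList a b).length = min a.length b.length := by
  simp [xorList]

theorem length_mulRoot {m s : List Bool} (h : s.length = m.length) (hm : m ≠ []) :
    (mulRoot m s).length = m.length := by
  have : 0 < m.length := List.length_pos_iff.2 hm
  unfold mulRoot
  split
  · simp only [length_xorList, List.length_append, List.length_tail, List.length_singleton]
    omega
  · simp only [List.length_append, List.length_tail, List.length_singleton]
    omega

namespace Eff

variable {α β γ δ : Type} {D : γ → Prop} {T : γ → ℕ}

theorem zipPair {l : γ → List α} {m : γ → List β} (K : ℕ) (hl : Eff D T l) (hm : Eff D T m)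
    (hT : ∀ x, D x → (l x).length ≤ K * (T x + 1)) :
    Eff D T fun x => List.zipWith Prod.mk (l x) (m x) :=
  zipWith (f := fun _ a b => (a, b)) (Tb := fun _ => 0) K hl hm (id.fst.pair id.snd.fst)
    (by simpa using hT)

theorem mapAccum {σ : Type} {l : γ → List α} {s : γ → σ} {next : γ → σ → α → σ}
    {out : γ → σ → α → β} {Tb : γ → ℕ} (K : ℕ) (hl : Eff D T l) (hs : Eff D T s)
    (hn : Eff (fun q : α × σ × γ => D q.2.2 ∧ q.1 ∈ l q.2.2) (fun q => Tb q.2.2)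
      fun q => next q.2.2 q.2.1 q.1)
    (ho : Eff (fun q : α × σ × γ => D q.2.2 ∧ q.1 ∈ l q.2.2) (fun q => Tb q.2.2)
      fun q => out q.2.2 q.2.1 q.1)
    (hT : ∀ x, D x → (l x).length * (Tb x + 1) ≤ K * (T x + 1)) :
    Eff D T fun x => GC.mapAccum (next x) (out x) (s x) (l x) := by
  have h1 : Eff D T fun x => (l x).foldl (fun (t : σ × List β) a =>
      (next x t.1 a, out x t.1 a :: t.2)) (s x, []) := by
    have hr : Eff (fun q : α × (σ × List β) × γ => D q.2.2 ∧ q.1 ∈ l q.2.2 ∧ True)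
        (fun q => Tb q.2.2) fun q => (q.1, q.2.1.1, q.2.2) :=
      id.fst.pair (id.snd.fst.fst.pair id.snd.snd)
    exact foldl_inv (Tb := Tb) K (fun _ _ => True) hl (hs.pair nil)
      ((hn.comp hr 1 (fun q hq => ⟨hq.1, hq.2.1⟩) fun q _ => by simp).pair
        ((ho.comp hr 1 (fun q hq => ⟨hq.1, hq.2.1⟩) fun q _ => by simp).cons id.snd.fst.snd))
      (fun _ _ => trivial) (fun _ _ _ _ _ _ => trivial) hT
  have key : ∀ x (l : List α) (s : σ) (o : List β), (l.foldl (fun (t : σ × List β) a =>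
      (next x t.1 a, out x t.1 a :: t.2)) (s, o)).2
      = (GC.mapAccum (next x) (out x) s l).reverse ++ o := by
    intro x l
    induction l with
    | nil => intro s o; rfl
    | cons a l ih => intro s o; rw [List.foldl_cons, ih]; simp [GC.mapAccum]
  refine (h1.snd.reverse K fun x hx => ?_).congr fun x _ => ?_
  · rw [key]
    simp only [List.append_nil, List.length_reverse, length_mapAccum]
    refine le_trans ?_ (hT x hx)
    nlinarith
  · rw [key]; simp

theorem copies (n : ℕ) {l : γ → List α} (hl : Eff D T l) (K : ℕ)
    (hT : ∀ x, D x → (l x).length ≤ K * (T x + 1)) : Eff D T fun x => GC.copies n (l x) := by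
  induction n with
  | zero => exact nil.congr fun x _ => by simp [GC.copies]
  | succ n ih =>
    exact (hl.append ih K hT).congr fun x _ => by simp [GC.copies, List.replicate_succ]

theorem xorList {l m : γ → List Bool} (hl : Eff D T l) (hm : Eff D T m) (K : ℕ)
    (hT : ∀ x, D x → (l x).length ≤ K * (T x + 1)) :
    Eff D T fun x => GC.xorList (l x) (m x) :=
  zipWith (f := fun _ a b => Bool.xor a b) (Tb := fun _ => 0) K hl hm (id.fst.xor id.snd.fst)
    (by simpa using hT)

theorem constMap {l : γ → List α} {b : γ → β} (hl : Eff D T l) (hb : Eff D (fun _ => 0) b) (K : ℕ)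
    (hT : ∀ x, D x → (l x).length ≤ K * (T x + 1)) : Eff D T fun x => (l x).map fun _ => b x :=
  map (f := fun x _ => b x) (Tb := fun _ => 0) K hl
    (hb.comp id.snd 1 (fun _ h => h.1) fun _ _ => by simp) (by simpa using hT)

theorem mulRoot {m s : γ → List Bool} (hm : Eff D T m) (hs : Eff D T s) (K : ℕ)
    (hT : ∀ x, D x → (s x).length ≤ K * (T x + 1)) :
    Eff D T fun x => GC.mulRoot (m x) (s x) := by
  have h1 : Eff D T fun x => (s x).tail ++ [false] :=
    hs.tail.append ((bit false).cons nil) K fun x hx => by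
      have := hT x hx
      rw [List.length_tail]; omega
  refine ite (hs.headD (bit false)) ((h1.xorList hm (K + 1) fun x hx => ?_).restrict fun _ h => h.1)
    (h1.restrict fun _ h => h.1) (fun x _ h => by simp only [GC.mulRoot, h, if_true])
    fun x _ h => by rw [GC.mulRoot, if_neg (by rw [h]; simp)]
  have := hT x hx
  simp only [List.length_append, List.length_tail, List.length_singleton]
  have h2 : (K + 1) * (T x + 1) = K * (T x + 1) + (T x + 1) := by ring
  omega

theorem length_foldl_addRows (L : List (Bool × List Bool)) : ∀ S : List Bool,
    (L.foldl (fun S q => if q.1 = true then GC.xorList S q.2 else S) S).length ≤ S.length := by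
  induction L with
  | nil => intro S; exact le_rfl
  | cons q L ih =>
    intro S
    rw [List.foldl_cons]
    refine (ih _).trans ?_
    split
    · simp [length_xorList]
    · exact le_rfl

theorem _root_.GC.length_addRows_le (S u : List Bool) (R : List (List Bool)) :
    (addRows S u R).length ≤ S.length := length_foldl_addRows _ _

theorem addRows {S u : γ → List Bool} {R : γ → List (List Bool)} (hS : Eff D T S)
    (hu : Eff D T u) (hR : Eff D T R) (K : ℕ)
    (hT : ∀ x, D x → (u x).length * ((S x).length + 1) ≤ K * (T x + 1)) :
    Eff D T fun x => GC.addRows (S x) (u x) (R x) := by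
  refine foldl_inv (Tb := fun x => (S x).length) K (fun x s => s.length ≤ (S x).length)
    (hu.zipPair K hR fun x hx => ?_) hS ?_ (fun _ _ => le_rfl) ?_ ?_
  · have := hT x hx; nlinarith
  · refine ite id.fst.fst ?_ (id.snd.fst) (fun x _ h => if_pos h)
      fun x _ h => if_neg (by rw [h]; simp)
    exact id.snd.fst.xorList id.fst.snd 1 fun x hx => by have := hx.1.2.2; omega
  · intro x s a _ _ hs
    split
    · rw [length_xorList]; omega
    · exact hs
  · intro x hx
    refine le_trans (Nat.mul_le_mul ?_ le_rfl) (hT x hx)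
    simp

end Eff

/-! ### The encoder -/

theorem blockRows_aux {m : List Bool} {g : List (List Bool)} (hm : m ≠ [])
    (hg : ∀ s ∈ g, s.length = m.length) (l : List Bool) : ∀ o : List (List Bool),
    let s := l.foldl (fun (s : List (List Bool) × List (List Bool)) _ =>
      (s.1.map (mulRoot m), s.1.flatten :: s.2)) (g, o)
    s.1.length = g.length ∧ (∀ t ∈ s.1, t.length = m.length) ∧
      s.2.length = l.length + o.length ∧
      ((∀ r ∈ o, r.length = g.length * m.length) → ∀ r ∈ s.2, r.length = g.length * m.length) := by
  induction l generalizing g with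
  | nil => intro o; simpa using hg
  | cons a l ih =>
    intro o
    have := ih (g := g.map (mulRoot m)) (by
      intro s hs
      obtain ⟨t, ht, rfl⟩ := List.mem_map.1 hs
      exact length_mulRoot (hg t ht) hm) (g.flatten :: o)
    simp only [List.length_map, List.length_cons, List.foldl_cons] at this ⊢
    refine ⟨this.1, this.2.1, by omega, fun h => this.2.2.2 ?_⟩
    intro r hr
    rcases List.mem_cons.1 hr with rfl | hr
    · rw [List.length_flatten, List.map_congr_left hg]
      simp
    · exact h r hr

theorem length_blockRows {m : List Bool} {g : List (List Bool)} (hm : m ≠ [])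
    (hg : ∀ s ∈ g, s.length = m.length) : (blockRows m g).length = m.length := by
  exact (blockRows_aux hm hg m []).2.2.1

theorem length_of_mem_blockRows {m : List Bool} {g : List (List Bool)} (hm : m ≠ [])
    (hg : ∀ s ∈ g, s.length = m.length) {r : List Bool} (hr : r ∈ blockRows m g) :
    r.length = g.length * m.length :=
  (blockRows_aux hm hg m []).2.2.2 (by simp) r hr

namespace Eff

variable {α β γ δ : Type} {D : γ → Prop} {T : γ → ℕ}

theorem blockRows (c : ℕ) {m : γ → List Bool} {g : γ → List (List Bool)} (hm : Eff D T m)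
    (hg : Eff D T g) (h0 : ∀ x, D x → m x ≠ []) (hc : ∀ x, D x → (g x).length = c)
    (hgl : ∀ x, D x → ∀ s ∈ g x, s.length = (m x).length) (K : ℕ)
    (hT : ∀ x, D x → (m x).length ^ 2 ≤ K * (T x + 1)) :
    Eff D T fun x => GC.blockRows (m x) (g x) := by
  suffices h : Eff (fun q : List Bool × List (List Bool) => q.1 ≠ [] ∧ q.2.length = c ∧
      ∀ s ∈ q.2, s.length = q.1.length) (fun q => q.1.length ^ 2)
      fun q => GC.blockRows q.1 q.2 from
    h.comp (hm.pair hg) K (fun x hx => ⟨h0 x hx, hc x hx, hgl x hx⟩) hT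
  -- With `n` the length of `m`, there are `n` rounds, each of which multiplies and copies `c`
  -- symbols of `n` bits.
  refine snd (foldl (Tb := fun q => (c + 2) * (q.1.length + 1)) (4 * (c + 2)) id.fst
    (id.snd.pair nil) ?_ ?_)
  · have hin : ∀ q : Bool × (List (List Bool) × List (List Bool)) ×
        (List Bool × List (List Bool)),
        ((q.2.2.1 ≠ [] ∧ q.2.2.2.length = c ∧ ∀ s ∈ q.2.2.2, s.length = q.2.2.1.length) ∧
        ∃ pre suf, q.2.2.1 = pre ++ q.1 :: suf ∧ q.2.1 = pre.foldl
          (fun s _ => (s.1.map (GC.mulRoot q.2.2.1), s.1.flatten :: s.2)) (q.2.2.2, [])) →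
        q.2.1.1.length = c ∧ ∀ t ∈ q.2.1.1, t.length = q.2.2.1.length := by
      rintro ⟨a, s, m, g⟩ ⟨⟨h1, h2, h3⟩, pre, suf, e, hs⟩
      simp only at h1 h2 h3 e hs ⊢
      have := blockRows_aux h1 h3 pre []
      rw [← hs] at this
      exact ⟨this.1.trans h2, this.2.1⟩
    refine Eff.pair ?_ (Eff.cons ?_ id.snd.fst.snd)
    · refine map (f := fun (q : Bool × (List (List Bool) × List (List Bool)) ×
        (List Bool × List (List Bool))) s => GC.mulRoot q.2.2.1 s)
        (Tb := fun q => q.2.2.1.length) 1 id.snd.fst.fst ?_ ?_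
      · refine mulRoot id.snd.snd.snd.fst id.fst 1 ?_
        rintro ⟨s, q⟩ ⟨hq, hs⟩
        have := (hin q hq).2 s hs
        simp only
        omega
      · intro q hq
        rw [(hin q hq).1]
        nlinarith
    · refine (flatMap (f := fun _ (s : List Bool) => s) (Tb := fun q => q.2.2.1.length) 1
        id.snd.fst.fst id.fst ?_ ?_).congr (g := fun (q : Bool × (List (List Bool) ×
          List (List Bool)) × (List Bool × List (List Bool))) => q.2.1.1.flatten) fun q _ => by
          simp [List.flatMap]
      · intro q s hq hs
        have := (hin q hq).2 s hs
        omega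
      · intro q hq
        rw [(hin q hq).1]
        nlinarith
  · rintro q ⟨h1, -, -⟩
    have := List.length_pos_iff.2 h1
    generalize q.1.length = n at *
    have h2 : n ≤ n ^ 2 := by nlinarith
    have h3 : n * ((c + 2) * (n + 1) + 1) ≤ (c + 2) * (3 * n ^ 2) := by
      nlinarith [Nat.mul_le_mul (Nat.le_refl (c + 2)) h2]
    nlinarith

/-- The domain records what holds for long messages: `w ≤ ℓ`, `ℓ ^ 2 ≤ 4 * k`, and `B * ℓ ≤ 2 * k`
for `B` blocks. Producing the rows costs `B * ℓ ^ 2`, adding them costs `k * ℓ`, and the repetition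
of the parity bits costs only `O(ℓ ^ 2)`. -/
theorem encodeList (z c : ℕ) :
    Eff (fun q : (List Unit × List Bool × List (List (List Bool))) × List Bool =>
      q.1.2.1 ≠ [] ∧ q.1.1.length ≤ q.1.2.1.length ∧ q.1.2.1.length ^ 2 ≤ 4 * q.2.length ∧
      q.1.2.2.length * q.1.2.1.length ≤ 2 * q.2.length ∧
      ∀ g ∈ q.1.2.2, g.length = c ∧ ∀ s ∈ g, s.length = q.1.2.1.length)
    (fun q => q.2.length * q.1.2.1.length)
    fun q => GC.encodeList z c q.1.1 q.1.2.1 q.1.2.2 q.2 := by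
  have hℓ : ∀ m : List Bool, m ≠ [] → 1 ≤ m.length := fun m h => List.length_pos_iff.2 h
  refine Eff.append id.snd ?_ 1 ?_
  · have hw : ∀ {α : Type} {D : α → Prop} {T : α → ℕ} {w : α → List Unit}, Eff D T w →
        (∀ x, D x → (w x).length ≤ T x) → Eff D T fun x => () :: GC.copies z (w x) :=
      fun hw h => Eff.unit.cons (hw.copies z 1 fun x hx => by have := h x hx; omega)
    refine Eff.flatMap (f := fun (q : (List Unit × List Bool × List (List (List Bool))) ×
      List Bool) b => (() :: GC.copies z q.1.1).map fun _ => b)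
      (Tb := fun q => (z + 1) * (q.1.2.1.length + 1)) (32 * c * (z + 2)) ?_ ?_ ?_ ?_
    · refine Eff.addRows (Eff.constMap (id.fst.snd.fst.copies c 1 ?_) (Eff.bit false) c ?_) id.snd
        (Eff.flatMap (f := fun (q : (List Unit × List Bool × List (List (List Bool))) ×
          List Bool) g => GC.blockRows q.1.2.1 g) (Tb := fun q => q.1.2.1.length ^ 2)
          8 id.fst.snd.snd ?_ ?_ ?_) (c + 1) ?_
      · rintro ⟨⟨w, m, g⟩, u⟩ ⟨h1, h2, h3, h4, h5⟩
        simp only at h1 h2 h3 h4 h5 ⊢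
        have := hℓ m h1
        have : 1 ≤ u.length := by nlinarith
        nlinarith
      · rintro ⟨⟨w, m, g⟩, u⟩ ⟨h1, h2, h3, h4, h5⟩
        simp only [length_copies] at h1 h2 h3 h4 h5 ⊢
        have := hℓ m h1
        have : 1 ≤ u.length := by nlinarith
        refine Nat.mul_le_mul le_rfl ?_
        nlinarith
      · refine Eff.blockRows c id.snd.fst.snd.fst id.fst ?_ ?_ ?_ 1 ?_
        · exact fun q hq => hq.1.1
        · exact fun q hq => (hq.1.2.2.2.2 q.1 hq.2).1
        · exact fun q hq => (hq.1.2.2.2.2 q.1 hq.2).2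
        · intro q _; omega
      · rintro ⟨⟨w, m, g⟩, u⟩ a ⟨h1, h2, h3, h4, h5⟩ ha
        simp only at h1 h2 h3 h4 h5 ha ⊢
        rw [length_blockRows h1 (h5 a ha).2]
        nlinarith
      · rintro ⟨⟨w, m, g⟩, u⟩ ⟨h1, h2, h3, h4, h5⟩
        simp only at h1 h2 h3 h4 h5 ⊢
        have := hℓ m h1
        have h6 : g.length * m.length * m.length ≤ 2 * u.length * m.length :=
          Nat.mul_le_mul h4 le_rfl
        nlinarith
      · rintro ⟨⟨w, m, g⟩, u⟩ ⟨h1, h2, h3, h4, h5⟩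
        simp only [length_copies, List.length_map] at h1 h2 h3 h4 h5 ⊢
        have := hℓ m h1
        nlinarith [Nat.zero_le (c * u.length)]
    · refine Eff.map (f := fun (q : Bool × (List Unit × List Bool × List (List (List Bool))) ×
        List Bool) (_ : Unit) => q.1) (Tb := fun _ => 0) 1 (hw id.snd.fst.fst ?_)
        id.snd.fst ?_
      · rintro ⟨b, ⟨w, m, g⟩, u⟩ ⟨⟨h1, h2, h3, h4, h5⟩, hb⟩
        simp only at h1 h2 h3 h4 h5 ⊢
        nlinarith
      · rintro ⟨b, ⟨w, m, g⟩, u⟩ ⟨⟨h1, h2, h3, h4, h5⟩, hb⟩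
        simp only [List.length_cons, length_copies] at h1 h2 h3 h4 h5 ⊢
        nlinarith
    · rintro ⟨⟨w, m, g⟩, u⟩ b ⟨h1, h2, h3, h4, h5⟩ hb
      simp only [List.length_cons, length_copies, List.length_map] at h1 h2 h3 h4 h5 ⊢
      nlinarith
    · rintro ⟨⟨w, m, g⟩, u⟩ ⟨h1, h2, h3, h4, h5⟩
      simp only at h1 h2 h3 h4 h5 ⊢
      have h6 : (GC.addRows ((GC.copies c m).map fun _ => false) u (g.flatMap (GC.blockRows m))).length
          ≤ c * m.length := by
        refine (length_addRows_le _ _ _).trans ?_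
        simp [length_copies]
      refine (Nat.mul_le_mul h6 le_rfl).trans ?_
      have := hℓ m h1
      have h7 : m.length * ((z + 1) * (m.length + 1) + 1) ≤ 2 * (z + 2) * m.length ^ 2 := by
        nlinarith [Nat.zero_le z, Nat.zero_le (z * m.length)]
      have h8 : m.length ^ 2 ≤ 4 * (u.length * m.length) := by nlinarith
      calc c * m.length * ((z + 1) * (m.length + 1) + 1)
          = c * (m.length * ((z + 1) * (m.length + 1) + 1)) := by ring
        _ ≤ c * (2 * (z + 2) * (4 * (u.length * m.length + 1))) := by
          refine Nat.mul_le_mul le_rfl (h7.trans (Nat.mul_le_mul le_rfl ?_))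
          omega
        _ ≤ 32 * c * (z + 2) * (u.length * m.length + 1) := by
          have : c * (2 * (z + 2) * (4 * (u.length * m.length + 1)))
            = 8 * (c * ((z + 2) * (u.length * m.length + 1))) := by ring
          rw [this]
          have : 32 * c * (z + 2) * (u.length * m.length + 1)
            = 32 * (c * ((z + 2) * (u.length * m.length + 1))) := by ring
          omega
  · rintro ⟨⟨w, m, g⟩, u⟩ ⟨h1, -⟩
    have := hℓ m h1
    simp only
    nlinarith

end Eff

end GC

namespace GC

/-! ### The decoder -/

theorem length_unitVectors {α : Type} (l : List α) :
    (unitVectors l).1.length = l.length ∧ (unitVectors l).2.length = l.length ∧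
      ∀ e ∈ (unitVectors l).2, e.length = l.length := by
  unfold unitVectors
  induction l using List.reverseRecOn with
  | nil => simp
  | append_singleton l a ih =>
    obtain ⟨h1, h2, h3⟩ := ih
    rw [List.foldl_append]
    refine ⟨by simp [h1], by simp [h2], ?_⟩
    intro e he
    simp only [List.foldl_cons, List.foldl_nil, List.mem_cons, List.mem_map] at he
    rcases he with rfl | ⟨e', he', rfl⟩
    · simp [h1]
    · simp [h3 e' he']

/-- Bounds for the sizes in an elimination step. -/
def ElimBound (N M : ℕ) (R : List (List Bool)) : Prop :=
  R.length ≤ N ∧ ∀ r ∈ R, r.length ≤ M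

theorem elimRow_bound {N M : ℕ} {s : List (List Bool) × List (List Bool)} {v : List Bool}
    (h1 : ElimBound N M s.2) (hv : v.length ≤ M) : ElimBound (N + 1) M (elimRow s v).2 := by
  have ht : v.tail.length ≤ M := by rw [List.length_tail]; omega
  unfold elimRow
  split
  · split
    · exact ⟨h1.1.trans (Nat.le_succ N), h1.2⟩
    · refine ⟨Nat.succ_le_succ h1.1, ?_⟩
      intro r hr
      rcases List.mem_cons.1 hr with rfl | hr
      · rw [length_xorList]; omega
      · exact h1.2 r hr
  · refine ⟨Nat.succ_le_succ h1.1, ?_⟩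
    intro r hr
    rcases List.mem_cons.1 hr with rfl | hr
    · exact ht
    · exact h1.2 r hr

theorem foldl_elimRow_bound {M : ℕ} {R : List (List Bool)} (hR : ∀ r ∈ R, r.length ≤ M) :
    ∀ {N : ℕ} {s : List (List Bool) × List (List Bool)}, ElimBound N M s.2 →
      ElimBound (N + R.length) M (R.foldl elimRow s).2 := by
  induction R with
  | nil => intro N s h; exact h
  | cons v R ih =>
    intro N s h
    have := ih (fun r hr => hR r (by simp [hr])) (elimRow_bound h (hR v (by simp)))
    rw [List.foldl_cons]
    rwa [List.length_cons, add_comm R.length, ← add_assoc]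

theorem elimStep_bound {N M : ℕ} {st : List (List Bool) × List Bool}
    (h : ElimBound N M st.1) (ht : st.2.length ≤ M) :
    ElimBound N M (elimStep st).1 ∧ (elimStep st).2.length ≤ M := by
  have h0 := foldl_elimRow_bound h.2 (N := 0) (s := ([], [])) ⟨le_rfl, by simp⟩
  refine ⟨⟨?_, h0.2⟩, ?_⟩
  · have := h0.1.trans (by simpa using h.1)
    exact this
  · have ht' : st.2.tail.length ≤ M := by rw [List.length_tail]; omega
    unfold elimStep
    simp only
    split
    · split
      · exact ht'
      · rw [length_xorList]; omega
    · exact ht'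

theorem length_fill (s : List Bool) (I : List Item) : (fill s I).length = I.length :=
  length_mapAccum _ _ _ _

namespace Eff

variable {α β γ δ : Type} {D : γ → Prop} {T : γ → ℕ}

theorem unitVectors {l : γ → List α} (hl : Eff D T l) (K : ℕ)
    (hT : ∀ x, D x → (l x).length * ((l x).length + 1) ≤ K * (T x + 1)) :
    Eff D T fun x => GC.unitVectors (l x) := by
  refine foldl (Tb := fun x => (l x).length) K hl (nil.pair nil) ?_ hT
  refine ((bit false).cons id.snd.fst.fst).pair (((bit true).cons id.snd.fst.fst).cons
    (map (f := fun _ (v : List Bool) => false :: v) (Tb := fun _ => 0) 1 id.snd.fst.snd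
      ((bit false).cons id.fst) ?_))
  rintro ⟨a, s, x⟩ ⟨hx, pre, suf, e, hs⟩
  simp only at hx e hs ⊢
  rw [hs]
  have := (length_unitVectors pre).2.1
  unfold GC.unitVectors at this
  rw [this, e, List.length_append, List.length_cons]
  omega

theorem elimStep {st : γ → List (List Bool) × List Bool} {N M : γ → ℕ} (hst : Eff D T st)
    (hN : ∀ x, D x → ElimBound (N x) (M x) (st x).1) (hM : ∀ x, D x → (st x).2.length ≤ M x)
    (K : ℕ) (hT : ∀ x, D x → (N x + 1) * (M x + 1) ≤ K * (T x + 1)) :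
    Eff D T fun x => GC.elimStep (st x) := by
  have h1 : Eff D T fun x => (st x).1.foldl elimRow ([], []) := by
    refine foldl_inv (Tb := fun x => M x) K (fun _ _ => True) hst.fst (nil.pair nil) ?_
      (fun _ _ => trivial) (fun _ _ _ _ _ _ => trivial) ?_
    · refine ite (id.fst.headD (bit false)) (uncons (f := fun q : List Bool × (List (List Bool) ×
        List (List Bool)) × γ => ([q.1.tail], q.2.1.2))
        (g := fun r : List Bool × List (List Bool) × (List Bool × (List (List Bool) ×
        List (List Bool)) × γ) => (r.1 :: r.2.1, GC.xorList r.2.2.1.tail r.1 :: r.2.2.2.1.2))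
        (h := fun q : List Bool × (List (List Bool) × List (List Bool)) × γ =>
        match q.2.1.1 with
        | [] => ([q.1.tail], q.2.1.2)
        | p :: t => (p :: t, GC.xorList q.1.tail p :: q.2.1.2))
        id.snd.fst.fst
        ((id.fst.tail.cons nil).pair id.snd.fst.snd)
        ((id.fst.cons id.snd.fst).pair
          ((id.snd.snd.fst.tail.xorList id.fst 1 ?_).cons id.snd.snd.snd.fst.snd))
        (fun x _ h => by simp only [h]) fun x a t _ h => by simp only [h])
        (id.snd.fst.fst.pair (id.fst.tail.cons id.snd.fst.snd))
        (fun x _ h => by refine (if_pos h).trans ?_; cases x.2.1.1 <;> rfl)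
        fun x _ h => by rw [elimRow, if_neg (by rw [h]; simp)]
      rintro ⟨p, t, v, s, x⟩ ⟨⟨⟨hx, hv, -⟩, -⟩, -⟩
      have := (hN x hx).2 v hv
      simp only [List.length_tail]
      omega
    · intro x hx
      exact (Nat.mul_le_mul ((hN x hx).1.trans (Nat.le_succ _)) le_rfl).trans (hT x hx)
  refine h1.snd.pair (ite (hst.snd.headD (bit false)) (uncons
    (f := fun x => (st x).2.tail)
    (g := fun r : List Bool × List (List Bool) × γ => GC.xorList (st r.2.2).2.tail r.1)
    (h := fun x => match ((st x).1.foldl elimRow ([], [])).1 with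
      | [] => (st x).2.tail
      | p :: _ => GC.xorList (st x).2.tail p)
    (h1.fst.restrict fun _ h => h.1) (hst.snd.tail.restrict fun _ h => h.1.1)
    (xorList (hst.snd.tail.comp id.snd.snd 1 (fun _ h => h.1.1) fun _ _ => by simp) id.fst K ?_)
    (fun x _ h => by simp only [h]) fun x a t _ h => by simp only [h])
    (hst.snd.tail.restrict fun _ h => h.1)
    (fun x _ h => if_pos h) fun x _ h => if_neg (by rw [h]; simp))
  rintro ⟨p, t, x⟩ ⟨⟨hx, -⟩, -⟩
  have h2 := hM x hx
  have h3 := hT x hx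
  have h4 : M x + 1 ≤ (N x + 1) * (M x + 1) := Nat.le_mul_of_pos_left _ (Nat.succ_pos _)
  simp only [List.length_tail] at hx ⊢
  omega

/-- There are at most `M` elimination steps. The number of rows never grows, and with the attached
unit vectors a row has at most `M + R.length` entries, so a step is one pass over a table of bounded
size. -/
theorem solve {R : γ → List (List Bool)} {S : γ → List Bool} {M : γ → ℕ} (hR : Eff D T R)
    (hS : Eff D T S) (hM : ∀ x, D x → ∀ r ∈ R x, r.length ≤ M x)
    (hMS : ∀ x, D x → (S x).length ≤ M x) (K : ℕ)
    (hT : ∀ x, D x → (M x + 1) * ((R x).length + 1) * (M x + (R x).length + 2) ≤ K * (T x + 1)) :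
    Eff D T fun x => GC.solve (R x) (S x) := by
  have hK1 : ∀ x, D x → (R x).length * ((R x).length + 1) ≤ K * (T x + 1) := fun x hx => by
    refine le_trans ?_ (hT x hx)
    have h1 : 1 * ((R x).length + 1) * ((R x).length) ≤
        (M x + 1) * ((R x).length + 1) * (M x + (R x).length + 2) :=
      Nat.mul_le_mul (Nat.mul_le_mul (by omega) le_rfl) (by omega)
    linarith
  have hK2 : ∀ x, D x → (R x).length * (M x + 1) ≤ K * (T x + 1) := fun x hx => by
    refine le_trans ?_ (hT x hx)
    have h1 : (M x + 1) * ((R x).length + 1) * 1 ≤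
        (M x + 1) * ((R x).length + 1) * (M x + (R x).length + 2) :=
      Nat.mul_le_mul le_rfl (by omega)
    linarith
  have hK3 : ∀ x, D x → (S x).length ≤ K * (T x + 1) := fun x hx => by
    have h2 := hMS x hx
    refine le_trans ?_ (hT x hx)
    have h1 : (M x + 1) * 1 * 1 ≤
        (M x + 1) * ((R x).length + 1) * (M x + (R x).length + 2) :=
      Nat.mul_le_mul (Nat.mul_le_mul le_rfl (by omega)) (by omega)
    linarith
  have hu := hR.unitVectors K hK1
  have hS' := hS.append hu.fst K hK3
  have hR' : Eff D T fun x => List.zipWith (· ++ ·) (R x) (GC.unitVectors (R x)).2 := by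
    refine zipWith (f := fun _ a b => a ++ b) (Tb := M) K hR hu.snd (id.fst.append id.snd.fst 1 ?_)
      hK2
    rintro ⟨a, b, x⟩ ⟨hx, ha, hb⟩
    have := hM x hx a ha
    simp only
    omega
  have hb0 : ∀ x, D x → ElimBound (R x).length (M x + (R x).length)
      (List.zipWith (· ++ ·) (R x) (GC.unitVectors (R x)).2) := by
    intro x hx
    refine ⟨by simp, ?_⟩
    intro r hr
    rw [← List.map_uncurry_zip_eq_zipWith, List.mem_map] at hr
    obtain ⟨⟨a, b⟩, hab, rfl⟩ := hr
    have h1 := List.of_mem_zip hab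
    have := hM x hx a h1.1
    have := (length_unitVectors (R x)).2.2 b h1.2
    simp only [Function.uncurry_apply_pair, List.length_append]
    omega
  refine snd (foldl_inv (Tb := fun x => ((R x).length + 1) * (M x + (R x).length + 1)) K
    (fun x st => ElimBound (R x).length (M x + (R x).length) st.1 ∧
      st.2.length ≤ M x + (R x).length) hS (hR'.pair hS') ?_ ?_ ?_ ?_)
  · exact id.snd.fst.elimStep (N := fun q => (R q.2.2).length)
      (M := fun q => M q.2.2 + (R q.2.2).length) (fun q hq => hq.2.2.1) (fun q hq => hq.2.2.2) 1
      fun q hq => by omega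
  · intro x hx
    refine ⟨hb0 x hx, ?_⟩
    have := hMS x hx
    simp only [List.length_append, (length_unitVectors (R x)).1]
    omega
  · intro x st a _ _ h
    exact elimStep_bound h.1 h.2
  · intro x hx
    refine le_trans ?_ (hT x hx)
    rw [mul_assoc]
    refine Nat.mul_le_mul ((hMS x hx).trans (Nat.le_succ _)) ?_
    nlinarith

theorem chunk {y : γ → List Bool} {P : γ → Plan} {B : γ → List (List (List Bool))} {ℓ : γ → ℕ}
    (hy : Eff D T y) (hP : Eff D T P) (hB : Eff D T B) (K : ℕ)
    (hPl : ∀ x, D x → ∀ e ∈ P x, e.2.length ≤ ℓ x)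
    (hBl : ∀ x, D x → ∀ b ∈ B x, b.length ≤ ℓ x)
    (hT : ∀ x, D x → (P x).length * (ℓ x + 1) ≤ K * (T x + 1)) :
    Eff D T fun x => GC.chunk (y x) (P x) (B x) := by
  have hd : Eff (fun q : ((Bool × List Unit) × List (List Bool)) × List Bool × γ =>
      D q.2.2 ∧ q.1 ∈ List.zipWith Prod.mk (P q.2.2) (B q.2.2)) (fun q => ℓ q.2.2)
      fun q => q.1.2.drop q.1.1.2.length := by
    refine id.fst.fst.snd.drop id.fst.snd 1 ?_
    rintro ⟨⟨e, b⟩, s, x⟩ ⟨hx, h⟩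
    have := hPl x hx e (List.of_mem_zip h).1
    simp only
    omega
  have hdl : ∀ q : ((Bool × List Unit) × List (List Bool)) × List Bool × γ,
      D q.2.2 ∧ q.1 ∈ List.zipWith Prod.mk (P q.2.2) (B q.2.2) →
      (q.1.2.drop q.1.1.2.length).length ≤ 1 * (ℓ q.2.2 + 1) := by
    rintro ⟨⟨e, b⟩, s, x⟩ ⟨hx, h⟩
    have := hBl x hx b (List.of_mem_zip h).2
    simp only [List.length_drop]
    omega
  refine mapAccum (Tb := ℓ) K (hP.zipPair K hB fun x hx => ?_) hy (hd.drop id.snd.fst 1 hdl)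
    (id.fst.fst.fst.pair (id.fst.snd.pair (hd.take id.snd.fst 1 hdl))) fun x hx => ?_
  · have := hT x hx; nlinarith
  · refine le_trans (Nat.mul_le_mul ?_ le_rfl) (hT x hx)
    simp

theorem knownPart {S : γ → List Bool} {I : γ → List Item} {ℓ M : γ → ℕ}
    (hS : Eff D T S) (hI : Eff D T I) (K : ℕ) (hIl : ∀ x, D x → ∀ q ∈ I x, q.2.2.length ≤ ℓ x)
    (hSl : ∀ x, D x → (S x).length ≤ M x)
    (hT : ∀ x, D x → (I x).length * (ℓ x * (M x + 1) + 1) ≤ K * (T x + 1)) :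
    Eff D T fun x => GC.knownPart (S x) (I x) := by
  refine foldl_inv (Tb := fun x => ℓ x * (M x + 1)) K (fun x s => s.length ≤ M x) hI hS ?_ hSl
    ?_ hT
  · refine ite id.fst.fst id.snd.fst (addRows id.snd.fst id.fst.snd.snd id.fst.snd.fst 1 ?_)
      (fun x _ h => if_pos h) fun x _ h => if_neg (by rw [h]; simp)
    rintro ⟨q, s, x⟩ ⟨⟨hx, hq, hs⟩, -⟩
    have := hIl x hx q hq
    simp only at hs this ⊢
    have := Nat.mul_le_mul this (Nat.succ_le_succ hs)
    simp only [Nat.succ_eq_add_one] at this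
    omega
  · intro x s q _ _ hs
    split
    · exact hs
    · exact (length_addRows_le _ _ _).trans hs

theorem _root_.GC.length_knownPart_le (S : List Bool) (I : List Item) :
    (GC.knownPart S I).length ≤ S.length := by
  unfold GC.knownPart
  induction I generalizing S with
  | nil => exact le_rfl
  | cons q I ih =>
    rw [List.foldl_cons]
    refine (ih _).trans ?_
    split
    · exact le_rfl
    · exact length_addRows_le _ _ _

theorem _root_.GC.length_unknownRows_le {ℓ e : ℕ} {I : List Item}
    (hI : ∀ q ∈ I, q.2.1.length ≤ ℓ) (he : I.countP (·.1) ≤ e) :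
    (GC.unknownRows I).length ≤ e * ℓ := by
  refine le_trans ?_ (Nat.mul_le_mul_right ℓ he)
  clear he
  unfold GC.unknownRows
  induction I with
  | nil => simp
  | cons q I ih =>
    have h1 := ih fun q' h => hI q' (by simp [h])
    have h2 := hI q (by simp)
    rw [List.flatMap_cons, List.length_append, List.countP_cons]
    split
    · nlinarith
    · simpa using h1

theorem _root_.GC.length_of_mem_unknownRows {M : ℕ} {I : List Item}
    (hI : ∀ q ∈ I, ∀ r ∈ q.2.1, r.length ≤ M) : ∀ r ∈ GC.unknownRows I, r.length ≤ M := by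
  intro r hr
  obtain ⟨q, hq, h⟩ := List.mem_flatMap.1 hr
  split at h
  · exact hI q hq r h
  · simp at h

theorem unknownRows {I : γ → List Item} {ℓ : γ → ℕ} (hI : Eff D T I) (K : ℕ)
    (hIl : ∀ x, D x → ∀ q ∈ I x, q.2.1.length ≤ ℓ x)
    (hT : ∀ x, D x → (I x).length * (ℓ x + 1) ≤ K * (T x + 1)) :
    Eff D T fun x => GC.unknownRows (I x) := by
  refine flatMap (f := fun _ (q : Item) => if q.1 = true then q.2.1 else []) (Tb := ℓ) K hI
    (ite id.fst.fst id.fst.snd.fst nil (fun x _ h => if_pos h)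
      fun x _ h => if_neg (by rw [h]; simp)) ?_ hT
  intro x q hx hq
  have := hIl x hx q hq
  split
  · omega
  · simp

theorem fill {s : γ → List Bool} {I : γ → List Item} {ℓ : γ → ℕ} (hs : Eff D T s)
    (hI : Eff D T I) (K : ℕ) (hIl : ∀ x, D x → ∀ q ∈ I x, q.2.1.length ≤ ℓ x)
    (hT : ∀ x, D x → (I x).length * (ℓ x + 1) ≤ K * (T x + 1)) :
    Eff D T fun x => GC.fill (s x) (I x) := by
  have hl : ∀ q : Item × List Bool × γ, (D q.2.2 ∧ q.1 ∈ I q.2.2) ∧ q.1.1 = true →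
      q.1.2.1.length ≤ 1 * (ℓ q.2.2 + 1) := fun q h => by
    have := hIl _ h.1.1 _ h.1.2
    omega
  exact mapAccum (Tb := ℓ) K hI hs
    (ite id.fst.fst (id.fst.snd.fst.drop id.snd.fst 1 hl) id.snd.fst
      (fun x _ h => if_pos h) fun x _ h => if_neg (by rw [h]; simp))
    (id.fst.fst.pair (id.fst.snd.snd.pair (ite id.fst.fst
      (id.fst.snd.fst.take id.snd.fst 1 hl) id.fst.snd.snd
      (fun x _ h => if_pos h) fun x _ h => if_neg (by rw [h]; simp)))) hT

theorem _root_.GC.length_foldl_runStep {ℓ : ℕ} (I : List (Bool × List Bool × List Bool))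
    (hI : ∀ q ∈ I, q.2.1.length ≤ ℓ ∧ q.2.2.length ≤ ℓ) :
    (I.foldl runStep (true, [], [])).2.1.length ≤ I.countP (·.1) * ℓ ∧
    (I.foldl runStep (true, [], [])).2.2.length ≤ I.countP (·.1) * ℓ := by
  induction I using List.reverseRecOn with
  | nil => simp
  | append_singleton I q ih =>
    obtain ⟨h1, h2⟩ := ih fun q' h => hI q' (by simp [h])
    obtain ⟨h3, h4⟩ := hI q (by simp)
    rw [List.foldl_append, List.countP_append]
    simp only [List.foldl_cons, List.foldl_nil, runStep, List.countP_singleton]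
    split
    · simp only [List.length_append, add_mul, one_mul]
      omega
    · simp

/-- Only erased blocks contribute to the two strings carried along, and there are at most `e` of
them. So these strings stay below `e * ℓ` bits, and appending to them in every step is affordable.
-/
theorem runsOk {I : γ → List (Bool × List Bool × List Bool)} {ℓ : γ → ℕ} (e : ℕ) (hI : Eff D T I)
    (hIl : ∀ x, D x → ∀ q ∈ I x, q.2.1.length ≤ ℓ x ∧ q.2.2.length ≤ ℓ x)
    (he : ∀ x, D x → (I x).countP (·.1) ≤ e) (K : ℕ)
    (hT : ∀ x, D x → ((I x).length + 1) * (e * ℓ x + 1) ≤ K * (T x + 1)) :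
    Eff D T fun x => GC.runsOk (I x) := by
  have hl : ∀ x, D x → ∀ pre suf, I x = pre ++ suf →
      (pre.foldl runStep (true, [], [])).2.1.length ≤ e * ℓ x ∧
      (pre.foldl runStep (true, [], [])).2.2.length ≤ e * ℓ x := by
    intro x hx pre suf h
    have h1 := GC.length_foldl_runStep pre fun q hq => hIl x hx q (by simp [h, hq])
    have h2 : pre.countP (·.1) ≤ e := by
      have := he x hx
      rw [h, List.countP_append] at this
      omega
    exact ⟨h1.1.trans (Nat.mul_le_mul_right _ h2), h1.2.trans (Nat.mul_le_mul_right _ h2)⟩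
  have h1 : Eff D T fun x => (I x).foldl runStep (true, [], []) := by
    refine foldl (Tb := fun x => e * ℓ x) K hI ((bit true).pair (nil.pair nil)) ?_ ?_
    · refine ite id.fst.fst (id.snd.fst.fst.pair ((id.snd.fst.snd.fst.append id.fst.snd.fst 1
        ?_).pair (id.snd.fst.snd.snd.append id.fst.snd.snd 1 ?_)))
        ((id.snd.fst.fst.and (id.snd.fst.snd.fst.isSublist id.snd.fst.snd.snd 1 ?_)).pair
          (nil.pair nil)) (fun x _ h => if_pos h) fun x _ h => if_neg (by rw [h]; simp)
      all_goals
        rintro ⟨q, s, x⟩ ⟨⟨hx, pre, suf, h, hs⟩, -⟩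
        simp only at hx h hs ⊢
        have := hl x hx pre (q :: suf) h
        rw [← hs] at this
        omega
    · intro x hx
      refine le_trans (Nat.mul_le_mul (Nat.le_succ _) le_rfl) (hT x hx)
  refine h1.fst.and (h1.snd.fst.isSublist h1.snd.snd K fun x hx => ?_)
  have h2 := (hl x hx (I x) [] (by simp)).2
  have h3 := hT x hx
  nlinarith

theorem _root_.GC.mem_fill {ℓ : ℕ} {I : List Item}
    (hI : ∀ q ∈ I, q.2.1.length ≤ ℓ ∧ q.2.2.length ≤ ℓ) (s : List Bool) :
    ∀ q ∈ GC.fill s I, q.2.1.length ≤ ℓ ∧ q.2.2.length ≤ ℓ := by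
  unfold GC.fill
  induction I generalizing s with
  | nil => simp [GC.mapAccum]
  | cons a I ih =>
    intro q hq
    rw [GC.mapAccum, List.mem_cons] at hq
    have ha := hI a (by simp)
    rcases hq with rfl | hq
    · refine ⟨ha.2, ?_⟩
      simp only
      split
      · simp only [List.length_take]; omega
      · exact ha.2
    · exact ih (fun q h => hI q (by simp [h])) _ q hq

theorem _root_.GC.countP_fill (s : List Bool) (I : List Item) :
    (GC.fill s I).countP (·.1) = I.countP (·.1) := by
  unfold GC.fill
  induction I generalizing s with
  | nil => rfl
  | cons a I ih => simp only [GC.mapAccum, List.countP_cons, ih]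

/-- At most `e` blocks are erased (later `e = 2 * z`), so the linear system has at most `e * ℓ`
unknowns and `c * ℓ` equations and is solved in `O(ℓ ^ 3)` steps. The rest costs at most `O(ℓ ^ 2)`
steps per block, up to terms absorbed by `ℓ ^ 3`. -/
theorem tryItems {par : γ → List Bool} {I : γ → List Item} {ℓ : γ → ℕ} (c e : ℕ)
    (hp : Eff D (fun x => ((I x).length + ℓ x) * ℓ x ^ 2) par)
    (hI : Eff D (fun x => ((I x).length + ℓ x) * ℓ x ^ 2) I)
    (hℓ : ∀ x, D x → 1 ≤ ℓ x)
    (hpl : ∀ x, D x → (par x).length ≤ c * ℓ x)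
    (hIl : ∀ x, D x → ∀ q ∈ I x, q.2.1.length ≤ ℓ x ∧ q.2.2.length ≤ ℓ x)
    (hIr : ∀ x, D x → ∀ q ∈ I x, ∀ r ∈ q.2.1, r.length ≤ c * ℓ x)
    (he : ∀ x, D x → (I x).countP (·.1) ≤ e) :
    Eff D (fun x => ((I x).length + ℓ x) * ℓ x ^ 2) fun x => GC.tryItems (par x) (I x) := by
  have hN : ∀ x, D x → ((I x).length + ℓ x) * ℓ x ^ 2
      = (I x).length * ℓ x ^ 2 + ℓ x ^ 3 := fun x _ => by ring
  have hmon : ∀ x, D x → (I x).length * ℓ x ≤ (I x).length * ℓ x ^ 2 ∧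
      (I x).length ≤ (I x).length * ℓ x ^ 2 ∧ ℓ x ≤ ℓ x ^ 3 ∧ ℓ x ^ 2 ≤ ℓ x ^ 3 ∧ 1 ≤ ℓ x ^ 3 := by
    intro x hx
    have h1 := hℓ x hx
    have h2 : ℓ x ≤ ℓ x ^ 2 := by nlinarith
    have h3 : ℓ x ^ 2 ≤ ℓ x ^ 3 := by nlinarith [sq_nonneg (ℓ x)]
    exact ⟨Nat.mul_le_mul le_rfl h2, by nlinarith, by omega, h3, by omega⟩
  have hblk : ∀ x, D x → (I x).length * (ℓ x + 1) ≤
      2 * (((I x).length + ℓ x) * ℓ x ^ 2 + 1) := fun x hx => by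
    have := hmon x hx
    rw [hN x hx]
    nlinarith
  have hk := hp.knownPart (M := fun x => c * ℓ x) hI (c + 2) (fun x hx q hq => (hIl x hx q hq).2)
    hpl fun x hx => by
      have := hmon x hx
      rw [hN x hx]
      nlinarith [Nat.zero_le (c * ℓ x ^ 3), Nat.zero_le c]
  have hkl : ∀ x, D x → (GC.knownPart (par x) (I x)).length ≤ c * ℓ x := fun x hx =>
    (length_knownPart_le _ _).trans (hpl x hx)
  have hu := hI.unknownRows 2 (fun x hx q hq => (hIl x hx q hq).1) hblk
  have hul : ∀ x, D x → (GC.unknownRows (I x)).length ≤ e * ℓ x := fun x hx =>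
    length_unknownRows_le (fun q hq => (hIl x hx q hq).1) (he x hx)
  have hs := hu.solve (M := fun x => c * ℓ x) hk
    (fun x hx => length_of_mem_unknownRows (hIr x hx)) hkl ((c + 1) * (e + 1) * (c + e + 2))
    fun x hx => by
      have h1 := hℓ x hx
      have h2 : c * ℓ x + 1 ≤ (c + 1) * ℓ x := by nlinarith
      have h3 : (GC.unknownRows (I x)).length + 1 ≤ (e + 1) * ℓ x := by
        have := hul x hx; nlinarith
      have h4 : c * ℓ x + (GC.unknownRows (I x)).length + 2 ≤ (c + e + 2) * ℓ x := by
        have := hul x hx; nlinarith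
      refine (Nat.mul_le_mul (Nat.mul_le_mul h2 h3) h4).trans ?_
      rw [hN x hx]
      have : (c + 1) * ℓ x * ((e + 1) * ℓ x) * ((c + e + 2) * ℓ x)
        = (c + 1) * (e + 1) * (c + e + 2) * ℓ x ^ 3 := by ring
      rw [this]
      exact Nat.mul_le_mul le_rfl (by omega)
  -- A crude bound that needs no matching of lengths: elimination never lengthens its target, which
  -- starts as `S` followed by one zero for each row.
  have hsl : ∀ x, (GC.solve (GC.unknownRows (I x)) (GC.knownPart (par x) (I x))).length ≤
      (GC.knownPart (par x) (I x)).length + (GC.unknownRows (I x)).length := by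
    intro x
    generalize GC.unknownRows (I x) = R
    generalize GC.knownPart (par x) (I x) = S
    have key : ∀ (l : List Bool) (st : List (List Bool) × List Bool),
        (l.foldl (fun st _ => GC.elimStep st) st).2.length ≤ st.2.length := by
      intro l
      induction l with
      | nil => intro st; exact le_rfl
      | cons a l ih =>
        intro st
        rw [List.foldl_cons]
        refine (ih _).trans ?_
        unfold GC.elimStep
        simp only
        split
        · split
          · simp
          · rw [length_xorList, List.length_tail]; omega
        · simp
    refine (key S _).trans ?_
    simp [(length_unitVectors R).1]
  have hr := hk.addRows hs hu ((c + e) * (c + 1)) fun x hx => by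
    have h1 := hℓ x hx
    have h2 := hsl x
    have h3 := hkl x hx
    have h4 := hul x hx
    have h5 := hmon x hx
    have h6 : (GC.solve (GC.unknownRows (I x)) (GC.knownPart (par x) (I x))).length
      ≤ (c + e) * ℓ x := by nlinarith
    have h7 : (GC.knownPart (par x) (I x)).length + 1 ≤ (c + 1) * ℓ x := by nlinarith
    refine (Nat.mul_le_mul h6 h7).trans ?_
    rw [hN x hx]
    have : (c + e) * ℓ x * ((c + 1) * ℓ x) = (c + e) * (c + 1) * ℓ x ^ 2 := by ring
    rw [this]
    exact Nat.mul_le_mul le_rfl (by omega)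
  have hz := hr.all (f := fun _ b => !b) (Tb := fun _ => 0) c id.fst.not fun x hx => by
    have h1 := (length_addRows_le (GC.knownPart (par x) (I x))
      (GC.solve (GC.unknownRows (I x)) (GC.knownPart (par x) (I x)))
      (GC.unknownRows (I x))).trans (hkl x hx)
    have h5 := hmon x hx
    rw [hN x hx]
    have : c * ℓ x ≤ c * ((I x).length * ℓ x ^ 2 + ℓ x ^ 3 + 1) :=
      Nat.mul_le_mul le_rfl (by omega)
    omega
  have hf := hs.fill hI 2 (fun x hx q hq => (hIl x hx q hq).1) hblk
  have hruns := hf.runsOk e (fun x hx => mem_fill (hIl x hx) _)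
    (fun x hx => by rw [countP_fill]; exact he x hx) (2 * (e + 1)) fun x hx => by
      have h1 := hℓ x hx
      have h5 := hmon x hx
      rw [hN x hx, length_fill]
      have h6 : e * ℓ x + 1 ≤ (e + 1) * ℓ x := by nlinarith
      refine (Nat.mul_le_mul le_rfl h6).trans ?_
      have : ((I x).length + 1) * ((e + 1) * ℓ x) = (e + 1) * ((I x).length * ℓ x + ℓ x) := by ring
      rw [this]
      have : 2 * (e + 1) * ((I x).length * ℓ x ^ 2 + ℓ x ^ 3 + 1)
        = (e + 1) * (2 * ((I x).length * ℓ x ^ 2 + ℓ x ^ 3 + 1)) := by ring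
      rw [this]
      exact Nat.mul_le_mul le_rfl (by omega)
  refine ite (hz.and hruns) (Eff.cons ?_ nil) nil (fun x _ h => if_pos h)
    fun x _ h => if_neg (by rw [h]; simp)
  refine (flatMap (f := fun _ (q : Bool × List Bool × List Bool) => q.2.2) (Tb := ℓ) 2 hf
    id.fst.snd.snd ?_ ?_).restrict fun _ h => h.1
  · intro x q hx hq
    have := (mem_fill (hIl x hx) _ q hq).2
    omega
  · intro x hx
    rw [length_fill]
    exact hblk x hx

end Eff

end GC

/-! ### The number of guesses and the cost of trying one -/

namespace GC

theorem dels_aux (w : List Unit) :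
    (dels w).map List.length = (List.range (w.length + 1)).reverse := by
  unfold dels
  induction w using List.reverseRecOn with
  | nil => rfl
  | append_singleton w a ih =>
    rw [List.foldl_append, List.length_append, List.length_singleton, List.range_succ,
      List.reverse_append]
    simp only [List.foldl_cons, List.foldl_nil, List.map_cons, List.length_cons, ih]
    simp only [List.reverse_cons, List.reverse_nil, List.nil_append, List.singleton_append]
    congr 1
    generalize w.foldl (fun s _ => (() :: s.headD []) :: s) [[]] = s at *
    rw [List.range_succ, List.reverse_append] at ih
    cases s with
    | nil => simp at ih
    | cons b s =>
      simp only [List.map_cons, List.reverse_cons, List.reverse_nil, List.nil_append,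
        List.singleton_append, List.cons.injEq] at ih
      simp [ih.1]

theorem length_dels (w : List Unit) : (dels w).length = w.length + 1 := by
  have := congrArg List.length (dels_aux w)
  simpa using this

theorem mem_dels {w m : List Unit} : m ∈ dels w ↔ m.length ≤ w.length := by
  have h : m ∈ dels w ↔ m.length ∈ (dels w).map List.length := by
    rw [List.mem_map]
    refine ⟨fun h => ⟨m, h, rfl⟩, ?_⟩
    rintro ⟨m', h, e⟩
    rwa [List.length_injective e] at h
  rw [h, dels_aux]
  simp

/-- Bounds for plans in terms of the number of blocks, of the number of erased blocks, and of the
number of deletions starting at a block. -/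
def PlanBound (B e d : ℕ) (P : Plan) : Prop :=
  P.length = B ∧ P.countP (·.1) ≤ e ∧ ∀ q ∈ P, q.2.length ≤ d

theorem singlePlans_bound {α : Type} (w : List Unit) (B : List α) :
    PlanBound B.length 0 0 (singlePlans w B).1 ∧
    (singlePlans w B).2.length ≤ B.length * (w.length + 1) ∧
    ∀ P ∈ (singlePlans w B).2, PlanBound B.length 2 w.length P := by
  unfold singlePlans
  induction B using List.reverseRecOn with
  | nil => simp [PlanBound]
  | append_singleton B b ih =>
    rw [List.foldl_append]
    simp only [List.foldl_cons, List.foldl_nil]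
    generalize B.foldl _ _ = s at *
    obtain ⟨⟨h1, h2, h3⟩, h4, h5⟩ := ih
    refine ⟨⟨by simp [h1], by simpa using h2, ?_⟩, ?_, ?_⟩
    · intro q hq
      rcases List.mem_cons.1 hq with rfl | hq
      · simp
      · exact h3 q hq
    · have : (List.flatMap (fun m => if s.1.isEmpty = true then []
          else [(true, m) :: (true, []) :: s.1.tail]) (dels w)).length ≤ w.length + 1 := by
        split
        · simp
        · simp [length_dels]
      simp only [List.length_append, List.length_map, List.length_singleton, add_mul, one_mul]
      omega
    · intro P hP
      rcases List.mem_append.1 hP with hP | hP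
      · obtain ⟨m, hm, hP⟩ := List.mem_flatMap.1 hP
        split at hP
        · simp at hP
        · rename_i hne
          rw [List.mem_singleton] at hP
          subst hP
          cases hs : s.1 with
          | nil => simp [hs] at hne
          | cons a t =>
            rw [hs] at h1 h2 h3
            refine ⟨?_, ?_, ?_⟩
            · simp only [List.length_cons, List.tail_cons, List.length_append] at h1 ⊢
              simp [h1]
            · simp only [List.countP_cons, List.tail_cons] at h2 ⊢
              simp only [if_true]
              omega
            · intro q hq
              simp only [List.mem_cons, List.tail_cons] at hq
              rcases hq with rfl | rfl | hq
              · exact mem_dels.1 hm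
              · simp
              · exact (h3 q (by simp [hq])).trans (Nat.zero_le _)
      · obtain ⟨Q, hQ, rfl⟩ := List.mem_map.1 hP
        obtain ⟨h6, h7, h8⟩ := h5 Q hQ
        refine ⟨by simp [h6], by simpa using h7, ?_⟩
        intro q hq
        rcases List.mem_cons.1 hq with rfl | hq
        · simp
        · exact h8 q hq

theorem combine_bound {B e₁ d₁ e₂ d₂ : ℕ} {P Q : Plan} (hP : PlanBound B e₁ d₁ P)
    (hQ : PlanBound B e₂ d₂ Q) : PlanBound B (e₁ + e₂) (d₁ + d₂) (combine P Q) := by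
  obtain ⟨h1, h2, h3⟩ := hP
  obtain ⟨h4, h5, h6⟩ := hQ
  refine ⟨by simp [combine, h1, h4], ?_, ?_⟩
  · refine le_trans ?_ (Nat.add_le_add h2 h5)
    clear h1 h2 h3 h4 h5 h6
    unfold combine
    induction P generalizing Q with
    | nil => simp
    | cons a P ih =>
      cases Q with
      | nil => simp
      | cons b Q =>
        have := @ih Q
        obtain ⟨a, _⟩ := a
        obtain ⟨b, _⟩ := b
        simp only [List.zipWith_cons_cons, List.countP_cons]
        cases a <;> cases b <;> simp <;> omega
  · intro q hq
    unfold combine at hq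
    rw [← List.map_uncurry_zip_eq_zipWith, List.mem_map] at hq
    obtain ⟨⟨a, b⟩, hab, rfl⟩ := hq
    have h := List.of_mem_zip hab
    have := h3 a h.1
    have := h6 b h.2
    simp only [Function.uncurry_apply_pair, List.length_append]
    omega

/-- One window has at most `B.length * (w.length + 1)` plans, and a superposition adds the numbers
of erased blocks and of deletions. The count accounts for the factor `k ^ z` in the running time. -/
theorem plans_bound {α : Type} (w : List Unit) (B : List α) (z : ℕ) :
    (plans w B z).length ≤ (B.length * (w.length + 1)) ^ z ∧
    ∀ P ∈ plans w B z, PlanBound B.length (2 * z) (z * w.length) P := by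
  obtain ⟨h1, h2, h3⟩ := singlePlans_bound w B
  induction z with
  | zero =>
    refine ⟨le_rfl, ?_⟩
    intro P hP
    rw [plans, List.mem_singleton] at hP
    rw [hP]
    simpa using h1
  | succ z ih =>
    refine ⟨?_, ?_⟩
    · rw [plans, List.length_flatMap]
      simp only [List.length_map, List.map_const', List.sum_replicate, smul_eq_mul]
      rw [pow_succ, mul_comm]
      exact Nat.mul_le_mul ih.1 h2
    · intro P hP
      obtain ⟨Q, hQ, hP⟩ := List.mem_flatMap.1 hP
      obtain ⟨R, hR, rfl⟩ := List.mem_map.1 hP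
      have := combine_bound (h3 Q hQ) (ih.2 R hR)
      rw [show 2 * (z + 1) = 2 + 2 * z by ring,
        show (z + 1) * w.length = w.length + z * w.length by ring]
      exact this

theorem zipWith_fst {α β : Type} (b : List α) (k : List β) :
    List.zipWith (fun a _ => a) b k = b.take k.length := by
  induction b generalizing k with
  | nil => simp
  | cons a b ih => cases k <;> simp [ih]

namespace Eff

variable {α β γ δ : Type} {D : γ → Prop} {T : γ → ℕ}

/-- Sharing of an intermediate value: it is computed once, outside the loops in which `g` uses it.
-/
theorem let_in {f : γ → α} {g : α × γ → β} (hf : Eff D T f)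
    (hg : Eff (fun q : α × γ => D q.2 ∧ q.1 = f q.2) (fun q => T q.2) g) :
    Eff D T fun x => g (f x, x) :=
  hg.comp (hf.pair id) 1 (fun _ h => ⟨h, rfl⟩) fun _ _ => by simp

theorem dels {w : γ → List Unit} (hw : Eff D T w) (K : ℕ)
    (hT : ∀ x, D x → (w x).length ≤ K * (T x + 1)) : Eff D T fun x => GC.dels (w x) :=
  foldl_inv (Tb := fun _ => 0) K (fun _ _ => True) hw (nil.cons nil)
    ((unit.cons (id.snd.fst.headD nil)).cons id.snd.fst)
    (fun _ _ => trivial) (fun _ _ _ _ _ _ => trivial) (by simpa using hT)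

theorem singlePlans {w : γ → List Unit} {B : γ → List α} (hw : Eff D (fun _ => 0) w)
    (hB : Eff D T B) (K : ℕ)
    (hT : ∀ x, D x → (B x).length * (((B x).length + 1) * ((w x).length + 1) + 1) ≤
      K * (T x + 1)) :
    Eff D T fun x => GC.singlePlans (w x) (B x) := by
  refine foldl (Tb := fun x => ((B x).length + 1) * ((w x).length + 1)) K hB (nil.pair nil) ?_ hT
  refine (((bit false).pair nil).cons id.snd.fst.fst).pair (Eff.append ?_ ?_ 1 ?_)
  · have hw' : Eff (fun q : α × (Plan × List Plan) × γ => D q.2.2 ∧ ∃ pre suf,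
        B q.2.2 = pre ++ q.1 :: suf ∧ q.2.1 = pre.foldl (fun s _ => ((false, []) :: s.1,
        ((GC.dels (w q.2.2)).flatMap fun m => if s.1.isEmpty = true then []
          else [(true, m) :: (true, []) :: s.1.tail]) ++ s.2.map ((false, []) :: ·))) ([], []))
        (fun q => ((B q.2.2).length + 1) * ((w q.2.2).length + 1)) fun q => w q.2.2 := by
      refine hw.comp id.snd.snd 1 (fun q hq => hq.1) fun q _ => ?_
      nlinarith [Nat.zero_le ((B q.2.2).length * ((w q.2.2).length + 1))]
    refine flatMap (f := fun (q : α × (Plan × List Plan) × γ) (m : List Unit) =>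
      if q.2.1.1.isEmpty = true then [] else [(true, m) :: (true, []) :: q.2.1.1.tail])
      (Tb := fun _ => 0) 1 (hw'.dels 1 fun q _ => ?_)
      (ite id.snd.snd.fst.fst.isEmpty nil ((((bit true).pair id.fst).cons
        (((bit true).pair nil).cons id.snd.snd.fst.fst.tail)).cons nil)
        (fun x _ h => if_pos h) fun x _ h => if_neg (by rw [h]; simp)) ?_ ?_
    · nlinarith [Nat.zero_le ((B q.2.2).length * ((w q.2.2).length + 1))]
    · intro q m _ _
      split <;> simp
    · intro q _
      rw [length_dels]
      nlinarith [Nat.zero_le ((B q.2.2).length * ((w q.2.2).length + 1))]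
  · refine map (f := fun _ (P : Plan) => (false, []) :: P) (Tb := fun _ => 0) 1 id.snd.fst.snd
      (((bit false).pair nil).cons id.fst) ?_
    rintro ⟨b, s, x⟩ ⟨hx, pre, suf, e, hs⟩
    have := (singlePlans_bound (w x) pre).2.1
    simp only at hx e hs ⊢
    have h2 : s = GC.singlePlans (w x) pre := hs
    have h3 : pre.length ≤ (B x).length := by simp [e]
    rw [h2]
    have h4 := Nat.mul_le_mul_right ((w x).length + 1) h3
    nlinarith
  · rintro ⟨b, s, x⟩ -
    simp only
    split
    · simp
    · simp only [List.length_flatMap, List.length_singleton, List.map_const', List.sum_replicate,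
        smul_eq_mul, mul_one, length_dels]
      nlinarith [Nat.zero_le ((B x).length * ((w x).length + 1))]

/-- To pass from `j` to `j + 1` windows, at most `G` single plans are combined with at most `G ^ j`
others, at a cost of about `G` for each pair. As `j + 2 ≤ z + 1`, every stage stays within `G ^ (z +
1)`. -/
theorem plans (z : ℕ) {w : γ → List Unit} {B : γ → List α} {G : γ → ℕ}
    (hw : Eff D (fun _ => 0) w)
    (hB : Eff D (fun _ => 0) B) (hG1 : ∀ x, D x → 1 ≤ G x)
    (hG : ∀ x, D x → (B x).length * ((w x).length + 1) ≤ G x)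
    (hT : ∀ x, D x → G x ^ (z + 1) ≤ T x) (hz : 1 ≤ z) (j : ℕ) (hj : j ≤ z) :
    Eff D T fun x => GC.plans (w x) (B x) j := by
  have hGp : ∀ x, D x → ∀ i ≤ z + 1, G x ^ i ≤ T x := fun x hx i hi =>
    (Nat.pow_le_pow_right (hG1 x hx) hi).trans (hT x hx)
  have hB' : ∀ x, D x → (B x).length ≤ G x := fun x hx => by
    refine le_trans ?_ (hG x hx); nlinarith
  have hs : Eff D T fun x => GC.singlePlans (w x) (B x) := by
    refine singlePlans hw (hB.mono 1 (fun _ h => h) fun x hx => by omega) 4 ?_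
    intro x hx
    have h1 := hG1 x hx
    have h2 := hG x hx
    have h3 := hB' x hx
    have h4 := hGp x hx 2 (by omega)
    have h5 : (B x).length * ((B x).length * ((w x).length + 1)) ≤ G x * G x :=
      Nat.mul_le_mul h3 h2
    nlinarith
  induction j with
  | zero => exact hs.fst.cons nil
  | succ j ih =>
    have hlet : Eff D T fun x => ((GC.singlePlans (w x) (B x)).2, GC.plans (w x) (B x) j) :=
      hs.snd.pair (ih (by omega))
    refine Eff.let_in (g := fun q : (List Plan × List Plan) × γ =>
      q.1.1.flatMap fun P => q.1.2.map (combine P)) hlet ?_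
    refine flatMap (f := fun (q : (List Plan × List Plan) × γ) P => q.1.2.map (combine P))
      (Tb := fun q => q.1.2.length * (G q.2 + 1)) 3 id.fst.fst (map
      (f := fun (q : Plan × (List Plan × List Plan) × γ) Q => combine q.1 Q)
      (Tb := fun q => G q.2.2) 1 id.snd.fst.snd (zipWith
      (f := fun _ (a b : Bool × List Unit) => (a.1 || b.1, a.2 ++ b.2))
      (Tb := fun q => (w q.2.2.2).length) 1 id.snd.fst id.fst ((id.fst.fst.or id.snd.fst.fst).pair
        (id.fst.snd.append id.snd.fst.snd 1 ?_)) ?_) ?_) ?_ ?_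
    · rintro ⟨a, b, Q, P, ⟨S, L⟩, x⟩ ⟨⟨⟨⟨hx, e⟩, hP⟩, hQ⟩, ha, hb⟩
      simp only [Prod.mk.injEq] at hx e hQ hP ha hb ⊢
      rw [e.1] at hP
      have := ((singlePlans_bound (w x) (B x)).2.2 P hP).2.2 a ha
      omega
    · rintro ⟨Q, P, ⟨S, L⟩, x⟩ ⟨⟨⟨hx, e⟩, hP⟩, hQ⟩
      simp only [Prod.mk.injEq] at hx e hQ hP ⊢
      rw [e.1] at hP
      rw [((singlePlans_bound (w x) (B x)).2.2 P hP).1]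
      have := hG x hx
      omega
    · rintro ⟨P, ⟨S, L⟩, x⟩ ⟨⟨hx, e⟩, hP⟩
      simp only at hx e hP ⊢
      omega
    · rintro ⟨⟨S, L⟩, x⟩ P ⟨hx, e⟩ hP
      simp only [List.length_map] at hx e hP ⊢
      nlinarith
    · rintro ⟨⟨S, L⟩, x⟩ ⟨hx, e⟩
      simp only [Prod.mk.injEq] at hx e ⊢
      rw [e.1, e.2]
      have h0 := hG1 x hx
      have h1 := (plans_bound (w x) (B x) j).1.trans (Nat.pow_le_pow_left (hG x hx) j)
      have h2 := hGp x hx (j + 2) (by omega)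
      have h3 := hGp x hx (j + 1) (by omega)
      have h4 := hGp x hx 1 (by omega)
      have h5 := (singlePlans_bound (w x) (B x)).2.1.trans (hG x hx)
      refine (Nat.mul_le_mul h5 (Nat.succ_le_succ (Nat.mul_le_mul_right _ h1))).trans ?_
      rw [Nat.succ_eq_add_one]
      have : G x * (G x ^ j * (G x + 1) + 1) = G x ^ (j + 2) + G x ^ (j + 1) + G x ^ 1 := by ring
      omega

theorem cutBlocks {k : γ → List Unit} {B : γ → List (List α)} {ℓ : γ → ℕ} (hk : Eff D T k)
    (hB : Eff D T B) (K : ℕ) (hBl : ∀ x, D x → ∀ b ∈ B x, b.length ≤ ℓ x)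
    (hT : ∀ x, D x → (B x).length * (ℓ x + 1) ≤ K * (T x + 1)) :
    Eff D T fun x => GC.cutBlocks (k x) (B x) := by
  refine mapAccum (Tb := ℓ) K hB hk (id.fst.drop id.snd.fst 1 ?_)
    ((zipWith (f := fun _ a _ => a) (Tb := fun _ => 0) 1 id.fst id.snd.fst id.fst ?_).congr
      fun q _ => (zipWith_fst _ _).symm) hT
  all_goals
    rintro q ⟨hx, hb⟩
    have := hBl _ hx _ hb
    try simp only [zero_add, mul_one]
    omega

theorem readParity (z c : ℕ) {w : γ → List Unit} {m y : γ → List Bool}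
    (hw : Eff D (fun _ => 0) w) (hm : Eff D T m) (hy : Eff D T y) (K : ℕ)
    (hmT : ∀ x, D x → (m x).length ≤ K * (T x + 1))
    (hT : ∀ x, D x → c * (m x).length * ((z + 1) * ((w x).length + 1) + 1) ≤ K * (T x + 1)) :
    Eff D T fun x => GC.readParity z c (w x) (m x) (y x) := by
  refine mapAccum (Tb := fun x => (z + 1) * ((w x).length + 1)) K (hm.copies c K hmT) hy
    (drop (unit.cons (copies z (hw.comp id.snd.snd 0 (fun _ h => h.1) fun _ _ => by simp) 1 ?_))
      id.snd.fst 1 ?_) (id.snd.fst.headD (bit false)) ?_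
  · rintro ⟨a, s, x⟩ -
    nlinarith
  · rintro ⟨a, s, x⟩ -
    simp only [List.length_cons, length_copies]
    nlinarith
  · intro x hx
    rw [length_copies]
    exact hT x hx

/-- A plan erases at most `2 * z` blocks and deletes at most `z * ℓ` bits at each; therefore
chunking and the test of the total number of deletions cost no more than the treatment of the
chunks. -/
theorem tryPlan (z c : ℕ) {B : γ → List (List (List Bool))} {par y : γ → List Bool}
    {d : γ → List Unit} {P : γ → Plan} {ℓ : γ → ℕ}
    (hB : Eff D (fun x => ((B x).length + ℓ x) * ℓ x ^ 2) B)
    (hp : Eff D (fun x => ((B x).length + ℓ x) * ℓ x ^ 2) par)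
    (hd : Eff D (fun x => ((B x).length + ℓ x) * ℓ x ^ 2) d)
    (hy : Eff D (fun x => ((B x).length + ℓ x) * ℓ x ^ 2) y)
    (hP : Eff D (fun x => ((B x).length + ℓ x) * ℓ x ^ 2) P)
    (hℓ : ∀ x, D x → 1 ≤ ℓ x) (hpl : ∀ x, D x → (par x).length ≤ c * ℓ x)
    (hBl : ∀ x, D x → ∀ b ∈ B x, b.length ≤ ℓ x ∧ ∀ r ∈ b, r.length ≤ c * ℓ x)
    (hdl : ∀ x, D x → (d x).length ≤ z * ℓ x)
    (hPl : ∀ x, D x → PlanBound (B x).length (2 * z) (z * ℓ x) (P x)) :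
    Eff D (fun x => ((B x).length + ℓ x) * ℓ x ^ 2)
      fun x => GC.tryPlan (B x) (par x) (d x) (y x) (P x) := by
  have hmon : ∀ x, D x → (B x).length * (ℓ x + 1) ≤ 2 * (((B x).length + ℓ x) * ℓ x ^ 2) ∧
      ℓ x ≤ ((B x).length + ℓ x) * ℓ x ^ 2 := by
    intro x hx
    have h1 := hℓ x hx
    have h2 : ℓ x ≤ ℓ x ^ 2 := by nlinarith
    have h3 : ℓ x ^ 2 ≤ ℓ x ^ 3 := by nlinarith [sq_nonneg (ℓ x)]
    have h4 := Nat.mul_le_mul (Nat.le_refl (B x).length) h2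
    have h5 := Nat.mul_le_mul (Nat.le_refl (B x).length) h1
    have : ((B x).length + ℓ x) * ℓ x ^ 2 = (B x).length * ℓ x ^ 2 + ℓ x ^ 3 := by ring
    constructor
    · rw [this]; nlinarith
    · rw [this]; omega
  have hcl : ∀ x, D x → (GC.chunk (y x) (P x) (B x)).length = (B x).length := by
    intro x hx
    simp [GC.chunk, length_mapAccum, (hPl x hx).1]
  have hc : Eff D (fun x => ((B x).length + ℓ x) * ℓ x ^ 2)
      fun x => GC.chunk (y x) (P x) (B x) := by
    refine hy.chunk (ℓ := fun x => (z + 1) * ℓ x) hP hB (2 * (z + 1)) ?_ ?_ ?_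
    · intro x hx e he
      have := (hPl x hx).2.2 e he
      nlinarith
    · intro x hx b hb
      have := (hBl x hx b hb).1
      nlinarith
    · intro x hx
      rw [(hPl x hx).1]
      have h1 := (hmon x hx).1
      have h2 : (B x).length * ((z + 1) * ℓ x + 1) ≤ (z + 1) * ((B x).length * (ℓ x + 1)) := by
        nlinarith [Nat.zero_le (z * (B x).length)]
      refine h2.trans ?_
      have h3 := Nat.mul_le_mul (Nat.le_refl (z + 1)) h1
      nlinarith
  have hitem : ∀ (y : List Bool) (P : Plan) (B : List (List (List Bool))) (b : ℕ),
      P.length = B.length → ((∀ r ∈ B, r.length ≤ b) →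
        ∀ q ∈ GC.chunk y P B, q.2.1 ∈ B ∧ q.2.2.length ≤ b) ∧
      (GC.chunk y P B).countP (·.1) = P.countP (·.1) := by
    intro y P B b
    unfold GC.chunk
    induction P generalizing y B with
    | nil => intro _; simp [GC.mapAccum]
    | cons e P ih =>
      intro h
      cases B with
      | nil => simp at h
      | cons r B =>
        have hlen : P.length = B.length := by simpa using h
        rw [List.zipWith_cons_cons, GC.mapAccum]
        refine ⟨fun hr q hq => ?_, ?_⟩
        · rcases List.mem_cons.1 hq with rfl | hq
          · refine ⟨by simp, ?_⟩
            have := hr r (by simp)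
            simp only [List.length_take, List.length_drop]
            omega
          · have := (ih _ B hlen).1 (fun r hr' => hr r (by simp [hr'])) q hq
            exact ⟨by simp [this.1], this.2⟩
        · rw [List.countP_cons, List.countP_cons, (ih _ B hlen).2]
  have ht := Eff.tryItems (D := D) (par := par) (I := fun x => GC.chunk (y x) (P x) (B x)) (ℓ := ℓ)
    c (2 * z) (hp.mono 1 (fun _ h => h) fun x hx => by rw [hcl x hx]; omega)
    (hc.mono 1 (fun _ h => h) fun x hx => by rw [hcl x hx]; omega) hℓ hpl
    (fun x hx q hq => by
      have := (hitem (y x) (P x) (B x) (ℓ x) (hPl x hx).1).1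
        (fun r hr => (hBl x hx r hr).1) q hq
      exact ⟨(hBl x hx _ this.1).1, this.2⟩)
    (fun x hx q hq => by
      have := (hitem (y x) (P x) (B x) (ℓ x) (hPl x hx).1).1
        (fun r hr => (hBl x hx r hr).1) q hq
      exact (hBl x hx _ this.1).2)
    (fun x hx => by
      rw [(hitem (y x) (P x) (B x) (ℓ x) (hPl x hx).1).2]
      exact (hPl x hx).2.1)
  refine ite (isEmpty (hd.drop (flatMap (f := fun _ (q : Bool × List Unit) => q.2)
    (Tb := fun x => z * ℓ x) (2 * (z + 1)) hP id.fst.snd ?_ ?_) z ?_))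
    (ht.mono 1 (fun _ h => h.1) fun x hx => by rw [hcl x hx.1]; omega) nil
    (fun x _ h => if_pos h) fun x _ h => if_neg (by rw [h]; simp)
  · intro x e hx he
    have := (hPl x hx).2.2 e he
    omega
  · intro x hx
    rw [(hPl x hx).1]
    have h1 := (hmon x hx).1
    have h2 : (B x).length * (z * ℓ x + 1) ≤ (z + 1) * ((B x).length * (ℓ x + 1)) := by
      nlinarith [Nat.zero_le (z * (B x).length)]
    refine h2.trans ?_
    have h3 := Nat.mul_le_mul (Nat.le_refl (z + 1)) h1
    nlinarith
  · intro x hx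
    have h1 := (hmon x hx).2
    exact (hdl x hx).trans (Nat.mul_le_mul_left z (by omega))

theorem agree {C : γ → List (List Bool)} {M : γ → ℕ} (hC : Eff D T C) (K : ℕ)
    (hM : ∀ x, D x → ∀ v ∈ C x, v.length ≤ M x)
    (hT : ∀ x, D x → (C x).length * (M x + 1) ≤ K * (T x + 1)) :
    Eff D T fun x => GC.agree (C x) := by
  refine uncons hC none (ite (all (f := fun (q : List Bool × List (List Bool) × γ) v' =>
    q.1 == v') (Tb := fun q => M q.2.2) K id.snd.fst (id.snd.fst.beqBool id.fst 1 ?_) ?_)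
    id.fst.some none (fun x _ h => ?_) fun x _ h => ?_)
    (h := fun x => GC.agree (C x)) (g := fun q => GC.agree (q.1 :: q.2.1))
    (fun x _ h => by simp [h, GC.agree]) fun x a t _ h => by rw [h]
  · rintro ⟨v', v, t, x⟩ ⟨⟨hx, e⟩, hv⟩
    have := hM x hx v (by rw [e]; simp)
    simp only
    omega
  · rintro ⟨v, t, x⟩ ⟨hx, e⟩
    refine le_trans ?_ (hT x hx)
    simp only at e ⊢
    rw [e, List.length_cons]
    exact Nat.mul_le_mul (Nat.le_succ _) le_rfl
  · exact if_pos h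
  · exact if_neg (by rw [h]; simp)

end Eff

end GC

/-! ### The running time of the decoder -/

namespace GC

theorem mem_cutBlocks {α : Type} {B : List (List α)} : ∀ {k : List Unit} {b : List α},
    b ∈ cutBlocks k B → ∃ b' ∈ B, ∃ n, b = b'.take n := by
  unfold cutBlocks
  induction B with
  | nil => simp [mapAccum]
  | cons a B ih =>
    intro k b hb
    rw [mapAccum, List.mem_cons] at hb
    rcases hb with rfl | hb
    · exact ⟨a, by simp, _, rfl⟩
    · obtain ⟨b', h, n, hn⟩ := ih hb
      exact ⟨b', by simp [h], n, hn⟩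

theorem length_cutBlocks {α : Type} (k : List Unit) (B : List (List α)) :
    (cutBlocks k B).length = B.length := length_mapAccum _ _ _ _

/-- The size conditions under which the decoder is efficient. -/
structure DecodeSizes (z c : ℕ)
    (x : (List Unit × List Bool × List (List (List Bool))) × List Unit × List Bool) : Prop where
  ne_nil : x.1.2.1 ≠ []
  window : x.1.1.length ≤ x.1.2.1.length
  guesses : x.1.2.2.length * (x.1.1.length + 1) ≤ x.2.1.length
  blocks_le : x.1.2.2.length * x.1.2.1.length ≤ 2 * x.2.1.length
  le_blocks : x.2.1.length ≤ x.1.2.2.length * x.1.2.1.length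
  sq_le : x.1.2.1.length ^ 2 ≤ 4 * x.2.1.length
  gen : ∀ g ∈ x.1.2.2, g.length = c ∧ ∀ s ∈ g, s.length = x.1.2.1.length
  received_le : x.2.2.length ≤ x.2.1.length + c * x.1.2.1.length * (z * x.1.1.length + 1)
  le_received : x.2.1.length + c * x.1.2.1.length * (z * x.1.1.length + 1) ≤
    x.2.2.length + z * x.1.2.1.length

theorem mem_chunk {ℓ : ℕ} {P : Plan} : ∀ {B : List (List (List Bool))} {y : List Bool},
    (∀ b ∈ B, b.length ≤ ℓ) → ∀ q ∈ chunk y P B, q.2.1.length ≤ ℓ ∧ q.2.2.length ≤ ℓ := by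
  unfold chunk
  induction P with
  | nil => simp [mapAccum]
  | cons e P ih =>
    intro B y hB
    cases B with
    | nil => simp [mapAccum]
    | cons b B =>
      intro q hq
      rw [List.zipWith_cons_cons, mapAccum, List.mem_cons] at hq
      have := hB b (by simp)
      rcases hq with rfl | hq
      · refine ⟨this, ?_⟩
        simp only [List.length_take, List.length_drop]
        omega
      · exact ih (fun b hb => hB b (List.mem_cons_of_mem _ hb)) q hq

theorem length_of_mem_tryPlan {ℓ : ℕ} {B : List (List (List Bool))} {par y : List Bool}
    {d : List Unit} {P : Plan} {v : List Bool} (hB : ∀ b ∈ B, b.length ≤ ℓ)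
    (h : v ∈ tryPlan B par d y P) : v.length ≤ B.length * ℓ := by
  unfold tryPlan at h
  split at h
  · unfold tryItems at h
    split at h
    · rw [List.mem_singleton] at h
      have h1 : (chunk y P B).length ≤ B.length := by
        simp [chunk, length_mapAccum]
      have h2 : ∀ q ∈ chunk y P B, q.2.1.length ≤ ℓ ∧ q.2.2.length ≤ ℓ := mem_chunk hB
      rw [h, List.length_flatMap]
      refine (List.sum_le_card_nsmul _ ℓ ?_).trans ?_
      · intro n hn
        obtain ⟨q, hq, rfl⟩ := List.mem_map.1 hn
        exact (mem_fill h2 _ q hq).2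
      · simp only [List.length_map, length_fill, smul_eq_mul]
        exact Nat.mul_le_mul_right _ h1
    · simp at h
  · simp at h

namespace Eff

/-- At most `k ^ z` plans are tried, at `O(k * ℓ)` steps each. The enumeration of the plans and the
comparison of the results stay within the same bound. -/
theorem decodeList {z c : ℕ} (hz : 1 ≤ z) :
    Eff (DecodeSizes z c) (fun x => x.2.1.length ^ (z + 1) * x.1.2.1.length)
      fun x => GC.agree (candidates z c x.1.1 x.1.2.1 x.1.2.2 x.2.1 x.2.2) := by
  have hℓ : ∀ x, DecodeSizes z c x → 1 ≤ x.1.2.1.length :=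
    fun x hx => List.length_pos_iff.2 hx.ne_nil
  have hk : ∀ x, DecodeSizes z c x → 1 ≤ x.2.1.length := fun x hx => by
    have := hx.sq_le; have := hℓ x hx; nlinarith
  have hblocks : ∀ x, DecodeSizes z c x → ∀ b ∈ GC.cutBlocks x.2.1
      (x.1.2.2.map (GC.blockRows x.1.2.1)), b.length ≤ x.1.2.1.length ∧
      ∀ r ∈ b, r.length ≤ c * x.1.2.1.length := by
    intro x hx b hb
    obtain ⟨b', hb', n, rfl⟩ := mem_cutBlocks hb
    obtain ⟨g, hg, rfl⟩ := List.mem_map.1 hb'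
    obtain ⟨h1, h2⟩ := hx.gen g hg
    refine ⟨?_, ?_⟩
    · rw [List.length_take, length_blockRows hx.ne_nil h2]
      exact min_le_right _ _
    · intro r hr
      rw [length_of_mem_blockRows hx.ne_nil h2 (List.mem_of_mem_take hr), h1]
  -- With `B * ℓ ≤ 2 * k` and `ℓ ^ 2 ≤ 4 * k` the three summands are at most `2 * k * ℓ`, `4 * k *
  -- ℓ` and `k * ℓ`.
  have hT : ∀ x, DecodeSizes z c x → (x.1.2.2.length + x.1.2.1.length) * x.1.2.1.length ^ 2 + 1 ≤
      7 * (x.2.1.length * x.1.2.1.length) := by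
    intro x hx
    have h1 := hx.blocks_le
    have h2 := hx.sq_le
    have h3 := Nat.mul_le_mul_right x.1.2.1.length h1
    have h4 := Nat.mul_le_mul_right x.1.2.1.length h2
    have h5 := Nat.mul_le_mul (hk x hx) (hℓ x hx)
    nlinarith
  have hplans : ∀ x, DecodeSizes z c x →
      (GC.plans x.1.1 x.1.2.2 z).length ≤ x.2.1.length ^ z := fun x hx =>
    (plans_bound _ _ z).1.trans (Nat.pow_le_pow_left hx.guesses z)
  have hcand : Eff (DecodeSizes z c) (fun x => x.2.1.length ^ (z + 1) * x.1.2.1.length)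
      fun x => candidates z c x.1.1 x.1.2.1 x.1.2.2 x.2.1 x.2.2 := by
    refine flatMap (Tb := fun x => (x.1.2.2.length + x.1.2.1.length) * x.1.2.1.length ^ 2) 7
      (plans z (G := fun x => x.2.1.length) id.fst.fst id.fst.snd.snd hk
        (fun x hx => hx.guesses) ?_ hz z le_rfl) ((Eff.tryPlan z c
        (B := fun q : Plan × (List Unit × List Bool × List (List (List Bool))) ×
          List Unit × List Bool => GC.cutBlocks q.2.2.1 (q.2.1.2.2.map (GC.blockRows q.2.1.2.1)))
        (par := fun q => GC.readParity z c q.2.1.1 q.2.1.2.1 (q.2.2.2.drop q.2.2.1.length))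
        (y := fun q => q.2.2.2)
        (d := fun q => (q.2.2.1 ++ (GC.copies c q.2.1.2.1).flatMap fun _ =>
          () :: GC.copies z q.2.1.1).drop q.2.2.2.length)
        (P := fun q => q.1) (ℓ := fun q => q.2.1.2.1.length)
        ?_ ?_ ?_ id.snd.snd.snd id.fst
        (fun q hq => hℓ q.2 hq.1) ?_ (fun q hq => hblocks q.2 hq.1) ?_ ?_).mono 1
        (fun _ h => h) ?_) ?_ ?_
    · intro x hx
      have := hℓ x hx
      exact Nat.le_mul_of_pos_right _ this
    · refine cutBlocks (ℓ := fun q => q.2.1.2.1.length) id.snd.snd.fst (map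
        (f := fun (q : Plan × (List Unit × List Bool × List (List (List Bool))) ×
          List Unit × List Bool) g => GC.blockRows q.2.1.2.1 g)
        (Tb := fun q => q.2.1.2.1.length ^ 2) 2 id.snd.fst.snd.snd
        (blockRows c id.snd.snd.fst.snd.fst id.fst (fun q hq => hq.1.1.ne_nil)
          (fun q hq => (hq.1.1.gen _ hq.2).1) (fun q hq => (hq.1.1.gen _ hq.2).2) 1
          fun q _ => by omega) ?_) 2 ?_ ?_
      · rintro ⟨P, x⟩ ⟨hx, -⟩
        have := hℓ x hx
        simp only [length_cutBlocks, List.length_map] at hx ⊢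
        have h2 : x.1.2.2.length * 1 ≤ x.1.2.2.length * x.1.2.1.length ^ 2 :=
          Nat.mul_le_mul le_rfl (Nat.one_le_pow _ _ this)
        nlinarith [Nat.zero_le (x.1.2.1.length ^ 3)]
      · rintro ⟨P, x⟩ ⟨hx, -⟩ b hb
        obtain ⟨g, hg, rfl⟩ := List.mem_map.1 hb
        exact (length_blockRows hx.ne_nil (hx.gen g hg).2).le
      · rintro ⟨P, x⟩ ⟨hx, -⟩
        have := hℓ x hx
        simp only [length_cutBlocks, List.length_map] at hx ⊢
        nlinarith [Nat.mul_le_mul this (Nat.mul_le_mul this this),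
          Nat.mul_le_mul (Nat.le_refl x.1.2.2.length) this]
    · refine readParity z c id.snd.fst.fst id.snd.fst.snd.fst (id.snd.snd.fst.drop
        id.snd.snd.snd 1 ?_) (4 * (c + 1) * (z + 2)) ?_ ?_
      · rintro ⟨P, x⟩ ⟨hx, -⟩
        have h1 := hℓ x hx
        have h2 := hx.le_blocks
        simp only [length_cutBlocks, List.length_map] at hx ⊢
        nlinarith [Nat.mul_le_mul h1 (Nat.mul_le_mul h1 h1),
          Nat.mul_le_mul (Nat.le_refl (x.1.2.2.length * x.1.2.1.length)) h1]
      · rintro ⟨P, x⟩ ⟨hx, -⟩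
        have h1 := hℓ x hx
        simp only [length_cutBlocks, List.length_map] at hx ⊢
        have h3 : x.1.2.1.length ≤ (x.1.2.2.length + x.1.2.1.length) * x.1.2.1.length ^ 2 + 1 := by
          nlinarith [Nat.mul_le_mul h1 (Nat.mul_le_mul h1 h1)]
        refine h3.trans (Nat.le_mul_of_pos_left _ (by positivity))
      · rintro ⟨P, x⟩ ⟨hx, -⟩
        have h1 := hℓ x hx
        have h2 := hx.window
        simp only [length_cutBlocks, List.length_map] at hx ⊢
        have h3 : x.1.2.1.length * x.1.2.1.length ≤
            (x.1.2.2.length + x.1.2.1.length) * x.1.2.1.length ^ 2 + 1 := by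
          nlinarith [Nat.mul_le_mul h1 (Nat.mul_le_mul h1 h1)]
        have h4 : (z + 1) * (x.1.1.length + 1) + 1 ≤ 4 * (z + 2) * x.1.2.1.length := by nlinarith
        calc _ ≤ (c + 1) * x.1.2.1.length * (4 * (z + 2) * x.1.2.1.length) :=
              Nat.mul_le_mul (Nat.mul_le_mul_right _ (Nat.le_succ c)) h4
          _ = 4 * (c + 1) * (z + 2) * (x.1.2.1.length * x.1.2.1.length) := by ring
          _ ≤ _ := Nat.mul_le_mul le_rfl h3
    · have hN : ∀ q : Plan × (List Unit × List Bool × List (List (List Bool))) ×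
          List Unit × List Bool, (DecodeSizes z c q.2 ∧ q.1 ∈ GC.plans q.2.1.1 q.2.1.2.2 z) →
          c * q.2.1.2.1.length * (z * q.2.1.1.length + 1) ≤ c * (z + 1) *
          (((GC.cutBlocks q.2.2.1 (q.2.1.2.2.map (GC.blockRows q.2.1.2.1))).length +
            q.2.1.2.1.length) * q.2.1.2.1.length ^ 2 + 1) ∧ q.2.2.1.length ≤
          1 * (((GC.cutBlocks q.2.2.1 (q.2.1.2.2.map (GC.blockRows q.2.1.2.1))).length +
            q.2.1.2.1.length) * q.2.1.2.1.length ^ 2 + 1) := by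
        rintro ⟨P, x⟩ ⟨hx, -⟩
        have h1 := hℓ x hx
        have h2 := hx.window
        have h2' := hx.le_blocks
        simp only [length_cutBlocks, List.length_map] at hx ⊢
        have h3 : x.1.2.1.length * x.1.2.1.length ≤
            (x.1.2.2.length + x.1.2.1.length) * x.1.2.1.length ^ 2 + 1 := by
          nlinarith [Nat.mul_le_mul h1 (Nat.mul_le_mul h1 h1)]
        have h4 : z * x.1.1.length + 1 ≤ (z + 1) * x.1.2.1.length := by nlinarith
        constructor
        · calc _ ≤ c * x.1.2.1.length * ((z + 1) * x.1.2.1.length) := Nat.mul_le_mul le_rfl h4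
            _ = c * (z + 1) * (x.1.2.1.length * x.1.2.1.length) := by ring
            _ ≤ _ := Nat.mul_le_mul le_rfl h3
        · nlinarith [Nat.mul_le_mul h1 (Nat.mul_le_mul h1 h1),
            Nat.mul_le_mul (Nat.le_refl (x.1.2.2.length * x.1.2.1.length)) h1]
      refine id.snd.snd.snd.drop (id.snd.snd.fst.append (flatMap
        (f := fun (q : Plan × (List Unit × List Bool × List (List (List Bool))) ×
          List Unit × List Bool) (_ : Bool) => () :: GC.copies z q.2.1.1)
        (Tb := fun q => z * q.2.1.1.length + q.2.1.1.length) (2 * (c + 1) * (z + 1))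
        (id.snd.fst.snd.fst.copies c 1 ?_)
        (unit.cons (id.snd.snd.fst.fst.copies z 1 ?_)) ?_ ?_) 1 ?_) (c * (z + 1) + 1) ?_
      · intro q hq
        have := hℓ q.2 hq.1
        nlinarith [Nat.mul_le_mul this (Nat.mul_le_mul this this)]
      · intro q hq
        have := hq.1.1.window
        nlinarith [Nat.zero_le (z * q.2.2.1.1.length)]
      · intro q b hq hb
        simp only [List.length_cons, length_copies]
        omega
      · rintro ⟨P, x⟩ ⟨hx, -⟩
        have h1 := hℓ x hx
        have h2 := hx.window
        simp only [length_cutBlocks, List.length_map, length_copies] at hx ⊢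
        have h3 : x.1.2.1.length * x.1.2.1.length ≤
            (x.1.2.2.length + x.1.2.1.length) * x.1.2.1.length ^ 2 + 1 := by
          nlinarith [Nat.mul_le_mul h1 (Nat.mul_le_mul h1 h1)]
        have h4 : z * x.1.1.length + x.1.1.length + 1 ≤ 2 * (z + 1) * x.1.2.1.length := by
          nlinarith [Nat.mul_le_mul (Nat.le_refl (z + 1)) h2]
        calc _ ≤ (c + 1) * x.1.2.1.length * (2 * (z + 1) * x.1.2.1.length) :=
              Nat.mul_le_mul (Nat.mul_le_mul_right _ (Nat.le_succ c)) h4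
          _ = 2 * (c + 1) * (z + 1) * (x.1.2.1.length * x.1.2.1.length) := by ring
          _ ≤ _ := Nat.mul_le_mul le_rfl h3
      · exact fun q hq => (hN q hq).2
      · intro q hq
        have h1 := hN q hq
        have h2 := hq.1.received_le
        refine h2.trans ((Nat.add_le_add h1.2 h1.1).trans (le_of_eq ?_))
        ring
    · rintro ⟨P, x⟩ -
      simp only [GC.readParity, length_mapAccum, length_copies, le_refl]
    · rintro ⟨P, x⟩ ⟨hx, -⟩
      have := hx.le_received
      simp only [List.length_drop, List.length_append, List.length_flatMap, List.length_cons,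
        length_copies, List.map_const', List.sum_replicate, smul_eq_mul]
      dsimp only at this
      omega
    · rintro ⟨P, x⟩ ⟨hx, hP⟩
      obtain ⟨h1, h2, h3⟩ := (plans_bound x.1.1 x.1.2.2 z).2 P hP
      refine ⟨by simp [length_cutBlocks, h1], h2, fun e he => (h3 e he).trans ?_⟩
      exact Nat.mul_le_mul_left z hx.window
    · rintro ⟨P, x⟩ -
      simp only [length_cutBlocks, List.length_map]
      omega
    · intro x P hx hP
      by_cases h : GC.tryPlan (GC.cutBlocks x.2.1 (x.1.2.2.map (GC.blockRows x.1.2.1)))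
        (GC.readParity z c x.1.1 x.1.2.1 (x.2.2.drop x.2.1.length))
        ((x.2.1 ++ (GC.copies c x.1.2.1).flatMap fun _ => () :: GC.copies z x.1.1).drop
          x.2.2.length) x.2.2 P = []
      · rw [h]; simp
      · unfold GC.tryPlan GC.tryItems at h ⊢
        split
        · split <;> simp
        · simp
    · intro x hx
      refine (Nat.mul_le_mul (hplans x hx) (hT x hx)).trans ?_
      rw [pow_succ]
      nlinarith
  refine hcand.agree (M := fun x => x.1.2.2.length * x.1.2.1.length) 3 ?_ ?_
  · intro x hx v hv
    obtain ⟨P, hP, hv⟩ := List.mem_flatMap.1 hv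
    have := length_of_mem_tryPlan (fun b hb => (hblocks x hx b hb).1) hv
    rwa [length_cutBlocks, List.length_map] at this
  · intro x hx
    have h1 : (candidates z c x.1.1 x.1.2.1 x.1.2.2 x.2.1 x.2.2).length ≤ x.2.1.length ^ z := by
      refine le_trans ?_ (hplans x hx)
      unfold candidates
      rw [List.length_flatMap]
      refine (List.sum_le_card_nsmul _ 1 ?_).trans (by simp)
      intro n hn
      obtain ⟨P, hP, rfl⟩ := List.mem_map.1 hn
      unfold GC.tryPlan GC.tryItems
      split
      · split <;> simp
      · simp
    have h2 := hx.blocks_le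
    have h3 := hk x hx
    have h4 := hℓ x hx
    have h5 : x.1.2.2.length * x.1.2.1.length + 1 ≤ 3 * (x.2.1.length * x.1.2.1.length) := by
      nlinarith
    refine (Nat.mul_le_mul h1 h5).trans ?_
    rw [pow_succ]
    nlinarith

end Eff

end GC

namespace GC

/-! ## Linear algebra on strings of bits -/

/-- A string of bits as a vector over the field with two elements. -/
def vec (l : List Bool) (i : ℕ) : ZMod 2 := if l.getD i false = true then 1 else 0

theorem vec_nil : vec [] = 0 := by
  funext i; simp [vec]

/-- The vector of a string does not see trailing zeros, hence the hypothesis on the lengths. -/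
theorem vec_inj {a b : List Bool} (hl : a.length = b.length) (h : vec a = vec b) : a = b := by
  refine List.ext_getElem hl fun i h1 h2 => ?_
  have := congrFun h i
  simp only [vec, List.getD_eq_getElem _ _ h1, List.getD_eq_getElem _ _ h2] at this
  revert this
  cases a[i] <;> cases b[i] <;> simp

theorem vec_xorList {a b : List Bool} (hl : a.length = b.length) :
    vec (xorList a b) = vec a + vec b := by
  funext i
  simp only [vec, Pi.add_apply]
  by_cases h : i < a.length
  · rw [List.getD_eq_getElem _ _ (by rw [length_xorList]; omega), List.getD_eq_getElem _ _ h,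
      List.getD_eq_getElem _ _ (hl ▸ h)]
    simp only [xorList, List.getElem_zipWith]
    cases a[i] <;> cases b[i] <;> decide
  · rw [List.getD_eq_default _ _ (by rw [length_xorList]; omega),
      List.getD_eq_default _ _ (by omega), List.getD_eq_default _ _ (by omega)]
    simp

theorem vec_map_false {α : Type} (l : List α) : vec (l.map fun _ => false) = 0 := by
  funext i
  by_cases h : i < l.length
  · simp [vec, h]
  · simp [vec, h]

theorem vec_eq_zero {l : List Bool} : vec l = 0 ↔ (l.all fun b => !b) = true := by
  rw [List.all_eq_true]
  constructor
  · intro h b hb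
    obtain ⟨i, hi, rfl⟩ := List.getElem_of_mem hb
    have := congrFun h i
    simp only [vec, List.getD_eq_getElem _ _ hi] at this
    revert this
    cases l[i] <;> simp
  · intro h
    funext i
    by_cases hi : i < l.length
    · have := h l[i] (List.getElem_mem hi)
      simp only [vec, List.getD_eq_getElem _ _ hi]
      simpa using this
    · rw [vec, List.getD_eq_default _ _ (not_lt.1 hi)]; simp

theorem vec_append (a b : List Bool) (i : ℕ) :
    vec (a ++ b) i = if i < a.length then vec a i else vec b (i - a.length) := by
  by_cases h : i < a.length
  · rw [if_pos h, vec, vec, List.getD_append _ _ _ _ h]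
  · rw [if_neg h, vec, vec, List.getD_append_right _ _ _ _ (not_lt.1 h)]

/-- The sum of the entries of `R` selected by `u`. -/
noncomputable def lin (u : List Bool) (R : List (List Bool)) : ℕ → ZMod 2 :=
  (List.zipWith (fun b r => if b = true then vec r else 0) u R).sum

theorem lin_append_right (u : List Bool) (R R' : List (List Bool)) :
    lin u (R ++ R') = lin (u.take R.length) R + lin (u.drop R.length) R' := by
  induction R generalizing u with
  | nil => simp [lin]
  | cons r R ih =>
    cases u with
    | nil => simp [lin]
    | cons b u =>
      have := ih u
      unfold lin at this ⊢
      simp [this, add_assoc]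

theorem addRows_spec {S : List Bool} {R : List (List Bool)} (u : List Bool)
    (hR : ∀ r ∈ R, r.length = S.length) :
    (addRows S u R).length = S.length ∧ vec (addRows S u R) = vec S + lin u R := by
  unfold addRows lin
  induction R generalizing u S with
  | nil => simp
  | cons r R ih =>
    cases u with
    | nil => simp
    | cons b u =>
      have hr := hR r (by simp)
      simp only [List.zipWith_cons_cons, List.foldl_cons, List.sum_cons]
      cases b
      · simpa using ih (S := S) u fun r' h => hR r' (by simp [h])
      · have hl : (xorList S r).length = S.length := by rw [length_xorList]; omega
        have := ih (S := xorList S r) u fun r' h => by rw [hl]; exact hR r' (by simp [h])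
        simp only [if_true, this, hl, vec_xorList hr.symm, add_assoc, and_self]

theorem lin_eq_sum (u : List Bool) (R : List (List Bool)) :
    lin u R = ∑ i ∈ Finset.range R.length,
      if u.getD i false = true then vec (R.getD i []) else 0 := by
  unfold lin
  induction R generalizing u with
  | nil => simp
  | cons r R ih =>
    rw [List.length_cons, Finset.sum_range_succ']
    cases u with
    | nil => simp
    | cons b u => simp [ih u, add_comm]

theorem getD_flatten {α : Type} {ℓ : ℕ} (hℓ : 0 < ℓ) (d : α) (L : List (List α))
    (h : ∀ l ∈ L, l.length = ℓ) (n : ℕ) :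
    L.flatten.getD n d = (L.getD (n / ℓ) []).getD (n % ℓ) d := by
  induction L generalizing n with
  | nil => simp
  | cons l L ih =>
    have hl := h l (by simp)
    rw [List.flatten_cons]
    by_cases hn : n < ℓ
    · rw [List.getD_append _ _ _ _ (by omega), Nat.div_eq_of_lt hn, Nat.mod_eq_of_lt hn]
      rfl
    · rw [List.getD_append_right _ _ _ _ (by omega), ih (fun l' h' => h l' (by simp [h'])), hl]
      obtain ⟨m, rfl⟩ := Nat.exists_eq_add_of_le (not_lt.1 hn)
      rw [Nat.add_sub_cancel_left, Nat.add_mod_left, Nat.add_div_left _ hℓ]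
      rfl

/-! ### Symbols as strings of bits -/

namespace Code

variable {k ℓ c : ℕ} (C : Code k ℓ c)

theorem length_pos {k ℓ c : ℕ} (C : Code k ℓ c) : 0 < ℓ := C.natDegree_eq ▸ C.irreducible.natDegree_pos

/-- The lower coefficients of the modulus. -/
noncomputable def modBits : List Bool :=
  List.ofFn fun i : Fin ℓ => decide (C.modulus.coeff (ℓ - 1 - i) = 1)

theorem length_modBits : C.modBits.length = ℓ := by simp [modBits]

theorem length_toBits (s : AdjoinRoot C.modulus) : (C.toBits s).length = ℓ := by simp [toBits]

theorem ite_eq_one (a : ZMod 2) : (if decide (a = 1) = true then (1 : ZMod 2) else 0) = a := by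
  revert a; decide

theorem vec_toBits (s : AdjoinRoot C.modulus) (i : ℕ) : vec (C.toBits s) i =
    if i < ℓ then (AdjoinRoot.modByMonicHom C.monic s).coeff (ℓ - 1 - i) else 0 := by
  unfold vec
  split
  · rename_i h
    split
    · rename_i hi
      rw [List.getD_eq_getElem _ _ (by rwa [length_toBits])] at h
      simp only [toBits, List.getElem_ofFn, decide_eq_true_eq] at h
      exact h.symm
    · rename_i hi
      rw [List.getD_eq_default _ _ (by rw [length_toBits]; omega)] at h
      simp at h
  · rename_i h
    split
    · rename_i hi
      rw [List.getD_eq_getElem _ _ (by rwa [length_toBits])] at h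
      simp only [toBits, List.getElem_ofFn, decide_eq_true_eq] at h
      generalize ((AdjoinRoot.modByMonicHom C.monic) s).coeff (ℓ - 1 - i) = a at h
      revert h; revert a; decide
    · rfl

theorem natDegree_modByMonicHom (s : AdjoinRoot C.modulus) :
    (AdjoinRoot.modByMonicHom C.monic s).degree < (ℓ : ℕ) := by
  obtain ⟨p, rfl⟩ := AdjoinRoot.mk_surjective s
  refine (Polynomial.degree_modByMonic_lt p C.monic).trans_le ?_
  rw [Polynomial.degree_eq_natDegree C.monic.ne_zero, C.natDegree_eq]

theorem toBits_injective {s t : AdjoinRoot C.modulus} (h : C.toBits s = C.toBits t) : s = t := by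
  have h1 : AdjoinRoot.modByMonicHom C.monic s = AdjoinRoot.modByMonicHom C.monic t := by
    ext i
    by_cases hi : i < ℓ
    · have h2 := C.vec_toBits s (ℓ - 1 - i)
      have h3 := C.vec_toBits t (ℓ - 1 - i)
      rw [← h] at h3
      rw [if_pos (by omega), show ℓ - 1 - (ℓ - 1 - i) = i by omega] at h2 h3
      exact h2.symm.trans h3
    · have hd : ∀ s, (AdjoinRoot.modByMonicHom C.monic s).coeff i = 0 := fun s =>
        Polynomial.coeff_eq_zero_of_degree_lt ((C.natDegree_modByMonicHom s).trans_le (by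
          exact_mod_cast not_lt.1 hi))
      rw [hd, hd]
  rw [← AdjoinRoot.mk_leftInverse C.monic s, ← AdjoinRoot.mk_leftInverse C.monic t, h1]

/-- Let `p` be the polynomial of degree less than `ℓ` that represents the symbol. The remainder of
`X * p` is `X * p` minus the modulus times the top coefficient of `p`. On bits this is a shift,
followed by adding the lower part of the modulus if the bit shifted out is one. -/
theorem toBits_mul_root (s : AdjoinRoot C.modulus) :
    C.toBits (AdjoinRoot.root C.modulus * s) = mulRoot C.modBits (C.toBits s) := by
  have hℓ := C.length_pos
  have hne : C.modBits ≠ [] := by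
    rw [← List.length_pos_iff, length_modBits]; exact hℓ
  set p := AdjoinRoot.modByMonicHom C.monic s with hp
  have hdeg := C.natDegree_modByMonicHom s
  have hroot : AdjoinRoot.modByMonicHom C.monic (AdjoinRoot.root C.modulus * s)
      = Polynomial.X * p - Polynomial.C (p.coeff (ℓ - 1)) * C.modulus := by
    conv_lhs => rw [← AdjoinRoot.mk_leftInverse C.monic s, ← hp, ← AdjoinRoot.mk_X, ← map_mul,
      AdjoinRoot.modByMonicHom_mk]
    have h1 : Polynomial.X * p = (Polynomial.X * p - Polynomial.C (p.coeff (ℓ - 1)) * C.modulus)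
      + C.modulus * Polynomial.C (p.coeff (ℓ - 1)) := by ring
    have h2 := (Polynomial.div_modByMonic_unique (f := Polynomial.X * p)
      (Polynomial.C (p.coeff (ℓ - 1)))
      (Polynomial.X * p - Polynomial.C (p.coeff (ℓ - 1)) * C.modulus) C.monic ⟨h1.symm, ?_⟩).2
    · exact h2
    · rw [Polynomial.degree_eq_natDegree C.monic.ne_zero, C.natDegree_eq,
        Polynomial.degree_lt_iff_coeff_zero]
      intro m hm
      obtain ⟨n, rfl⟩ : ∃ n, m = n + 1 := ⟨m - 1, by omega⟩
      rw [Polynomial.coeff_sub, Polynomial.coeff_X_mul, Polynomial.coeff_C_mul]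
      rcases eq_or_lt_of_le hm with h | h
      · have : C.modulus.coeff (n + 1) = 1 := by
          have := C.monic.coeff_natDegree
          exact (congrArg _ (h.symm.trans C.natDegree_eq.symm)).trans this
        rw [this, mul_one, show ℓ - 1 = n by omega, sub_self]
      · rw [Polynomial.coeff_eq_zero_of_natDegree_lt (p := C.modulus) (by
          rw [C.natDegree_eq]; omega), Polynomial.coeff_eq_zero_of_degree_lt (p := p)
          (hdeg.trans_le (by exact_mod_cast (by omega : ℓ ≤ n)))]
        simp
  refine vec_inj (by rw [length_mulRoot (by rw [length_toBits, length_modBits]) hne,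
    length_toBits, length_modBits]) ?_
  have hhead : (C.toBits s).headD false = decide (p.coeff (ℓ - 1) = 1) := by
    have : (C.toBits s).headD false = (C.toBits s).getD 0 false := by
      cases C.toBits s <;> rfl
    rw [this, List.getD_eq_getElem _ _ (by rwa [length_toBits])]
    simp [toBits, hp]
  have htail : ∀ i, i < ℓ → vec ((C.toBits s).tail ++ [false]) i = (Polynomial.X * p).coeff
      (ℓ - 1 - i) := by
    intro i hi
    rw [vec_append]
    split
    · rename_i h
      rw [List.length_tail, length_toBits] at h
      have : vec (C.toBits s).tail i = vec (C.toBits s) (i + 1) := by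
        cases C.toBits s <;> simp [vec]
      rw [this, C.vec_toBits, if_pos (by omega), ← hp,
        show ℓ - 1 - i = (ℓ - 1 - (i + 1)) + 1 by omega, Polynomial.coeff_X_mul]
    · rename_i h
      rw [List.length_tail, length_toBits] at h
      rw [show ℓ - 1 - i = 0 by omega, Polynomial.mul_coeff_zero]
      simp [vec]
  have hmod : ∀ i, i < ℓ → vec C.modBits i = C.modulus.coeff (ℓ - 1 - i) := by
    intro i hi
    rw [vec, List.getD_eq_getElem _ _ (by rwa [length_modBits])]
    simp only [modBits, List.getElem_ofFn]
    exact ite_eq_one _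
  funext i
  by_cases hi : i < ℓ
  · rw [C.vec_toBits, if_pos hi, hroot, Polynomial.coeff_sub, Polynomial.coeff_C_mul,
      ← htail i hi, ← hmod i hi]
    unfold mulRoot
    rw [hhead]
    by_cases h1 : p.coeff (ℓ - 1) = 1
    · rw [if_pos (by simpa using h1), vec_xorList (by simp [length_toBits, length_modBits]; omega),
        h1, one_mul, Pi.add_apply, CharTwo.sub_eq_add]
    · have h0 : p.coeff (ℓ - 1) = 0 := by
        revert h1; generalize p.coeff (ℓ - 1) = a; revert a; decide
      rw [if_neg (by simpa using h1), h0, zero_mul, sub_zero]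
  · have hz : ∀ l : List Bool, l.length = ℓ → vec l i = 0 := fun l h => by
      rw [vec, List.getD_eq_default _ _ (by omega)]; simp
    rw [hz _ (C.length_toBits _), hz _ (by rw [length_mulRoot (by
      rw [length_toBits, length_modBits]) hne, length_modBits])]

end Code

end GC

/-! ### The parity bits as a linear function of the message bits -/

namespace GC
namespace Code

variable {k ℓ c : ℕ} (C : Code k ℓ c)

/-- The bits of `c` symbols as a vector. -/
noncomputable def symbolVec : (Fin c → AdjoinRoot C.modulus) →+ (ℕ → ZMod 2) where
  toFun X n := if h : n / ℓ < c then
    (AdjoinRoot.modByMonicHom C.monic (X ⟨n / ℓ, h⟩)).coeff (ℓ - 1 - n % ℓ) else 0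
  map_zero' := by funext n; simp
  map_add' X Y := by
    funext n
    by_cases h : n / ℓ < c <;> simp [h]

/-- The bits of `c` symbols as a string. -/
noncomputable def symbolBits (X : Fin c → AdjoinRoot C.modulus) : List Bool :=
  (List.ofFn fun r => C.toBits (X r)).flatten

theorem length_symbolBits (X : Fin c → AdjoinRoot C.modulus) :
    (C.symbolBits X).length = c * ℓ := by
  rw [symbolBits, List.length_flatten, List.map_ofFn]
  have : (List.length ∘ fun r => C.toBits (X r)) = fun _ => ℓ := by
    funext r; simp [length_toBits]
  rw [this, List.ofFn_const]
  simp

theorem vec_symbolBits (X : Fin c → AdjoinRoot C.modulus) :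
    vec (C.symbolBits X) = C.symbolVec X := by
  funext n
  have hℓ := C.length_pos
  have h1 : vec (C.symbolBits X) n
      = vec ((List.ofFn fun r => C.toBits (X r)).getD (n / ℓ) []) (n % ℓ) := by
    unfold vec symbolBits
    rw [getD_flatten hℓ]
    intro l hl
    obtain ⟨r, rfl⟩ := List.mem_ofFn.1 hl
    exact C.length_toBits _
  rw [h1]
  by_cases h : n / ℓ < c
  · rw [List.getD_eq_getElem _ _ (by simpa using h), List.getElem_ofFn, vec_toBits,
      if_pos (Nat.mod_lt _ hℓ)]
    simp [symbolVec, h]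
  · rw [List.getD_eq_default _ _ (by simpa using h), vec_nil]
    simp [symbolVec, h]

theorem symbolBits_injective {X Y : Fin c → AdjoinRoot C.modulus}
    (h : C.symbolVec X = C.symbolVec Y) : X = Y := by
  funext r
  refine C.toBits_injective (vec_inj (by simp [length_toBits]) ?_)
  funext i
  rw [vec_toBits, vec_toBits]
  split
  · rename_i hi
    have h1 := congrFun h (r * ℓ + i)
    have hd : (r * ℓ + i) / ℓ = r := by
      rw [mul_comm, Nat.mul_add_div C.length_pos, Nat.div_eq_of_lt hi, add_zero]
    have hm : (r * ℓ + i) % ℓ = i := by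
      rw [mul_comm, Nat.mul_add_mod, Nat.mod_eq_of_lt hi]
    simpa [symbolVec, hd, hm] using h1
  · rfl

theorem parityBits_eq (u : Fin k → Bool) :
    C.parityBits u = C.symbolBits (C.symbols u ᵥ* C.gen) := rfl

theorem length_parityBits (u : Fin k → Bool) : (C.parityBits u).length = c * ℓ :=
  C.length_symbolBits _

/-- The bit of a message at a position, and zero beyond the end. -/
def bitAt (u : Fin k → Bool) (p : ℕ) : Bool := (List.ofFn u).getD p false

theorem bitAt_of_lt (u : Fin k → Bool) {p : ℕ} (h : p < k) : bitAt u p = u ⟨p, h⟩ := by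
  rw [bitAt, List.getD_eq_getElem _ _ (by simpa using h)]
  simp

theorem bitAt_of_le (u : Fin k → Bool) {p : ℕ} (h : k ≤ p) : bitAt u p = false :=
  List.getD_eq_default _ _ (by simpa using h)

theorem symbols_eq (u : Fin k → Bool) (j : Fin (numBlocks k ℓ)) :
    C.symbols u j = ∑ i : Fin ℓ, if bitAt u (j * ℓ + i) = true then
      AdjoinRoot.root C.modulus ^ (ℓ - 1 - i : ℕ) else 0 := by
  unfold symbols
  refine Finset.sum_congr rfl fun i _ => ?_
  by_cases h : j * ℓ + i < k
  · simp [h, bitAt_of_lt u h]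
  · simp [h, bitAt_of_le u (not_lt.1 h)]

/-- The sum defining a symbol comes from a polynomial of degree less than `ℓ`, which is its own
remainder, so the message bits are its coefficients. Beyond the end of the message the padding gives
zero. -/
theorem coeff_symbols (u : Fin k → Bool) (j : Fin (numBlocks k ℓ)) (i : Fin ℓ) :
    (AdjoinRoot.modByMonicHom C.monic (C.symbols u j)).coeff (ℓ - 1 - i) =
      if bitAt u (j * ℓ + i) = true then 1 else 0 := by
  have h1 : C.symbols u j = AdjoinRoot.mk C.modulus (∑ i : Fin ℓ,
      if bitAt u (j * ℓ + i) = true then (Polynomial.X : (ZMod 2)[X]) ^ (ℓ - 1 - i : ℕ) else 0) := by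
    rw [symbols_eq, map_sum]
    refine Finset.sum_congr rfl fun i _ => ?_
    split
    · simp
    · simp
  rw [h1, AdjoinRoot.modByMonicHom_mk, (Polynomial.modByMonic_eq_self_iff C.monic).2,
    Polynomial.finsetSum_coeff, Finset.sum_eq_single i]
  · split <;> simp
  · intro i' _ hne
    split
    · rw [Polynomial.coeff_X_pow, if_neg]
      intro h
      apply hne
      ext
      have := i.2
      have := i'.2
      omega
    · simp
  · simp
  · rw [Polynomial.degree_eq_natDegree C.monic.ne_zero, C.natDegree_eq]
    refine (Polynomial.degree_sum_le _ _).trans_lt ?_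
    rw [Finset.sup_lt_iff (by exact_mod_cast WithBot.bot_lt_coe ℓ)]
    intro i _
    split
    · rw [Polynomial.degree_X_pow]
      have := i.2
      exact_mod_cast (by omega : ℓ - 1 - (i : ℕ) < ℓ)
    · rw [Polynomial.degree_zero]
      exact WithBot.bot_lt_coe ℓ

theorem lt_numBlocks {p : ℕ} (hp : p < k) (hℓ : 0 < ℓ) : p / ℓ < numBlocks k ℓ := by
  unfold numBlocks
  rw [Nat.lt_iff_add_one_le, Nat.le_div_iff_mul_le hℓ]
  have := Nat.div_mul_le_self p ℓ
  rw [add_mul, one_mul]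
  omega

/-- Messages which agree off `c` blocks are equal if they have the same parities. -/
theorem eq_of_parityBits_eq {u v : Fin k → Bool} (hp : C.parityBits u = C.parityBits v)
    (E : Finset ℕ) (hE : E.card ≤ c) (h : ∀ p : Fin k, (p : ℕ) / ℓ ∉ E → u p = v p) : u = v := by
  classical
  have hℓ := C.length_pos
  have h1 : C.symbols u ᵥ* C.gen = C.symbols v ᵥ* C.gen := by
    apply C.symbolBits_injective
    rw [← vec_symbolBits, ← vec_symbolBits, ← parityBits_eq, ← parityBits_eq, hp]
  have h2 : C.symbols u = C.symbols v := by
    by_contra hne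
    -- The difference of the two symbol vectors has zero parities, so its own weight would have to
    -- be at least `c + 1`; but it vanishes off the blocks in `E`.
    have h3 := C.mds (C.symbols u - C.symbols v) (sub_ne_zero.2 hne)
    rw [Matrix.sub_vecMul, h1, sub_self, hammingNorm_zero, add_zero] at h3
    refine absurd (h3.trans ?_) (by omega : ¬ c + 1 ≤ E.card)
    · unfold hammingNorm
      refine Finset.card_le_card_of_injOn (fun j => (j : ℕ)) ?_ (fun a _ b _ h => Fin.ext h)
      intro j hj
      by_contra hjE
      simp only [Finset.coe_filter, Finset.mem_univ, true_and, Set.mem_ofPred_eq, Pi.sub_apply,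
        ne_eq] at hj
      apply hj
      rw [sub_eq_zero, symbols_eq, symbols_eq]
      refine Finset.sum_congr rfl fun i _ => ?_
      have : bitAt u (j * ℓ + i) = bitAt v (j * ℓ + i) := by
        by_cases hk : (j : ℕ) * ℓ + i < k
        · rw [bitAt_of_lt u hk, bitAt_of_lt v hk]
          apply h
          have hd : ((j : ℕ) * ℓ + i) / ℓ = j := by
            rw [mul_comm, Nat.mul_add_div hℓ, Nat.div_eq_of_lt i.2, add_zero]
          change ((j : ℕ) * ℓ + i) / ℓ ∉ E
          rw [hd]
          exact hjE
        · rw [bitAt_of_le u (not_lt.1 hk), bitAt_of_le v (not_lt.1 hk)]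
      rw [this]
  funext p
  have hb := lt_numBlocks p.2 hℓ
  have h3 := C.coeff_symbols u ⟨p / ℓ, hb⟩ ⟨p % ℓ, Nat.mod_lt _ hℓ⟩
  have h4 := C.coeff_symbols v ⟨p / ℓ, hb⟩ ⟨p % ℓ, Nat.mod_lt _ hℓ⟩
  rw [h2] at h3
  have h5 := h3.symm.trans h4
  simp only [Nat.div_add_mod', bitAt_of_lt u p.2, bitAt_of_lt v p.2, Fin.eta] at h5
  revert h5
  cases u p <;> cases v p <;> simp

/-- The row of the generator matrix for a block, as strings of bits. -/
noncomputable def genRow (j : Fin (numBlocks k ℓ)) : List (List Bool) :=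
  List.ofFn fun r => C.toBits (C.gen j r)

theorem description_eq (w : ℕ) :
    C.description w = (List.replicate w (), C.modBits, List.ofFn C.genRow) := rfl

theorem blockRows_spec_aux (X : Fin c → AdjoinRoot C.modulus) (l : List Bool) :
    ∀ o : List (List Bool), l.foldl (fun (s : List (List Bool) × List (List Bool)) _ =>
      (s.1.map (mulRoot C.modBits), s.1.flatten :: s.2)) (List.ofFn fun r => C.toBits (X r), o)
    = (List.ofFn fun r => C.toBits (AdjoinRoot.root C.modulus ^ l.length * X r),
      ((List.range l.length).reverse.map fun i =>
        C.symbolBits fun r => AdjoinRoot.root C.modulus ^ i * X r) ++ o) := by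
  induction l using List.reverseRecOn with
  | nil => intro o; simp
  | append_singleton l a ih =>
    intro o
    rw [List.foldl_append, ih, List.length_append, List.length_singleton, List.range_succ]
    simp only [List.foldl_cons, List.foldl_nil, List.map_ofFn, List.reverse_append,
      List.reverse_singleton, List.map_cons, Prod.mk.injEq,
      List.cons_append, List.nil_append]
    refine ⟨?_, rfl⟩
    congr 1
    funext r
    rw [Function.comp_apply, ← toBits_mul_root, ← mul_assoc, ← pow_succ']

/-- The loop puts the row for `α ^ 0` down first and each later power in front of it. The powers
thus end up in decreasing order, which is the order of the bits within a block. -/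
theorem blockRows_genRow (j : Fin (numBlocks k ℓ)) :
    blockRows C.modBits (C.genRow j) = (List.range ℓ).reverse.map fun i =>
      C.symbolBits fun r => AdjoinRoot.root C.modulus ^ i * C.gen j r := by
  unfold blockRows genRow
  rw [blockRows_spec_aux, length_modBits, List.append_nil]

theorem length_blockRows_genRow (j : Fin (numBlocks k ℓ)) :
    (blockRows C.modBits (C.genRow j)).length = ℓ := by
  rw [blockRows_genRow]; simp

theorem length_of_mem_blockRows_genRow (j : Fin (numBlocks k ℓ)) {r : List Bool}
    (hr : r ∈ blockRows C.modBits (C.genRow j)) : r.length = c * ℓ := by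
  rw [blockRows_genRow] at hr
  obtain ⟨i, -, rfl⟩ := List.mem_map.1 hr
  exact C.length_symbolBits _

theorem getD_blockRows_genRow (j : Fin (numBlocks k ℓ)) (i : Fin ℓ) :
    (blockRows C.modBits (C.genRow j)).getD i [] =
      C.symbolBits fun r => AdjoinRoot.root C.modulus ^ (ℓ - 1 - i : ℕ) * C.gen j r := by
  rw [List.getD_eq_getElem _ _ (by rw [length_blockRows_genRow]; exact i.2)]
  simp only [blockRows_genRow, List.getElem_map, List.getElem_reverse, List.getElem_range,
    List.length_range]

/-- The bits of a message in a block. -/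
def blockBits (ℓ : ℕ) (u : Fin k → Bool) (j : ℕ) : List Bool :=
  ((List.ofFn u).drop (j * ℓ)).take ℓ

theorem getD_blockBits (u : Fin k → Bool) (j : ℕ) {i : ℕ} (hi : i < ℓ) :
    (blockBits ℓ u j).getD i false = bitAt u (j * ℓ + i) := by
  unfold blockBits bitAt
  simp [List.getD_eq_getElem?_getD, hi]

/-- The link from the field to bits: bit `i` of block `j` contributes `α ^ (ℓ - 1 - i)` times row
`j` of the generator matrix. Padding needs no separate treatment, because missing bits select no
row. -/
theorem vec_parityBits (u : Fin k → Bool) : vec (C.parityBits u) =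
    ∑ j : Fin (numBlocks k ℓ), lin (blockBits ℓ u j) (blockRows C.modBits (C.genRow j)) := by
  rw [parityBits_eq, vec_symbolBits]
  have h1 : C.symbols u ᵥ* C.gen = ∑ j : Fin (numBlocks k ℓ), ∑ i : Fin ℓ, if bitAt u (j * ℓ + i) = true then
      (fun r => AdjoinRoot.root C.modulus ^ (ℓ - 1 - i : ℕ) * C.gen j r) else 0 := by
    funext r
    rw [Finset.sum_apply, Matrix.vecMul, dotProduct]
    refine Finset.sum_congr rfl fun j _ => ?_
    rw [symbols_eq, Finset.sum_mul, Finset.sum_apply]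
    refine Finset.sum_congr rfl fun i _ => ?_
    split <;> simp
  rw [h1, map_sum]
  refine Finset.sum_congr rfl fun j _ => ?_
  rw [map_sum, lin_eq_sum, length_blockRows_genRow, Finset.sum_range]
  refine Finset.sum_congr rfl fun i _ => ?_
  rw [getD_blockBits u j i.2, getD_blockRows_genRow, vec_symbolBits]
  split
  · rfl
  · exact map_zero _

theorem lin_flatten {α : Type} {ℓ : ℕ} (f : α → List (List Bool)) (u : List Bool) (L : List α)
    (hL : ∀ l ∈ L, (f l).length = ℓ) : lin u (L.flatMap f) =
    ∑ j : Fin L.length, lin ((u.drop (j * ℓ)).take ℓ) (f L[j]) := by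
  induction L generalizing u with
  | nil => simp [lin]
  | cons l L ih =>
    have hl := hL l (by simp)
    rw [List.flatMap_cons, lin_append_right, hl, ih _ fun l' h => hL l' (by simp [h])]
    refine Eq.trans ?_ (Fin.sum_univ_succ (n := L.length) fun j =>
      lin ((u.drop (j * ℓ)).take ℓ) (f (l :: L)[j])).symm
    congr 1
    · simp
    · refine Finset.sum_congr rfl fun j _ => ?_
      simp only [Fin.val_succ, List.drop_drop, Fin.getElem_fin, List.getElem_cons_succ]
      rw [show ℓ + (j : ℕ) * ℓ = ((j : ℕ) + 1) * ℓ by ring]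

theorem encodeList_eq (z w : ℕ) (u : Fin k → Bool) :
    encodeList z c (List.replicate w ()) C.modBits (List.ofFn C.genRow) (List.ofFn u) =
      C.encode z w u := by
  unfold encodeList encode
  have h0 : ((copies c C.modBits).map fun _ => false).length = c * ℓ := by
    rw [List.length_map, length_copies, length_modBits]
  have h2 := addRows_spec (S := (copies c C.modBits).map fun _ => false) (List.ofFn u)
    (R := (List.ofFn C.genRow).flatMap (blockRows C.modBits)) (by
      intro r hr
      obtain ⟨g, hg, hr⟩ := List.mem_flatMap.1 hr
      obtain ⟨j, rfl⟩ := List.mem_ofFn.1 hg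
      rw [h0]
      exact C.length_of_mem_blockRows_genRow j hr)
  have h1 : addRows ((copies c C.modBits).map fun _ => false) (List.ofFn u)
      ((List.ofFn C.genRow).flatMap (blockRows C.modBits)) = C.parityBits u := by
    refine vec_inj (by rw [h2.1, h0, length_parityBits]) ?_
    rw [h2.2, vec_map_false, zero_add, vec_parityBits, lin_flatten (ℓ := ℓ)]
    · refine Fintype.sum_equiv (finCongr (by simp)) _ _ fun j => ?_
      simp only [blockBits, Fin.getElem_fin, List.getElem_ofFn, finCongr_apply, Fin.val_cast]
      rfl
    · intro g hg
      obtain ⟨j, rfl⟩ := List.mem_ofFn.1 hg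
      exact C.length_blockRows_genRow j
  rw [h1]
  congr 2
  funext b
  rw [List.map_const', List.length_cons, length_copies, List.length_replicate]

end Code
end GC

namespace GC

/-! ## Cauchy matrices -/

/-- Multiplying entry `r` of the parity vector by `∏ i ∈ S, (x i - y r)`, with `S` the support of
`U`, gives the value at `y r` of a polynomial of degree less than `S.card`. It is not zero, as its
value at `x j₀` is a nonzero multiple of `U j₀`. So fewer than `S.card` parities vanish. -/
theorem cauchy_mds {K : Type*} [Field K] [DecidableEq K] {m c : ℕ} (x : Fin m → K)
    (y : Fin c → K) (hx : Function.Injective x) (hy : Function.Injective y)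
    (hxy : ∀ j r, x j ≠ y r) (U : Fin m → K) (hU : U ≠ 0) :
    c + 1 ≤ hammingNorm U + hammingNorm (U ᵥ* Matrix.of fun j r => (x j - y r)⁻¹) := by
  set V := U ᵥ* Matrix.of fun j r => (x j - y r)⁻¹ with hV
  let S : Finset (Fin m) := Finset.univ.filter fun j => U j ≠ 0
  let Z : Finset (Fin c) := Finset.univ.filter fun r => V r = 0
  have hS : hammingNorm U = S.card := rfl
  have hZ : hammingNorm V + Z.card = c := by
    have := Finset.card_filter_add_card_filter_not (s := (Finset.univ : Finset (Fin c)))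
      (fun r => V r = 0)
    rw [Finset.card_univ, Fintype.card_fin] at this
    rw [add_comm]
    convert this using 2
    unfold hammingNorm
    congr
  suffices h : Z.card < S.card by omega
  obtain ⟨j₀, hj₀⟩ := Function.ne_iff.1 hU
  have hj₀S : j₀ ∈ S := by simpa [S] using hj₀
  let P : K[X] := ∑ j ∈ S, Polynomial.C (U j) *
    ∏ i ∈ S.erase j, (Polynomial.C (x i) - Polynomial.X)
  have hdeg : P.natDegree < S.card := by
    have hpos : 0 < S.card := Finset.card_pos.2 ⟨j₀, hj₀S⟩
    refine lt_of_le_of_lt (Polynomial.natDegree_sum_le_of_forall_le (n := S.card - 1) _ _ ?_)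
      (by omega)
    intro j hj
    refine (Polynomial.natDegree_C_mul_le _ _).trans ?_
    refine (Polynomial.natDegree_prod_le _ _).trans ?_
    refine (Finset.sum_le_card_nsmul _ _ 1 fun i _ => ?_).trans ?_
    · refine (Polynomial.natDegree_sub_le _ _).trans ?_
      simp
    · rw [Finset.card_erase_of_mem hj]; simp
  have hP : P ≠ 0 := by
    intro h0
    have h1 : P.eval (x j₀) = U j₀ * ∏ i ∈ S.erase j₀, (x i - x j₀) := by
      simp only [P, Polynomial.eval_finsetSum, Polynomial.eval_mul, Polynomial.eval_C,
        Polynomial.eval_prod, Polynomial.eval_sub, Polynomial.eval_X]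
      refine Finset.sum_eq_single_of_mem j₀ hj₀S fun j _ hne => ?_
      rw [Finset.prod_eq_zero (Finset.mem_erase.2 ⟨hne.symm, hj₀S⟩) (sub_self _), mul_zero]
    rw [h0, Polynomial.eval_zero] at h1
    refine mul_ne_zero hj₀ (Finset.prod_ne_zero_iff.2 fun i hi => ?_) h1.symm
    exact sub_ne_zero.2 fun h => (Finset.mem_erase.1 hi).1 (hx h)
  by_contra hlt
  refine hP (Polynomial.eq_zero_of_natDegree_lt_card_of_eval_eq_zero' P (Z.image y) ?_ ?_)
  · intro t ht
    obtain ⟨r, hr, rfl⟩ := Finset.mem_image.1 ht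
    have hr0 : V r = 0 := by simpa [Z] using hr
    have h1 : P.eval (y r) = (∏ i ∈ S, (x i - y r)) * V r := by
      have h2 : V r = ∑ j ∈ S, U j * (x j - y r)⁻¹ := by
        rw [hV, Matrix.vecMul, dotProduct]
        refine (Finset.sum_subset (Finset.subset_univ S) fun j _ hj => ?_).symm
        have : U j = 0 := by simpa [S] using hj
        rw [this, zero_mul]
      rw [h2, Finset.mul_sum]
      simp only [P, Polynomial.eval_finsetSum, Polynomial.eval_mul, Polynomial.eval_C,
        Polynomial.eval_prod, Polynomial.eval_sub, Polynomial.eval_X]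
      refine Finset.sum_congr rfl fun j hj => ?_
      rw [← Finset.mul_prod_erase S _ hj]
      have := sub_ne_zero.2 (hxy j r)
      field_simp
    rw [h1, hr0, mul_zero]
  · rw [Finset.card_image_of_injective _ hy]
    omega

/-- The minimal polynomial of a primitive element of the field with `2 ^ ℓ` elements. -/
theorem exists_irreducible (ℓ : ℕ) (hℓ : ℓ ≠ 0) :
    ∃ f : (ZMod 2)[X], f.Monic ∧ Irreducible f ∧ f.natDegree = ℓ := by
  obtain ⟨α, hα⟩ := Field.exists_primitive_element (ZMod 2) (GaloisField 2 ℓ)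
  have hint : IsIntegral (ZMod 2) α := Algebra.IsIntegral.isIntegral α
  refine ⟨minpoly (ZMod 2) α, minpoly.monic hint, minpoly.irreducible hint, ?_⟩
  rw [(Field.primitive_element_iff_minpoly_natDegree_eq (ZMod 2) α).1 hα,
    GaloisField.finrank 2 hℓ]

/-- A Cauchy matrix needs one field element for each block and each parity, all distinct. For `2 ≤
ℓ` the blocks use at most half of the field and one more element, and `hc` leaves room for `c`
others. -/
theorem exists_cauchy_code (c ℓ : ℕ) (hℓ : 2 ≤ ℓ) (hc : 2 * (c + 1) ≤ 2 ^ ℓ) :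
    ∃ C : Code (2 ^ ℓ) ℓ c, C.IsCauchy := by
  classical
  obtain ⟨f, hm, hi, hd⟩ := exists_irreducible ℓ (by omega)
  have : Fact (Irreducible f) := ⟨hi⟩
  have hfin : Module.finrank (ZMod 2) (AdjoinRoot f) = ℓ := by
    rw [(AdjoinRoot.powerBasis hm.ne_zero).finrank, AdjoinRoot.powerBasis_dim, hd]
  have : Module.Finite (ZMod 2) (AdjoinRoot f) := (AdjoinRoot.powerBasis hm.ne_zero).finite
  have : Finite (AdjoinRoot f) := Module.finite_of_finite (ZMod 2)
  let : Fintype (AdjoinRoot f) := Fintype.ofFinite _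
  have hcard : Fintype.card (AdjoinRoot f) = 2 ^ ℓ := by
    rw [Module.card_eq_pow_finrank (K := ZMod 2), hfin, ZMod.card]
  have hB : numBlocks (2 ^ ℓ) ℓ + c ≤ 2 ^ ℓ := by
    have h1 : numBlocks (2 ^ ℓ) ℓ ≤ 2 ^ ℓ / 2 + 1 := by
      unfold numBlocks
      rw [← Nat.lt_succ_iff, Nat.succ_eq_add_one, Nat.div_lt_iff_lt_mul (by omega)]
      have h3 : 2 ^ ℓ + 1 ≤ (2 ^ ℓ / 2 + 1) * 2 := by omega
      have h4 := Nat.mul_le_mul_left (2 ^ ℓ / 2 + 1) hℓ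
      have : (2 ^ ℓ / 2 + 1 + 1) * ℓ = (2 ^ ℓ / 2 + 1) * ℓ + ℓ := by ring
      omega
    omega
  obtain ⟨e⟩ : Nonempty (Fin (numBlocks (2 ^ ℓ) ℓ + c) ↪ AdjoinRoot f) :=
    Function.Embedding.nonempty_of_card_le (by rw [Fintype.card_fin, hcard]; exact hB)
  have hne : ∀ j r, e (Fin.castAdd c j) ≠ e (Fin.natAdd _ r) := fun j r h => by
    have := congrArg Fin.val (e.injective h)
    simp only [Fin.val_castAdd, Fin.val_natAdd] at this
    have := j.2
    omega
  refine ⟨⟨f, hm, hi, hd, Matrix.of fun j r => (e (Fin.castAdd c j) - e (Fin.natAdd _ r))⁻¹,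
    fun U hU => ?_⟩, fun j => e (Fin.castAdd c j), fun r => e (Fin.natAdd _ r), ?_, ?_, ?_⟩
  · exact @cauchy_mds _ _ (fun a b => Classical.propDecidable _) _ _
      (fun j => e (Fin.castAdd c j)) (fun r => e (Fin.natAdd _ r))
      (e.injective.comp (Fin.castAdd_injective _ _))
      (e.injective.comp (Fin.natAdd_injective _ _)) hne U hU
  · exact e.injective.comp (Fin.castAdd_injective _ _)
  · exact e.injective.comp (Fin.natAdd_injective _ _)
  · intro j r
    exact inv_mul_cancel₀ (sub_ne_zero.2 (hne j r))

namespace Code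

theorem length_encode {k ℓ c : ℕ} (C : Code k ℓ c) (z w : ℕ) (u : Fin k → Bool) :
    (C.encode z w u).length = k + c * ℓ * (z * w + 1) := by
  unfold encode
  rw [List.length_append, List.length_ofFn, List.length_flatMap]
  simp [length_parityBits]

end Code

end GC

namespace GC

/-! ## Deletions -/

/-- The number of positions before `p` that are not deleted. -/
def kept (D : Finset ℕ) (p : ℕ) : ℕ := Nat.count (· ∉ D) p

/-- The position of the `i`-th bit that is not deleted. -/
noncomputable def pos (D : Finset ℕ) (i : ℕ) : ℕ := Nat.nth (· ∉ D) i

variable (D : Finset ℕ)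

theorem kept_add_card (p : ℕ) : kept D p + (D.filter (· < p)).card = p := by
  have h1 : (D.filter (· < p)) = (Finset.range p).filter (· ∈ D) := by
    ext q; simp [and_comm]
  rw [kept, Nat.count_eq_card_filter_range, h1, add_comm,
    Finset.card_filter_add_card_filter_not, Finset.card_range]

theorem kept_mono : Monotone (kept D) := Nat.count_monotone _

theorem kept_succ (p : ℕ) : kept D (p + 1) = kept D p + if p ∉ D then 1 else 0 :=
  Nat.count_succ _ _

theorem infinite_compl : (Set.ofPred fun p : ℕ => p ∉ D).Infinite := by
  have := D.finite_toSet.infinite_compl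
  exact this

theorem pos_notMem (i : ℕ) : pos D i ∉ D := Nat.nth_mem_of_infinite (infinite_compl D) i

theorem kept_pos (i : ℕ) : kept D (pos D i) = i := Nat.count_nth_of_infinite (infinite_compl D) i

theorem pos_kept {p : ℕ} (h : p ∉ D) : pos D (kept D p) = p :=
  Nat.nth_count (p := fun p => p ∉ D) h

theorem pos_strictMono : StrictMono (pos D) := Nat.nth_strictMono (infinite_compl D)

theorem pos_eq (i : ℕ) : pos D i = i + (D.filter (· < pos D i)).card := by
  have := kept_add_card D (pos D i)
  rw [kept_pos] at this
  exact this.symm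

theorem le_pos (i : ℕ) : i ≤ pos D i := by
  have := pos_eq D i; omega

theorem pos_le (i : ℕ) : pos D i ≤ i + D.card := by
  have := pos_eq D i
  have := Finset.card_filter_le D (· < pos D i)
  omega

/-- The part of a string that is left, if its first entry has position `n`. -/
def deleteFrom (D : Finset ℕ) (n : ℕ) (x : List Bool) : List Bool :=
  ((x.zipIdx n).filter fun b => b.2 ∉ D).map Prod.fst

theorem deleteFrom_sublist (n : ℕ) (x : List Bool) : (deleteFrom D n x).Sublist x := by
  unfold deleteFrom
  have h := (List.filter_sublist (p := fun b : Bool × ℕ => decide (b.2 ∉ D))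
    (l := x.zipIdx n)).map Prod.fst
  rwa [List.zipIdx_map_fst] at h

theorem deleteAt_append (a b : List Bool) :
    deleteAt D (a ++ b) = deleteAt D a ++ deleteFrom D a.length b := by
  simp [deleteAt, deleteFrom, List.zipIdx_append]

theorem length_deleteAt (x : List Bool) : (deleteAt D x).length = kept D x.length := by
  induction x using List.reverseRecOn with
  | nil => rfl
  | append_singleton x b ih =>
    rw [deleteAt_append, List.length_append, ih, List.length_append, List.length_singleton,
      kept_succ]
    congr 1
    by_cases h : x.length ∈ D <;> simp [deleteFrom, h]

theorem getElem?_deleteAt_kept (x : List Bool) {p : ℕ} (hp : p < x.length) (hD : p ∉ D) :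
    (deleteAt D x)[kept D p]? = x[p]? := by
  have h1 : x = x.take p ++ x.drop p := (List.take_append_drop p x).symm
  have h2 : (x.take p).length = p := by rw [List.length_take]; omega
  conv_lhs => rw [h1, deleteAt_append]
  rw [List.getElem?_append_right (by rw [length_deleteAt, h2]), length_deleteAt, h2, Nat.sub_self]
  have h3 := List.drop_eq_getElem_cons hp
  generalize x.drop (p + 1) = t at h3
  rw [h3]
  simp [deleteFrom, hD, List.getElem?_eq_getElem hp]

theorem getElem?_deleteAt (x : List Bool) (i : ℕ) : (deleteAt D x)[i]? = x[pos D i]? := by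
  by_cases h : pos D i < x.length
  · have := getElem?_deleteAt_kept D x h (pos_notMem D i)
    rwa [kept_pos] at this
  · rw [List.getElem?_eq_none (not_lt.1 h), List.getElem?_eq_none]
    rw [length_deleteAt]
    have := kept_mono D (not_lt.1 h)
    rwa [kept_pos] at this

/-- Deleting commutes with cutting, if the cuts at `a` and `b` are made in the received string
behind the surviving bits that precede them. The received piece then arises from the original piece
by deletions. -/
theorem segment_sublist (x : List Bool) {a b : ℕ} (hab : a ≤ b) (hb : b ≤ x.length) :
    List.Sublist (((deleteAt D x).take (kept D b)).drop (kept D a)) ((x.take b).drop a) := by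
  have h1 : (deleteAt D x).take (kept D b) = deleteAt D (x.take b) := by
    conv_lhs => rw [← List.take_append_drop b x, deleteAt_append]
    rw [List.take_append_of_le_length, List.take_of_length_le] <;>
      rw [length_deleteAt, List.length_take, min_eq_left hb]
  have h2 : x.take b = x.take a ++ (x.take b).drop a := by
    conv_lhs => rw [← List.take_append_drop a (x.take b)]
    rw [List.take_take, min_eq_left hab]
  rw [h1]
  conv_lhs => rw [h2, deleteAt_append]
  rw [List.drop_append_of_le_length, List.drop_of_length_le, List.nil_append]
  · exact deleteFrom_sublist _ _ _
  · rw [length_deleteAt, List.length_take, min_eq_left (hab.trans hb)]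
  · rw [length_deleteAt, List.length_take, min_eq_left (hab.trans hb)]

variable {D}

theorem Localized.card_le {z w : ℕ} (h : Localized z w D) : D.card ≤ z * w := by
  obtain ⟨a, ha⟩ := h
  have : D ⊆ Finset.univ.biUnion fun j : Fin z => Finset.Ico (a j) (a j + w) := by
    intro p hp
    obtain ⟨j, h1, h2⟩ := ha p hp
    simp only [Finset.mem_biUnion, Finset.mem_univ, true_and, Finset.mem_Ico]
    exact ⟨j, h1, h2⟩
  refine (Finset.card_le_card this).trans ((Finset.card_biUnion_le).trans ?_)
  simp

/-! ### The transmitted message as the outcome of a possible case -/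

namespace Code

variable {k ℓ c : ℕ} (C : Code k ℓ c) {z w : ℕ}

theorem getElem?_encode_of_lt (u : Fin k → Bool) {p : ℕ} (hp : p < k) :
    (C.encode z w u)[p]? = some (u ⟨p, hp⟩) := by
  rw [encode, List.getElem?_append_left (by simpa using hp)]
  simp [hp]

theorem getD_encode (u : Fin k → Bool) {b r : ℕ} (hr : r ≤ z * w) :
    (C.encode z w u).getD (k + (b * (z * w + 1) + r)) false = (C.parityBits u).getD b false := by
  have h1 : (C.encode z w u).getD (k + (b * (z * w + 1) + r)) false =
      ((C.parityBits u).flatMap fun b => List.replicate (z * w + 1) b).getD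
        (b * (z * w + 1) + r) false := by
    rw [encode, List.getD_append_right _ _ _ _ (by simp)]
    simp
  rw [h1, List.flatMap, getD_flatten (Nat.succ_pos (z * w))]
  · have h2 : (b * (z * w + 1) + r) / (z * w + 1) = b := by
      rw [mul_comm, Nat.mul_add_div (Nat.succ_pos _), Nat.div_eq_of_lt (by omega), add_zero]
    have h3 : (b * (z * w + 1) + r) % (z * w + 1) = r := by
      rw [mul_comm, Nat.mul_add_mod, Nat.mod_eq_of_lt (by omega)]
    rw [h2, h3]
    by_cases hb : b < (C.parityBits u).length
    · rw [List.getD_eq_getElem _ [] (by simpa using hb),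
        List.getElem_map, List.getD_eq_getElem _ _ (by simp; omega), List.getD_eq_getElem _ _ hb]
      simp
    · rw [List.getD_eq_default _ [] (by simpa using hb),
        List.getD_eq_default _ _ (not_lt.1 hb)]
      simp
  · intro l hl
    obtain ⟨b, -, rfl⟩ := List.mem_map.1 hl
    simp

/-- The bit received at the first position of a group was sent at most `D.card ≤ z * w` places
later, which is still within the group of `z * w + 1` copies. -/
theorem recoveredParity_deleteAt (hD : Localized z w D) (u : Fin k → Bool) :
    recoveredParity k ℓ c z w (deleteAt D (C.encode z w u)) = C.parityBits u := by
  unfold recoveredParity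
  refine List.ext_getElem (by simp [length_parityBits]) fun b h1 h2 => ?_
  rw [List.getElem_ofFn, List.getD_eq_getElem?_getD, getElem?_deleteAt,
    ← List.getD_eq_getElem?_getD]
  simp only
  have h3 := le_pos D (k + b * (z * w + 1))
  have h4 := pos_le D (k + b * (z * w + 1))
  have h5 := hD.card_le
  obtain ⟨r, hr⟩ := Nat.exists_eq_add_of_le h3
  rw [hr, add_assoc, getD_encode C u (by omega), List.getD_eq_getElem _ _ h2]

/-- The transmitted message is the outcome of a possible case. -/
theorem possible_self (hz : 0 < z) (hD : Localized z w D) (hw : w ≤ ℓ) (hB : 2 ≤ numBlocks k ℓ)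
    (u : Fin k → Bool) : C.Possible z w (deleteAt D (C.encode z w u)) u := by
  have hℓ := C.length_pos
  set x := C.encode z w u with hx
  have hxl : x.length = k + c * ℓ * (z * w + 1) := C.length_encode z w u
  refine ⟨(C.recoveredParity_deleteAt hD u).symm, ?_⟩
  obtain ⟨a, ha⟩ := hD
  have : Nonempty (Fin z) := ⟨⟨0, hz⟩⟩
  -- Windows may overlap; `J` charges every deletion to exactly one of them, so that the numbers of
  -- deletions add up.
  choose! J hJ1 hJ2 using ha
  let E : Fin z → Finset ℕ := fun j => (D.filter (· < k)).filter fun p => J p = j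
  have hE : ∀ j p, p ∈ E j ↔ (p ∈ D ∧ p < k) ∧ J p = j := fun j p => by simp [E]
  have hstart : ∀ j, ∃ s, s + 1 < numBlocks k ℓ ∧ ∀ p ∈ E j, p / ℓ = s ∨ p / ℓ = s + 1 := by
    intro j
    by_cases hne : (E j).Nonempty
    · set m := (E j).min' hne
      have hm := (hE j m).1 ((E j).min'_mem hne)
      have hmB := lt_numBlocks hm.1.2 hℓ
      -- By `w ≤ ℓ` the window reaches at most one block beyond the block of its first deletion. The
      -- minimum matters if that block is the last one, which must then be the second block of the
      -- pair.
      refine ⟨min (m / ℓ) (numBlocks k ℓ - 2), by omega, fun p hp => ?_⟩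
      have hmp : m ≤ p := (E j).min'_le p hp
      have hp' := (hE j p).1 hp
      have h1 : m / ℓ ≤ p / ℓ := Nat.div_le_div_right hmp
      have h2 : p / ℓ ≤ (m + ℓ) / ℓ := Nat.div_le_div_right (by
        have h3 := hJ1 m hm.1.1
        have h4 := hJ2 p hp'.1.1
        rw [hm.2] at h3
        rw [hp'.2] at h4
        omega)
      rw [Nat.add_div_right _ hℓ] at h2
      have := lt_numBlocks hp'.1.2 hℓ
      omega
    · refine ⟨0, by omega, fun p hp => absurd ⟨p, hp⟩ hne⟩
  choose s hsB hs using hstart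
  let g : Guess z := ⟨s, fun j => (E j).card⟩
  have hcard : ∀ P : ℕ → Prop, [DecidablePred P] → ∑ j, ((E j).filter P).card
      = ((D.filter (· < k)).filter P).card := by
    intro P _
    rw [Finset.card_eq_sum_card_fiberwise (f := J) (t := Finset.univ) (fun _ _ => by simp)]
    refine Finset.sum_congr rfl fun j _ => ?_
    congr 1
    ext p
    simp only [E, Finset.mem_filter]
    tauto
  -- If `b` is not the second block of a window, each window has either all or none of its deletions
  -- before block `b`. Hence the assumed shift is the true number of deletions there.
  have hshift : ∀ b, (∀ j, s j + 1 ≠ b) →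
      kept D (min (b * ℓ) k) + g.shift b = min (b * ℓ) k := by
    intro b hb
    have h1 : g.shift b = ∑ j, ((E j).filter (· < b * ℓ)).card := by
      refine Finset.sum_congr rfl fun j _ => ?_
      change (if s j < b then (E j).card else 0) = _
      have hbj := hb j
      split
      · rw [Finset.filter_true_of_mem]
        intro p hp
        rw [← Nat.div_lt_iff_lt_mul hℓ]
        rcases hs j p hp with h | h <;> omega
      · rw [Finset.filter_false_of_mem, Finset.card_empty]
        intro p hp
        rw [← Nat.div_lt_iff_lt_mul hℓ]
        rcases hs j p hp with h | h <;> omega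
    rw [h1, hcard, Finset.filter_filter]
    have h2 := kept_add_card D (min (b * ℓ) k)
    have h3 : (D.filter fun p => p < k ∧ p < b * ℓ) = D.filter (· < min (b * ℓ) k) := by
      ext p; simp only [Finset.mem_filter, lt_min_iff]; tauto
    rw [h3]
    exact h2
  have hErased : ∀ p ∈ D, p < k → g.Erased (p / ℓ) := fun p hp hpk =>
    ⟨J p, hs (J p) p ((hE _ p).2 ⟨⟨hp, hpk⟩, rfl⟩)⟩
  refine ⟨g, ⟨fun j => ⟨hsB j, ?_⟩, ?_⟩, ?_, ?_⟩
  · have : E j ⊆ Finset.Ico (a j) (a j + w) := by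
      intro p hp
      have hp' := (hE j p).1 hp
      rw [Finset.mem_Ico, ← hp'.2]
      exact ⟨hJ1 p hp'.1.1, hJ2 p hp'.1.1⟩
    simpa using Finset.card_le_card this
  · have h1 := hcard (fun _ => True)
    simp only [Finset.filter_true] at h1
    change ∑ j, (E j).card ≤ _
    rw [h1, length_deleteAt, hxl]
    have h2 := kept_add_card D k
    have h3 := kept_add_card D (k + c * ℓ * (z * w + 1))
    have h4 : (D.filter (· < k)).card ≤ (D.filter (· < k + c * ℓ * (z * w + 1))).card :=
      Finset.card_le_card fun p hp => by
        simp only [Finset.mem_filter] at hp ⊢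
        exact ⟨hp.1, by omega⟩
    have h5 : c * (z * w + 1) * ℓ = c * ℓ * (z * w + 1) := by ring
    omega
  · intro p hp
    have hnot : ∀ j, s j + 1 ≠ (p : ℕ) / ℓ := fun j h => hp ⟨j, Or.inr h.symm⟩
    have h1 := hshift _ hnot
    have hpl : (p : ℕ) / ℓ * ℓ ≤ p := Nat.div_mul_le_self _ _
    rw [min_eq_left (hpl.trans p.2.le)] at h1
    -- A block that is not erased contains no deletion, so the count at `p` equals the count at the
    -- beginning of its block.
    have h2 : (D.filter (· < (p : ℕ))) = D.filter (· < (p : ℕ) / ℓ * ℓ) := by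
      ext q
      simp only [Finset.mem_filter, and_congr_right_iff]
      intro hq
      refine ⟨fun h => ?_, fun h => by omega⟩
      by_contra hlt
      apply hp
      have h3 : q / ℓ = p / ℓ := le_antisymm (Nat.div_le_div_right h.le)
        ((Nat.le_div_iff_mul_le hℓ).2 (not_lt.1 hlt))
      rw [← h3]
      exact hErased q hq (h.trans p.2)
    have h3 := kept_add_card D p
    have h4 := kept_add_card D ((p : ℕ) / ℓ * ℓ)
    rw [h2] at h3
    have h5 : (p : ℕ) - g.shift (p / ℓ) = kept D p := by omega
    have h6 : (p : ℕ) ∉ D := fun h => hp (hErased p h p.2)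
    rw [h5, getElem?_deleteAt_kept D x (by rw [hxl]; have := p.2; omega) h6, hx,
      getElem?_encode_of_lt C u p.2]
  · intro a' b' ⟨hab, her, ha', hb'⟩
    have hb1 := hshift b' fun j h => hb' ⟨j, Or.inr h.symm⟩
    have ha1 := hshift a' fun j h => by
      rcases ha' with ha' | ha'
      · omega
      · exact ha' ⟨j, Or.inl (by change a' - 1 = s j; omega)⟩
    have haB : a' < numBlocks k ℓ := by
      obtain ⟨j, hj⟩ := her a' le_rfl hab
      have h1 : g.start j = s j := rfl
      have := hsB j
      rw [h1] at hj
      omega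
    have hak : a' * ℓ ≤ k := by
      unfold numBlocks at haB
      have h1 := (Nat.le_div_iff_mul_le hℓ).1 (Nat.succ_le_of_lt haB)
      rw [Nat.succ_mul] at h1
      omega
    rw [min_eq_left hak] at ha1
    rw [show min (b' * ℓ) k - g.shift b' = kept D (min (b' * ℓ) k) by omega,
      show a' * ℓ - g.shift a' = kept D (a' * ℓ) by omega]
    have h1 := segment_sublist D x (a := a' * ℓ) (b := min (b' * ℓ) k)
      (le_min (Nat.mul_le_mul_right _ hab.le) hak)
      (by rw [hxl]; exact (min_le_right _ _).trans (Nat.le_add_right _ _))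
    have h2 : x.take (min (b' * ℓ) k) = (List.ofFn u).take (b' * ℓ) := by
      rw [hx, encode, List.take_append_of_le_length (by simp)]
      rcases le_total (b' * ℓ) k with h | h
      · rw [min_eq_left h]
      · rw [min_eq_right h, List.take_of_length_le (by simp), List.take_of_length_le (by simpa)]
    rwa [h2] at h1

end Code

end GC

/-! ### The displacement of positions by a guess -/

namespace GC

namespace Code

namespace Guess

variable {z w ℓ : ℕ} (g : Guess z) (D : Finset ℕ)

/-- The index in the received string of the bit assigned to a position off the erasures. -/
def idx (ℓ p : ℕ) : ℕ := p - g.shift (p / ℓ)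

/-- The position in the codeword of the bit assigned to a position off the erasures. -/
noncomputable def source (ℓ p : ℕ) : ℕ := pos D (g.idx ℓ p)

variable {g D}

theorem shift_le (hdel : ∀ j, g.del j ≤ w) (b : ℕ) : g.shift b ≤ z * w := by
  unfold shift
  refine (Finset.sum_le_card_nsmul _ _ w fun j _ => ?_).trans (by simp)
  split
  · exact hdel j
  · exact Nat.zero_le _

theorem exists_start_of_shift_ne {a b : ℕ} (hab : a ≤ b) (h : g.shift a ≠ g.shift b) :
    ∃ j, a ≤ g.start j ∧ g.start j < b := by
  by_contra hne
  push Not at hne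
  apply h
  refine Finset.sum_congr rfl fun j _ => ?_
  have := hne j
  congr 1
  exact propext ⟨fun h => by omega, fun h => by by_contra h'; have := this (by omega); omega⟩

/-- The shift changes only at the first block of a window. If this lies between `a` and `b`, both
blocks of the window are erased and so lie strictly between them. -/
theorem shift_eq_or {a b : ℕ} (hab : a ≤ b) (ha : ¬ g.Erased a) (hb : ¬ g.Erased b) :
    g.shift a = g.shift b ∨ a + 3 ≤ b := by
  by_contra h
  push Not at h
  obtain ⟨j, h1, h2⟩ := exists_start_of_shift_ne hab h.1
  have h3 : a ≠ g.start j := fun h => ha ⟨j, Or.inl h⟩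
  have h4 : b ≠ g.start j + 1 := fun h => hb ⟨j, Or.inr h⟩
  omega

/-- A nonzero shift comes from a window that starts in an earlier block, so `p ≥ ℓ ≥ z * w`. This
makes the subtraction of natural numbers in `idx` exact. -/
theorem shift_le_pos (hℓ : 0 < ℓ) (hzw : z * w ≤ ℓ) (hdel : ∀ j, g.del j ≤ w) {p : ℕ}
    (_ : ¬ g.Erased (p / ℓ)) : g.shift (p / ℓ) ≤ p := by
  have h1 := shift_le hdel (p / ℓ)
  rcases Nat.eq_zero_or_pos (g.shift (p / ℓ)) with h | h
  · omega
  · have h0 : g.shift 0 = 0 := by simp [shift]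
    obtain ⟨j, -, h3⟩ := exists_start_of_shift_ne (g := g) (Nat.zero_le (p / ℓ)) (by omega)
    have h4 : 1 ≤ p / ℓ := by omega
    have h5 := (Nat.le_div_iff_mul_le hℓ).1 h4
    omega

/-- Where the shift is the same there is nothing to show. Where it differs, `q` is more than `2 * ℓ`
ahead of `p`, which outweighs a shift of at most `z * w ≤ ℓ`. -/
theorem idx_lt (hℓ : 0 < ℓ) (hzw : z * w ≤ ℓ) (hdel : ∀ j, g.del j ≤ w) {p q : ℕ} (hpq : p < q)
    (hp : ¬ g.Erased (p / ℓ)) (hq : ¬ g.Erased (q / ℓ)) : g.idx ℓ p < g.idx ℓ q := by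
  unfold idx
  have h1 := shift_le_pos hℓ hzw hdel hp
  have h2 := shift_le_pos hℓ hzw hdel hq
  have h3 := shift_le hdel (q / ℓ)
  rcases shift_eq_or (Nat.div_le_div_right hpq.le) hp hq with h | h
  · omega
  · have h4 := Nat.div_mul_le_self q ℓ
    have h5 := Nat.lt_div_mul_add hℓ (a := p)
    have h6 := Nat.mul_le_mul_right ℓ h
    rw [add_mul] at h6
    omega

theorem source_lt (hℓ : 0 < ℓ) (hzw : z * w ≤ ℓ) (hdel : ∀ j, g.del j ≤ w) {p q : ℕ}
    (hpq : p < q) (hp : ¬ g.Erased (p / ℓ)) (hq : ¬ g.Erased (q / ℓ)) :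
    g.source D ℓ p < g.source D ℓ q :=
  pos_strictMono D (idx_lt hℓ hzw hdel hpq hp hq)

theorem source_notMem (p : ℕ) : g.source D ℓ p ∉ D := pos_notMem D _

theorem source_eq_iff (hℓ : 0 < ℓ) (hzw : z * w ≤ ℓ) (hdel : ∀ j, g.del j ≤ w) {p : ℕ}
    (hp : ¬ g.Erased (p / ℓ)) :
    g.source D ℓ p = p ↔ p ∉ D ∧ g.shift (p / ℓ) = (D.filter (· < p)).card := by
  have h1 := kept_add_card D p
  have h2 := shift_le_pos hℓ hzw hdel hp
  constructor
  · intro h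
    refine ⟨h ▸ source_notMem p, ?_⟩
    have h3 : kept D (g.source D ℓ p) = g.idx ℓ p := kept_pos D _
    rw [h] at h3
    unfold idx at h3
    omega
  · rintro ⟨h3, h4⟩
    have h5 : g.idx ℓ p = kept D p := by unfold idx; omega
    rw [source, h5, pos_kept D h3]

/-- For sandwiching: if the two ends of an interval without erasures are fixed by `source`, this
inequality on both sides fixes everything in between. -/
theorem source_add_le (hℓ : 0 < ℓ) (hzw : z * w ≤ ℓ) (hdel : ∀ j, g.del j ≤ w) {p q : ℕ}
    (hpq : p ≤ q) (h : ∀ t, p ≤ t → t ≤ q → ¬ g.Erased (t / ℓ)) :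
    g.source D ℓ p + (q - p) ≤ g.source D ℓ q := by
  induction q, hpq using Nat.le_induction with
  | base => simp
  | succ q hpq ih =>
    have h1 := ih fun t h1 h2 => h t h1 (by omega)
    have h2 := source_lt (D := D) hℓ hzw hdel (Nat.lt_succ_self q) (h q hpq (by omega))
      (h (q + 1) (by omega) le_rfl)
    rw [Nat.succ_eq_add_one] at h2
    omega

/-- A block with fixed and with other positions contains a deletion. -/
theorem exists_mem_of_source_ne (hℓ : 0 < ℓ) (hzw : z * w ≤ ℓ) (hdel : ∀ j, g.del j ≤ w)
    {p q : ℕ} (hpq : p / ℓ = q / ℓ) (hp : ¬ g.Erased (p / ℓ)) (h1 : g.source D ℓ p = p)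
    (h2 : g.source D ℓ q ≠ q) : ∃ r ∈ D, r / ℓ = p / ℓ := by
  -- Within a block that is not erased the shift is constant. Without a deletion in the block the
  -- number of earlier deletions is constant too, so by `source_eq_iff` either all its positions are
  -- fixed or none.
  by_contra hne
  push Not at hne
  apply h2
  rw [source_eq_iff hℓ hzw hdel hp] at h1
  rw [source_eq_iff hℓ hzw hdel (hpq ▸ hp), ← hpq, h1.2]
  refine ⟨fun h => hne q h hpq.symm, congrArg Finset.card ?_⟩
  ext r
  simp only [Finset.mem_filter, and_congr_right_iff]
  intro hr
  have h3 := hne r hr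
  constructor
  · intro h
    by_contra h4
    have h5 := Nat.div_le_div_right (c := ℓ) h.le
    have h6 := Nat.div_le_div_right (c := ℓ) (not_lt.1 h4)
    omega
  · intro h
    by_contra h4
    have h5 := Nat.div_le_div_right (c := ℓ) h.le
    have h6 := Nat.div_le_div_right (c := ℓ) (not_lt.1 h4)
    omega

open Classical in
/-- Few positions are fixed in blocks which contain other positions as well. -/
theorem card_fixed_le (hℓ : 0 < ℓ) (hzw : z * w ≤ ℓ) (hw : w ≤ ℓ) (hdel : ∀ j, g.del j ≤ w)
    (hz : 0 < z) (hD : Localized z w D) (Z : Finset ℕ)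
    (hZ : ∀ p ∈ Z, ¬ g.Erased (p / ℓ) ∧ g.source D ℓ p = p ∧
      ∃ q, q / ℓ = p / ℓ ∧ g.source D ℓ q ≠ q) : Z.card ≤ z * ℓ := by
  have hne : Nonempty (Fin z) := ⟨⟨0, hz⟩⟩
  obtain ⟨a, ha⟩ := hD
  choose! J hJ1 hJ2 using ha
  -- Every block that meets `Z` gets a deletion `r b` of its own, and its positions in `Z` are
  -- charged to the window of that deletion.
  have hr : ∀ b, (∃ p ∈ Z, p / ℓ = b) → ∃ r ∈ D, r / ℓ = b := by
    rintro b ⟨p, hp, rfl⟩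
    obtain ⟨h1, h2, q, h3, h4⟩ := hZ p hp
    exact exists_mem_of_source_ne hℓ hzw hdel h3.symm h1 h2 h4
  choose! r hrD hrb using hr
  have hrD' : ∀ p ∈ Z, r (p / ℓ) ∈ D := fun p hp => hrD _ ⟨p, hp, rfl⟩
  have hrb' : ∀ p ∈ Z, r (p / ℓ) / ℓ = p / ℓ := fun p hp => hrb _ ⟨p, hp, rfl⟩
  have key : ∀ p ∈ Z, ∀ q ∈ Z, J (r (p / ℓ)) = J (r (q / ℓ)) → p < q → q < p + ℓ := by
    intro p hp q hq hj hpq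
    have hb := Nat.div_le_div_right (c := ℓ) hpq.le
    rcases Nat.eq_or_lt_of_le hb with hb | hb
    · have h1 := Nat.div_mul_le_self p ℓ
      have h2 := Nat.lt_div_mul_add hℓ (a := q)
      rw [← hb] at h2
      omega
    · have h1 := hJ2 _ (hrD' q hq)
      have h2 := hJ1 _ (hrD' p hp)
      rw [hj] at h2
      have h3 : r (q / ℓ) < r (p / ℓ) + ℓ := by omega
      have h4 : q / ℓ ≤ p / ℓ + 1 := by
        have := Nat.div_le_div_right (c := ℓ) h3.le
        rwa [Nat.add_div_right _ hℓ, hrb' p hp, hrb' q hq] at this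
      have hmid : ∀ t, p ≤ t → t ≤ q → ¬ g.Erased (t / ℓ) := by
        intro t h5 h6
        have h7 := Nat.div_le_div_right (c := ℓ) h5
        have h8 := Nat.div_le_div_right (c := ℓ) h6
        rcases Nat.eq_or_lt_of_le h7 with h | h
        · rw [← h]; exact (hZ p hp).1
        · rw [show t / ℓ = q / ℓ by omega]; exact (hZ q hq).1
      -- As `source` fixes `p` and `q` and increases by at least one per place, it fixes all of the
      -- interval; fixed positions are not deleted.
      have hfix : ∀ t, p ≤ t → t ≤ q → t ∉ D := by
        intro t h5 h6
        have h7 := source_add_le (D := D) hℓ hzw hdel h5 fun s h h' => hmid s h (by omega)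
        have h8 := source_add_le (D := D) hℓ hzw hdel h6 fun s h h' => hmid s (by omega) h'
        rw [(hZ p hp).2.1] at h7
        rw [(hZ q hq).2.1] at h8
        have h9 : g.source D ℓ t = t := by omega
        rw [← h9]
        exact source_notMem t
      have h5 : r (p / ℓ) < q := by
        by_contra h
        have := Nat.div_le_div_right (c := ℓ) (not_lt.1 h)
        rw [hrb' p hp] at this
        omega
      have h6 : p < r (q / ℓ) := by
        by_contra h
        have := Nat.div_le_div_right (c := ℓ) (not_lt.1 h)
        rw [hrb' q hq] at this
        omega
      -- No deletion lies between `p` and `q`, so the one in the block of `p` is to the left of `p`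
      -- and the one in the block of `q` to the right of `q`. Both are in the same window, hence `q
      -- - p < w ≤ ℓ`.
      have h7 : r (p / ℓ) < p := by
        by_contra h
        exact hfix _ (not_lt.1 h) h5.le (hrD' p hp)
      have h8 : q < r (q / ℓ) := by
        by_contra h
        exact hfix _ h6.le (not_lt.1 h) (hrD' q hq)
      omega
  rw [Finset.card_eq_sum_card_fiberwise (f := fun p => J (r (p / ℓ))) (t := Finset.univ)
    (fun _ _ => by simp)]
  refine (Finset.sum_le_card_nsmul _ _ ℓ fun j _ => ?_).trans (by simp)
  set Y := Z.filter fun p => J (r (p / ℓ)) = j with hY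
  by_cases hne : Y.Nonempty
  · have hm := Finset.mem_filter.1 (Y.min'_mem hne)
    have : Y ⊆ Finset.Ico (Y.min' hne) (Y.min' hne + ℓ) := by
      intro q hq
      have hq' := Finset.mem_filter.1 hq
      have hle := Y.min'_le q hq
      rw [Finset.mem_Ico]
      refine ⟨hle, ?_⟩
      rcases Nat.eq_or_lt_of_le hle with h | h
      · omega
      · exact key _ hm.1 q hq'.1 (hm.2.trans hq'.2.symm) h
    simpa using Finset.card_le_card this
  · rw [Finset.not_nonempty_iff_eq_empty] at hne
    rw [hne]
    exact Nat.zero_le _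

end Guess

end Code

end GC

/-! ### Counting the messages that a guess mistakes -/

namespace GC

namespace Code

variable {k ℓ c : ℕ} (C : Code k ℓ c) {z w : ℕ}

/-- The bit of the codeword at a position not far behind the end of the message, in terms of the
message and of the first parity bit. -/
def extendBy (β : Bool) (u : Fin k → Bool) (q : ℕ) : Bool := if h : q < k then u ⟨q, h⟩ else β

theorem extendBy_of_lt {β : Bool} {u : Fin k → Bool} {q : ℕ} (h : q < k) :
    extendBy β u q = u ⟨q, h⟩ := dif_pos h

theorem extendBy_of_le {β : Bool} {u : Fin k → Bool} {q : ℕ} (h : k ≤ q) :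
    extendBy β u q = β := dif_neg (not_lt.2 h)

/-- The first parity bit. -/
noncomputable def firstParity (u : Fin k → Bool) : Bool := (C.parityBits u).getD 0 false

/-- The source of a position before `k` lies less than `k + z * w`. If it is beyond the message, it
is in the first group of repetitions, so that it holds the first parity bit. -/
theorem AgreesOffErasures.eq_extendBy {D : Finset ℕ} (hD : Localized z w D) {g : Guess z}
    {u v : Fin k → Bool} (h : AgreesOffErasures ℓ (deleteAt D (C.encode z w u)) g v) {p : Fin k}
    (hp : ¬ g.Erased (p / ℓ)) :
    v p = extendBy (C.firstParity u) u (g.source D ℓ p) := by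
  have h1 := h p hp
  rw [getElem?_deleteAt] at h1
  change (C.encode z w u)[g.source D ℓ p]? = _ at h1
  by_cases hk : g.source D ℓ p < k
  · rw [C.getElem?_encode_of_lt u hk] at h1
    rw [extendBy_of_lt hk]
    exact (Option.some.inj h1).symm
  · rw [extendBy_of_le (not_lt.1 hk), firstParity]
    have h2 : g.source D ℓ p ≤ p - g.shift (p / ℓ) + D.card := pos_le D _
    have h3 := hD.card_le
    have h4 := p.2
    rw [← C.getD_encode (z := z) (w := w) u (b := 0) (r := g.source D ℓ p - k) (by omega), zero_mul,
      zero_add, Nat.add_sub_cancel' (not_lt.1 hk), List.getD_eq_getElem?_getD, h1]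
    rfl

theorem vecMul_eq_of_parityBits_eq {u v : Fin k → Bool} (h : C.parityBits u = C.parityBits v) :
    C.symbols u ᵥ* C.gen = C.symbols v ᵥ* C.gen := by
  apply C.symbolBits_injective
  rw [← vec_symbolBits, ← vec_symbolBits, ← parityBits_eq, ← parityBits_eq, h]

theorem symbols_xor (u v : Fin k → Bool) :
    C.symbols (fun p => (u p).xor (v p)) = C.symbols u + C.symbols v := by
  funext j
  rw [Pi.add_apply, symbols, symbols, symbols, ← Finset.sum_add_distrib]
  refine Finset.sum_congr rfl fun i _ => ?_
  by_cases h : j * ℓ + i < k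
  · generalize AdjoinRoot.root C.modulus ^ (ℓ - 1 - i : ℕ) = t
    have ht : t + t = 0 := by
      rw [← two_smul (ZMod 2), show (2 : ZMod 2) = 0 from rfl, zero_smul]
    simp only [h, exists_true_left]
    cases u ⟨_, h⟩ <;> cases v ⟨_, h⟩ <;> simp [ht]
  · simp [h]

theorem parityBits_xor {u v : Fin k → Bool} (h : C.parityBits u = C.parityBits v) :
    C.parityBits (fun p => (u p).xor (v p)) = C.symbolBits 0 := by
  rw [parityBits_eq, symbols_xor, Matrix.add_vecMul, C.vecMul_eq_of_parityBits_eq h]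
  congr 1
  funext r
  rw [Pi.add_apply, ← two_smul (ZMod 2), show (2 : ZMod 2) = 0 from rfl, zero_smul]
  rfl

/-- The erased blocks. -/
def Guess.erasures (g : Guess z) : Finset ℕ :=
  Finset.univ.image g.start ∪ Finset.univ.image fun j => g.start j + 1

theorem Guess.mem_erasures {g : Guess z} {b : ℕ} : b ∈ g.erasures ↔ g.Erased b := by
  simp only [erasures, Finset.mem_union, Finset.mem_image, Finset.mem_univ, true_and, Erased]
  constructor
  · rintro (⟨j, rfl⟩ | ⟨j, rfl⟩)
    · exact ⟨j, Or.inl rfl⟩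
    · exact ⟨j, Or.inr rfl⟩
  · rintro ⟨j, rfl | rfl⟩
    · exact Or.inl ⟨j, rfl⟩
    · exact Or.inr ⟨j, rfl⟩

theorem Guess.card_erasures_le (g : Guess z) : g.erasures.card ≤ 2 * z := by
  refine (Finset.card_union_le _ _).trans ?_
  have h1 : (Finset.univ.image g.start).card ≤ z := Finset.card_image_le.trans (by simp)
  have h2 : (Finset.univ.image fun j => g.start j + 1).card ≤ z :=
    Finset.card_image_le.trans (by simp)
  omega

/-- With a given guess another message than the transmitted one has the right parities. -/
def Mistaken (w : ℕ) (D : Finset ℕ) (g : Guess z) (u v : Fin k → Bool) : Prop :=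
  v ≠ u ∧ C.parityBits v = C.parityBits u ∧
    AgreesOffErasures ℓ (deleteAt D (C.encode z w u)) g v

open Classical in
/-- The positions off the erasures which are assigned bits from other positions. -/
noncomputable def Guess.moved (k ℓ : ℕ) (D : Finset ℕ) (g : Guess z) : Finset (Fin k) :=
  Finset.univ.filter fun p => ¬ g.Erased (p / ℓ) ∧ g.source D ℓ p ≠ p

theorem Guess.mem_moved {D : Finset ℕ} {g : Guess z} {p : Fin k} :
    p ∈ g.moved k ℓ D ↔ ¬ g.Erased (p / ℓ) ∧ g.source D ℓ p ≠ p := by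
  simp [moved]

/-- Messages are equal if they agree off the moved positions and if the differences to the
decoded messages are equal. -/
theorem eq_of_xor_eq (hzw : z * w ≤ ℓ) {D : Finset ℕ} (hD : Localized z w D) {g : Guess z}
    (hdel : ∀ j, g.del j ≤ w) {u₁ u₂ v₁ v₂ : Fin k → Bool}
    (h₁ : AgreesOffErasures ℓ (deleteAt D (C.encode z w u₁)) g v₁)
    (h₂ : AgreesOffErasures ℓ (deleteAt D (C.encode z w u₂)) g v₂)
    (hβ : C.firstParity u₁ = C.firstParity u₂)
    (hu : ∀ p ∉ g.moved k ℓ D, u₁ p = u₂ p)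
    (hd : ∀ p, (u₁ p).xor (v₁ p) = (u₂ p).xor (v₂ p)) : u₁ = u₂ := by
  have hℓ := C.length_pos
  -- At a moved position `v` repeats a bit of `u` at the source, and `u` differs from `v` by the
  -- known difference. So `u` at the source determines `u` at `p`.
  have step : ∀ p ∈ g.moved k ℓ D,
      (∀ h : g.source D ℓ p < k, u₁ ⟨_, h⟩ = u₂ ⟨_, h⟩) → u₁ p = u₂ p := by
    intro p hp hq
    have hp' := Guess.mem_moved.1 hp
    have h3 := AgreesOffErasures.eq_extendBy C hD h₁ hp'.1
    have h4 := AgreesOffErasures.eq_extendBy C hD h₂ hp'.1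
    have h5 : v₁ p = v₂ p := by
      rw [h3, h4]
      by_cases h : g.source D ℓ p < k
      · rw [extendBy_of_lt h, extendBy_of_lt h, hq h]
      · rw [extendBy_of_le (not_lt.1 h), extendBy_of_le (not_lt.1 h), hβ]
    have h6 := hd p
    rw [h5] at h6
    exact Bool.xor_left_inj.1 h6
  -- Since `source` is increasing, the source of a position moved upwards is again moved upwards or
  -- not moved at all (possibly erased). The chain climbs until it leaves the moved positions or the
  -- message, which justifies the induction on `k - p`; `down` is the mirror image.
  have up : ∀ n, ∀ p : Fin k, k - p ≤ n → p ∈ g.moved k ℓ D → (p : ℕ) < g.source D ℓ p →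
      u₁ p = u₂ p := by
    intro n
    induction n with
    | zero => intro p hn; have := p.2; omega
    | succ n ih =>
      intro p hn hp hlt
      refine step p hp fun h => ?_
      by_cases hq : (⟨_, h⟩ : Fin k) ∈ g.moved k ℓ D
      · exact ih _ (by simp only; omega) hq (Guess.source_lt hℓ hzw hdel hlt
          (Guess.mem_moved.1 hp).1 (Guess.mem_moved.1 hq).1)
      · exact hu _ hq
  have down : ∀ n, ∀ p : Fin k, (p : ℕ) < n → p ∈ g.moved k ℓ D → g.source D ℓ p < p →
      u₁ p = u₂ p := by
    intro n
    induction n with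
    | zero => intro p hn; omega
    | succ n ih =>
      intro p hn hp hlt
      refine step p hp fun h => ?_
      by_cases hq : (⟨_, h⟩ : Fin k) ∈ g.moved k ℓ D
      · exact ih _ (by simp only; omega) hq (Guess.source_lt hℓ hzw hdel hlt
          (Guess.mem_moved.1 hq).1 (Guess.mem_moved.1 hp).1)
      · exact hu _ hq
  funext p
  by_cases hp : p ∈ g.moved k ℓ D
  · rcases lt_or_gt_of_ne (Guess.mem_moved.1 hp).2 with h | h
    · exact down _ p (Nat.lt_succ_self _) hp h
    · exact up _ p le_rfl hp h
  · exact hu p hp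

theorem Mistaken.eq_of_notMem {D : Finset ℕ} (hD : Localized z w D) {g : Guess z}
    {u v : Fin k → Bool} (h : AgreesOffErasures ℓ (deleteAt D (C.encode z w u)) g v) {p : Fin k}
    (hp : ¬ g.Erased (p / ℓ)) (hm : p ∉ g.moved k ℓ D) : v p = u p := by
  have h1 : g.source D ℓ p = p := by
    by_contra h
    exact hm (Guess.mem_moved.2 ⟨hp, h⟩)
  have h2 := AgreesOffErasures.eq_extendBy C hD h hp
  rw [h1, extendBy_of_lt p.2] at h2
  exact h2

theorem succ_mul_le_of_lt {b : ℕ} (hb : b + 1 < numBlocks k ℓ) : (b + 1) * ℓ ≤ k := by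
  unfold numBlocks at hb
  have hℓ : 0 < ℓ := by
    by_contra h
    simp [Nat.eq_zero_of_not_pos h] at hb
  have h1 := (Nat.le_div_iff_mul_le hℓ).1 (Nat.succ_le_of_lt hb)
  rw [Nat.succ_mul] at h1
  omega

/-- Only the last block can be incomplete, and `hT` excludes it. -/
theorem card_positions {T : Finset ℕ} (hℓ : 0 < ℓ) (hT : ∀ b ∈ T, b + 1 < numBlocks k ℓ) :
    (Finset.univ.filter fun p : Fin k => (p : ℕ) / ℓ ∈ T).card = T.card * ℓ := by
  rw [Finset.card_eq_sum_card_fiberwise (f := fun p : Fin k => (p : ℕ) / ℓ) (t := T)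
    (fun p hp => by simpa using hp)]
  rw [Finset.sum_const_nat]
  intro b hb
  have h1 := succ_mul_le_of_lt (hT b hb)
  rw [add_mul, one_mul] at h1
  have h2 : ((Finset.univ.filter fun p : Fin k => (p : ℕ) / ℓ ∈ T).filter
      fun p : Fin k => (p : ℕ) / ℓ = b).map Fin.valEmbedding = Finset.Ico (b * ℓ) (b * ℓ + ℓ) := by
    ext q
    simp only [Finset.mem_map, Finset.mem_filter, Finset.mem_univ, true_and, Finset.mem_Ico,
      Fin.valEmbedding_apply]
    constructor
    · rintro ⟨p, ⟨-, rfl⟩, rfl⟩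
      exact ⟨Nat.div_mul_le_self _ _, Nat.lt_div_mul_add hℓ⟩
    · rintro ⟨h3, h4⟩
      have h5 : q / ℓ = b := Nat.div_eq_of_lt_le h3 (by rwa [add_mul, one_mul])
      exact ⟨⟨q, by omega⟩, ⟨by simpa [h5] using hb, h5⟩, rfl⟩
  rw [← Finset.card_map Fin.valEmbedding, h2]
  simp

open Classical in
/-- The number of messages for which a given guess is mistaken. -/
theorem card_mistaken_le (hz : 0 < z) (hzw : z * w ≤ ℓ) (hw : w ≤ ℓ) (hc : 2 * z ≤ c)
    {D : Finset ℕ} (hD : Localized z w D) {g : Guess z} (hdel : ∀ j, g.del j ≤ w) :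
    (Finset.univ.filter fun u : Fin k → Bool => ∃ v, C.Mistaken w D g u v).card
      * 2 ^ ((c - 2 * z) * ℓ) ≤ 2 * 2 ^ k * 2 ^ (z * ℓ) := by
  have hℓ := C.length_pos
  set M := g.moved k ℓ D with hM
  set N := M.image fun p : Fin k => (p : ℕ) / ℓ with hN
  -- If the moved positions meet at most `c - 2 * z` blocks, these and the at most `2 * z` erased
  -- ones are too few for two messages with the same parities to differ, and no message is mistaken.
  by_cases hcard : N.card ≤ c - 2 * z
  · rw [Finset.card_eq_zero.2, zero_mul]
    · exact Nat.zero_le _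
    · rw [Finset.filter_eq_empty_iff]
      rintro u - ⟨v, hne, hpar, hag⟩
      refine hne (C.eq_of_parityBits_eq hpar (N ∪ g.erasures) ?_ ?_)
      · have := Finset.card_union_le N g.erasures
        have := g.card_erasures_le
        omega
      · intro p hp
        rw [Finset.mem_union, not_or, Guess.mem_erasures] at hp
        exact Mistaken.eq_of_notMem C hD hag hp.2 fun h =>
          hp.1 (Finset.mem_image_of_mem _ h)
  -- There are at least `c - 2 * z + 1` blocks with moved positions. One is spared so that the last
  -- block, which may be incomplete, can be avoided.
  · obtain ⟨T, hTN, hT⟩ := Finset.exists_subset_card_eq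
      (s := N.erase (numBlocks k ℓ - 1)) (n := c - 2 * z) (by
        have := Finset.pred_card_le_card_erase (s := N) (a := numBlocks k ℓ - 1)
        omega)
    have hTM : ∀ b ∈ T, ∃ q ∈ M, (q : ℕ) / ℓ = b := fun b hb =>
      Finset.mem_image.1 (Finset.mem_of_mem_erase (hTN hb))
    have hTB : ∀ b ∈ T, b + 1 < numBlocks k ℓ := by
      intro b hb
      obtain ⟨q, -, hq⟩ := hTM b hb
      have h1 := lt_numBlocks q.2 hℓ
      have h2 := Finset.ne_of_mem_erase (hTN hb)
      omega
    set P := Finset.univ.filter fun p : Fin k => (p : ℕ) / ℓ ∈ T with hP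
    have hPcard : P.card = (c - 2 * z) * ℓ := by rw [hP, card_positions hℓ hTB, hT]
    set R := P.filter (· ∈ M) with hR
    have hF : (P.filter (· ∉ M)).card ≤ z * ℓ := by
      rw [← Finset.card_map Fin.valEmbedding]
      refine Guess.card_fixed_le (g := g) (D := D) hℓ hzw hw hdel hz hD _ ?_
      intro p' hp'
      obtain ⟨p, hp, rfl⟩ := Finset.mem_map.1 hp'
      have hpT : (p : ℕ) / ℓ ∈ T := (Finset.mem_filter.1 (Finset.mem_filter.1 hp).1).2
      obtain ⟨q, hqM, hq⟩ := hTM _ hpT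
      have hq' := Guess.mem_moved.1 hqM
      rw [hq] at hq'
      refine ⟨hq'.1, ?_, q, hq, hq'.2⟩
      by_contra h
      exact (Finset.mem_filter.1 hp).2 (Guess.mem_moved.2 ⟨hq'.1, h⟩)
    have hRF : R.card + (P.filter (· ∉ M)).card = P.card :=
      Finset.card_filter_add_card_filter_not _
    set Bad := Finset.univ.filter fun u : Fin k → Bool => ∃ v, C.Mistaken w D g u v
    have hBad : ∀ u, ∃ v, u ∈ Bad → C.Mistaken w D g u v := by
      intro u
      by_cases h : u ∈ Bad
      · obtain ⟨v, hv⟩ := (Finset.mem_filter.1 h).2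
        exact ⟨v, fun _ => hv⟩
      · exact ⟨u, fun h' => absurd h' h⟩
    choose V hV using hBad
    -- The record of a bad message: nothing is noted at the positions in `R`, the difference to the
    -- decoded message at the other moved positions, and the message itself elsewhere.
    let Φ : (Fin k → Bool) → Bool × ({p : Fin k // p ∉ R} → Bool) := fun u =>
      (C.firstParity u, fun p => if p.1 ∈ M then (u p).xor (V u p) else u p)
    have hinj : Set.InjOn Φ Bad := by
      intro u₁ hu₁ u₂ hu₂ heq
      obtain ⟨-, hp₁, ha₁⟩ := hV u₁ hu₁
      obtain ⟨-, hp₂, ha₂⟩ := hV u₂ hu₂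
      have hβ : C.firstParity u₁ = C.firstParity u₂ := congrArg Prod.fst heq
      have hΦ : ∀ p ∉ R, (if p ∈ M then (u₁ p).xor (V u₁ p) else u₁ p) =
          if p ∈ M then (u₂ p).xor (V u₂ p) else u₂ p := fun p hp =>
        congrFun (congrArg Prod.snd heq) ⟨p, hp⟩
      -- Both differences have zero parities. Off the blocks in `T` and the erased ones, at most `c`
      -- altogether, they are equal: they are recorded where positions are moved and vanish where
      -- they are not.
      have hd : (fun p => (u₁ p).xor (V u₁ p)) = fun p => (u₂ p).xor (V u₂ p) := by
        refine C.eq_of_parityBits_eq ?_ (T ∪ g.erasures) ?_ ?_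
        · rw [C.parityBits_xor hp₁.symm, C.parityBits_xor hp₂.symm]
        · have := Finset.card_union_le T g.erasures
          have := g.card_erasures_le
          omega
        · intro p hp
          rw [Finset.mem_union, not_or, Guess.mem_erasures] at hp
          by_cases hpM : p ∈ M
          · have := hΦ p fun h => hp.1 (by simpa [hR, hP, hpM] using h)
            rwa [if_pos hpM, if_pos hpM] at this
          · rw [Mistaken.eq_of_notMem C hD ha₁ hp.2 hpM,
              Mistaken.eq_of_notMem C hD ha₂ hp.2 hpM, Bool.xor_self, Bool.xor_self]
      refine C.eq_of_xor_eq hzw hD hdel ha₁ ha₂ hβ (fun p hp => ?_) fun p => congrFun hd p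
      have := hΦ p fun h => hp (Finset.mem_filter.1 h).2
      rwa [if_neg hp, if_neg hp] at this
    have hle := Finset.card_le_card_of_injOn Φ (t := Finset.univ) (fun _ _ => Finset.mem_univ _) hinj
    have hcardR : Fintype.card {p : Fin k // p ∉ R} = k - R.card := by
      rw [Fintype.card_subtype_compl, Fintype.card_fin, Fintype.card_coe]
    rw [Finset.card_univ, Fintype.card_prod, Fintype.card_fun, Fintype.card_bool, hcardR] at hle
    have hRk : R.card ≤ k := by simpa using Finset.card_le_univ R
    -- The record saves `R.card` bits at the price of one parity bit, and `hF` gives `(c - 2 * z) *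
    -- ℓ ≤ R.card + z * ℓ`.
    calc Bad.card * 2 ^ ((c - 2 * z) * ℓ)
        ≤ (2 * 2 ^ (k - R.card)) * 2 ^ (R.card + z * ℓ) :=
          Nat.mul_le_mul hle (Nat.pow_le_pow_right (by omega) (by omega))
      _ = 2 * (2 ^ (k - R.card) * 2 ^ R.card) * 2 ^ (z * ℓ) := by rw [pow_add]; ring
      _ = _ := by rw [← pow_add, Nat.sub_add_cancel hRk]

end Code

end GC

/-! ### The union bound over all guesses -/

namespace GC

namespace Code

variable {k ℓ c : ℕ} (C : Code k ℓ c) {z w : ℕ}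

theorem decode_eq_some {y : List Bool} {u : Fin k → Bool} (h : C.Possible z w y u)
    (hu : ∀ v, C.Possible z w y v → v = u) : C.decode z w y = some u := by
  have h' : ∃! v, C.Possible z w y v := ⟨u, h, hu⟩
  rw [decode, dif_pos h', hu _ h'.choose_spec.1]

theorem decode_eq_none {y : List Bool} {u v : Fin k → Bool} (hu : C.Possible z w y u)
    (hv : C.Possible z w y v) (hne : v ≠ u) : C.decode z w y = none :=
  dif_neg fun h => hne (h.unique hv hu)

theorem decode_eq_none_of_forall {y : List Bool} (h : ∀ v, ¬ C.Possible z w y v) :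
    C.decode z w y = none :=
  dif_neg fun ⟨v, hv, _⟩ => h v hv

theorem decode_eq_or {y : List Bool} {u : Fin k → Bool} (h : C.Possible z w y u) :
    C.decode z w y = some u ∨ C.decode z w y = none := by
  by_cases hu : ∀ v, C.Possible z w y v → v = u
  · exact Or.inl (C.decode_eq_some h hu)
  · push Not at hu
    obtain ⟨v, hv, hne⟩ := hu
    exact Or.inr (C.decode_eq_none h hv hne)

theorem exists_ne_of_decode_eq_none {y : List Bool} {u : Fin k → Bool} (h : C.Possible z w y u)
    (hd : C.decode z w y = none) : ∃ v, v ≠ u ∧ C.Possible z w y v := by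
  by_contra hne
  push Not at hne
  rw [C.decode_eq_some h fun v hv => by
    by_contra h'
    exact hne v h' hv] at hd
  exact absurd hd (by simp)

-- A failure needs a mistaken guess, since the transmitted message is possible itself. The union
-- bound runs over a pair of block and number of deletions for each window; the supersequence
-- criterion is not needed for it.
open Classical in
theorem card_failure_le (hz : 0 < z) (hzw : z * w ≤ ℓ) (hw : w ≤ ℓ) (hc : 2 * z ≤ c)
    (hB : 2 ≤ numBlocks k ℓ) (hBw : numBlocks k ℓ * (w + 1) ≤ k) {D : Finset ℕ}
    (hD : Localized z w D) :
    (Finset.univ.filter fun u : Fin k → Bool =>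
      C.decode z w (deleteAt D (C.encode z w u)) = none).card * 2 ^ ((c - 2 * z) * ℓ) ≤
      k ^ z * (2 * 2 ^ k * 2 ^ (z * ℓ)) := by
  let G : (Fin z → Fin (numBlocks k ℓ) × Fin (w + 1)) → Guess z := fun f =>
    ⟨fun j => (f j).1, fun j => (f j).2⟩
  have hsub : (Finset.univ.filter fun u : Fin k → Bool =>
      C.decode z w (deleteAt D (C.encode z w u)) = none) ⊆
      Finset.univ.biUnion fun f => Finset.univ.filter fun u => ∃ v, C.Mistaken w D (G f) u v := by
    intro u hu
    obtain ⟨v, hne, hpar, g, hg, hag, -⟩ := C.exists_ne_of_decode_eq_none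
      (C.possible_self hz hD hw hB u) (Finset.mem_filter.1 hu).2
    rw [C.recoveredParity_deleteAt hD] at hpar
    simp only [Finset.mem_biUnion, Finset.mem_univ, true_and, Finset.mem_filter]
    exact ⟨fun j => (⟨g.start j, (Nat.lt_succ_self _).trans (hg.1 j).1⟩,
      ⟨g.del j, Nat.lt_succ_of_le (hg.1 j).2⟩), v, hne, hpar, hag⟩
  refine (Nat.mul_le_mul_right _ ((Finset.card_le_card hsub).trans Finset.card_biUnion_le)).trans ?_
  rw [Finset.sum_mul]
  refine (Finset.sum_le_card_nsmul _ _ (2 * 2 ^ k * 2 ^ (z * ℓ)) fun f _ =>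
    C.card_mistaken_le hz hzw hw hc hD fun j => Nat.le_of_lt_succ (f j).2.2).trans ?_
  rw [smul_eq_mul]
  refine Nat.mul_le_mul_right _ ?_
  rw [Finset.card_univ, Fintype.card_fun, Fintype.card_prod, Fintype.card_fin, Fintype.card_fin,
    Fintype.card_fin]
  exact Nat.pow_le_pow_left hBw z

/-- The probability of a decoding failure. -/
theorem failureProb_le (hk : k = 2 ^ ℓ) (hz : 0 < z) (hzw : z * w ≤ ℓ) (hw : w ≤ ℓ)
    (hc : 2 * z ≤ c) (hB : 2 ≤ numBlocks k ℓ) (hBw : numBlocks k ℓ * (w + 1) ≤ k) {D : Finset ℕ}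
    (hD : Localized z w D) :
    C.failureProb z w D ≤ 2 * (k : ℝ) ^ (-((c : ℤ) - 4 * (z : ℤ))) := by
  have h := C.card_failure_le hz hzw hw hc hB hBw hD
  have h1 : (2 : ℕ) ^ ((c - 2 * z) * ℓ) = k ^ (c - 2 * z) := by
    rw [mul_comm, pow_mul, hk]
  have h2 : (2 : ℕ) ^ (z * ℓ) = k ^ z := by rw [mul_comm, pow_mul, hk]
  rw [h1, h2] at h
  unfold failureProb
  generalize (Finset.card _) = n at h ⊢
  have hk0 : (0 : ℝ) < k := by rw [hk]; positivity
  have h' : (n : ℝ) * (k : ℝ) ^ (c - 2 * z) ≤ (k : ℝ) ^ z * (2 * 2 ^ k * (k : ℝ) ^ z) := by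
    exact_mod_cast h
  rw [div_le_iff₀ (by positivity)]
  -- One factor `k ^ z` counts the guesses, the other one is `2 ^ (z * ℓ)`, which pays for the fixed
  -- positions in the chosen blocks.
  have h3 : -((c : ℤ) - 4 * (z : ℤ)) = (z : ℤ) + z - ((c - 2 * z : ℕ) : ℤ) := by
    push_cast [hc]; ring
  rw [h3, zpow_sub₀ hk0.ne', zpow_add₀ hk0.ne', zpow_natCast, zpow_natCast]
  have h4 : 2 * ((k : ℝ) ^ z * (k : ℝ) ^ z / (k : ℝ) ^ (c - 2 * z)) * 2 ^ k =
      ((k : ℝ) ^ z * (2 * 2 ^ k * (k : ℝ) ^ z)) / (k : ℝ) ^ (c - 2 * z) := by ring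
  rw [h4, le_div_iff₀ (by positivity)]
  exact h'

end Code

end GC

namespace GC

/-! ## Correctness of the elimination -/

/-- A vector shifted by one place, with a zero in front. -/
def shiftMap : (ℕ → ZMod 2) →ₗ[ZMod 2] (ℕ → ZMod 2) where
  toFun v j := if j = 0 then 0 else v (j - 1)
  map_add' u v := by funext j; by_cases h : j = 0 <;> simp [h]
  map_smul' a v := by funext j; by_cases h : j = 0 <;> simp [h]

/-- The first unit vector. -/
def firstUnit : ℕ → ZMod 2 := fun j => if j = 0 then 1 else 0

/-- The span of the rows of a matrix. -/
def rowSpan : List (List Bool) → Submodule (ZMod 2) (ℕ → ZMod 2)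
  | [] => ⊥
  | r :: R => Submodule.span (ZMod 2) {vec r} ⊔ rowSpan R

theorem add_self_vec (v : ℕ → ZMod 2) : v + v = 0 := by
  rw [← two_smul (ZMod 2), show (2 : ZMod 2) = 0 from rfl, zero_smul]

theorem shiftMap_zero_apply (v : ℕ → ZMod 2) : shiftMap v 0 = 0 := rfl

theorem shiftMap_succ_apply (v : ℕ → ZMod 2) (j : ℕ) : shiftMap v (j + 1) = v j := rfl

theorem shiftMap_pow_apply (m : ℕ) (v : ℕ → ZMod 2) (j : ℕ) :
    (shiftMap ^ m) v j = if j < m then 0 else v (j - m) := by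
  induction m generalizing j with
  | zero => simp
  | succ m ih =>
    rw [pow_succ', Module.End.mul_apply]
    cases j with
    | zero => rw [shiftMap_zero_apply, if_pos (Nat.succ_pos _)]
    | succ j => rw [shiftMap_succ_apply, ih]; simp

theorem vec_cons (b : Bool) (l : List Bool) :
    vec (b :: l) = (if b = true then firstUnit else 0) + shiftMap (vec l) := by
  funext j
  cases j with
  | zero => cases b <;> simp [vec, firstUnit, shiftMap]
  | succ j => cases b <;> simp [vec, firstUnit, shiftMap]

theorem vec_eq_of_headD (l : List Bool) :
    vec l = (if l.headD false = true then firstUnit else 0) + shiftMap (vec l.tail) := by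
  cases l with
  | nil => simp [vec_nil]
  | cons b l => exact vec_cons b l

theorem lin_nil (u : List Bool) : lin u [] = 0 := by simp [lin]

theorem lin_cons (b : Bool) (u r : List Bool) (R : List (List Bool)) :
    lin (b :: u) (r :: R) = (if b = true then vec r else 0) + lin u R := by simp [lin]

theorem mem_rowSpan {R : List (List Bool)} {v : ℕ → ZMod 2} :
    v ∈ rowSpan R ↔ ∃ u : List Bool, u.length = R.length ∧ v = lin u R := by
  induction R generalizing v with
  | nil =>
    rw [rowSpan, Submodule.mem_bot]
    constructor
    · rintro rfl
      exact ⟨[], rfl, (lin_nil _).symm⟩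
    · rintro ⟨u, -, rfl⟩
      exact lin_nil u
  | cons r R ih =>
    rw [rowSpan, Submodule.mem_sup]
    constructor
    · rintro ⟨a, ha, b, hb, rfl⟩
      obtain ⟨t, rfl⟩ := Submodule.mem_span_singleton.1 ha
      obtain ⟨u, hu, rfl⟩ := ih.1 hb
      refine ⟨decide (t = 1) :: u, by simp [hu], ?_⟩
      rw [lin_cons]
      congr 1
      have h : ∀ t : ZMod 2, t = 0 ∨ t = 1 := by decide
      rcases h t with rfl | rfl <;> simp
    · rintro ⟨_ | ⟨b, u⟩, hu, rfl⟩
      · simp at hu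
      · rw [lin_cons]
        refine ⟨_, ?_, _, ih.2 ⟨u, by simpa using hu, rfl⟩, rfl⟩
        split
        · exact Submodule.mem_span_singleton_self _
        · exact Submodule.zero_mem _

/-- The span of the rows treated so far in an elimination step. -/
def stepSpan (s : List (List Bool) × List (List Bool)) : Submodule (ZMod 2) (ℕ → ZMod 2) :=
  (match s.1 with
    | [] => ⊥
    | p :: _ => Submodule.span (ZMod 2) {firstUnit + shiftMap (vec p)}) ⊔
  (rowSpan s.2).map shiftMap

theorem span_sup_span_add (a b : ℕ → ZMod 2) :
    Submodule.span (ZMod 2) {a} ⊔ Submodule.span (ZMod 2) {b + a} =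
      Submodule.span (ZMod 2) {a} ⊔ Submodule.span (ZMod 2) {b} := by
  have h1 : ∀ c : ℕ → ZMod 2, Submodule.span (ZMod 2) {a} ⊔ Submodule.span (ZMod 2) {c + a} ≤
      Submodule.span (ZMod 2) {a} ⊔ Submodule.span (ZMod 2) {c} := by
    intro c
    refine sup_le le_sup_left ?_
    rw [Submodule.span_singleton_le_iff_mem]
    exact Submodule.add_mem _ (Submodule.mem_sup_right (Submodule.mem_span_singleton_self c))
      (Submodule.mem_sup_left (Submodule.mem_span_singleton_self a))
  refine le_antisymm (h1 b) ?_
  have h2 := h1 (b + a)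
  rwa [add_assoc, add_self_vec, add_zero] at h2

/-- The lengths of the rows in an elimination step. -/
def StepLength (n : ℕ) (s : List (List Bool) × List (List Bool)) : Prop :=
  (∀ p ∈ s.1, p.length = n) ∧ ∀ r ∈ s.2, r.length = n

/-- In `stepSpan` the dropped first column is restored, with entry one in the pivot row and zero in
all others. Adding the pivot to a row is then a row operation that preserves the span. -/
theorem elimRow_spec {n : ℕ} {s : List (List Bool) × List (List Bool)} {v : List Bool}
    (hs : StepLength n s) (hv : v.length = n + 1) : StepLength n (elimRow s v) ∧
    stepSpan (elimRow s v) = stepSpan s ⊔ Submodule.span (ZMod 2) {vec v} := by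
  obtain ⟨P, O⟩ := s
  have ht : v.tail.length = n := by simp [hv]
  have hvec := vec_eq_of_headD v
  unfold elimRow
  by_cases h : v.headD false = true
  · rw [if_pos h] at hvec ⊢
    cases P with
    | nil =>
      refine ⟨⟨by simpa using ht, hs.2⟩, ?_⟩
      rw [hvec]
      simp only [stepSpan, bot_sup_eq]
      exact sup_comm _ _
    | cons p P =>
      have hp := hs.1 p (by simp)
      refine ⟨⟨hs.1, ?_⟩, ?_⟩
      · intro r hr
        rcases List.mem_cons.1 hr with rfl | hr
        · simp [xorList, hp, hv]
        · exact hs.2 r hr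
      · have h1 : shiftMap (vec (xorList v.tail p)) = vec v + (firstUnit + shiftMap (vec p)) := by
          rw [vec_xorList (ht.trans hp.symm), map_add, hvec, add_add_add_comm, add_self_vec,
            zero_add]
        simp only [stepSpan, rowSpan, Submodule.map_sup, Submodule.map_span, Set.image_singleton]
        rw [h1, ← sup_assoc, span_sup_span_add, sup_right_comm]
  · rw [if_neg h, zero_add] at hvec
    rw [if_neg h]
    refine ⟨⟨hs.1, ?_⟩, ?_⟩
    · intro r hr
      rcases List.mem_cons.1 hr with rfl | hr
      · exact ht
      · exact hs.2 r hr
    · simp only [stepSpan, rowSpan, Submodule.map_sup, Submodule.map_span, Set.image_singleton]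
      rw [← hvec, sup_assoc]
      congr 1
      exact sup_comm _ _

theorem foldl_elimRow_spec {n : ℕ} (R : List (List Bool)) (hR : ∀ r ∈ R, r.length = n + 1)
    {s : List (List Bool) × List (List Bool)} (hs : StepLength n s) :
    StepLength n (R.foldl elimRow s) ∧ stepSpan (R.foldl elimRow s) = stepSpan s ⊔ rowSpan R := by
  induction R generalizing s with
  | nil => exact ⟨hs, by simp [rowSpan]⟩
  | cons r R ih =>
    have h1 := elimRow_spec hs (hR r (by simp))
    have h2 := ih (fun r' h => hR r' (by simp [h])) h1.1
    exact ⟨h2.1, by rw [List.foldl_cons, h2.2, h1.2, sup_assoc, rowSpan]⟩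

/-- The vectors which arise from the target by adding rows. -/
def Reaches (st : List (List Bool) × List Bool) (v : ℕ → ZMod 2) : Prop :=
  v + vec st.2 ∈ rowSpan st.1

theorem elimStep_length {n : ℕ} {st : List (List Bool) × List Bool}
    (hR : ∀ r ∈ st.1, r.length = n + 1) (ht : st.2.length = n + 1) :
    (∀ r ∈ (elimStep st).1, r.length = n) ∧ (elimStep st).2.length = n := by
  have h := (foldl_elimRow_spec st.1 hR (s := ([], [])) ⟨by simp, by simp⟩).1
  refine ⟨h.2, ?_⟩
  have ht' : st.2.tail.length = n := by simp [ht]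
  unfold elimStep
  generalize st.1.foldl elimRow ([], []) = s at h
  obtain ⟨P, O⟩ := s
  simp only
  split
  · cases P with
    | nil => exact ht'
    | cons p P => simp [xorList, ht, h.1 p (by simp)]
  · exact ht'

/-- A vector `shiftMap v` has first entry zero, so the pivot must be used exactly if the target
starts with a one, and this is what the step does. Without a pivot such a target would lose its
first entry unnoticed; `hex` rules this out. -/
theorem reaches_elimStep {n : ℕ} {st : List (List Bool) × List Bool}
    (hR : ∀ r ∈ st.1, r.length = n + 1) (ht : st.2.length = n + 1)
    (hex : ∃ v, Reaches st (shiftMap v)) (v : ℕ → ZMod 2) :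
    Reaches (elimStep st) v ↔ Reaches st (shiftMap v) := by
  have h := foldl_elimRow_spec st.1 hR (s := ([], [])) ⟨by simp, by simp⟩
  have hspan : rowSpan st.1 = stepSpan (st.1.foldl elimRow ([], [])) := by
    rw [h.2]; simp [stepSpan, rowSpan]
  unfold Reaches at hex ⊢
  rw [hspan] at hex ⊢
  have hvec := vec_eq_of_headD st.2
  have ht' : st.2.tail.length = n := by simp [ht]
  unfold elimStep
  have hlen := h.1
  generalize st.1.foldl elimRow ([], []) = s at hlen hex
  obtain ⟨P, O⟩ := s
  have hinj : ∀ a ∈ (rowSpan O).map shiftMap, a 0 = 0 := by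
    rintro a ⟨w, -, rfl⟩
    rfl
  have hmem : ∀ a : ℕ → ZMod 2, shiftMap a ∈ (rowSpan O).map shiftMap ↔ a ∈ rowSpan O := by
    intro a
    constructor
    · rintro ⟨w, hw, he⟩
      have : w = a := funext fun j => congrFun he (j + 1)
      exact this ▸ hw
    · exact fun ha => ⟨a, ha, rfl⟩
  by_cases hb : st.2.headD false = true
  · rw [if_pos hb] at hvec
    cases P with
    | nil =>
      obtain ⟨v', hv'⟩ := hex
      simp only [stepSpan, bot_sup_eq] at hv'
      have := hinj _ hv'
      rw [hvec] at this
      simp [shiftMap_zero_apply, firstUnit] at this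
    | cons p P =>
      have hp := hlen.1 p (by simp)
      simp only [hb, if_true, stepSpan]
      rw [hvec, ← hmem, vec_xorList (ht'.trans hp.symm)]
      set f := firstUnit + shiftMap (vec p) with hf
      have h1 : shiftMap v + (firstUnit + shiftMap (vec st.2.tail)) =
          shiftMap (v + (vec st.2.tail + vec p)) + f := by
        have := add_self_vec (shiftMap (vec p))
        rw [map_add, map_add, hf]
        linear_combination -this
      rw [h1, Submodule.mem_sup]
      constructor
      · exact fun h => ⟨f, Submodule.mem_span_singleton_self f, _, h, add_comm _ _⟩
      · rintro ⟨a, ha, b, hb, he⟩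
        obtain ⟨t, rfl⟩ := Submodule.mem_span_singleton.1 ha
        -- Only the pivot row has a nonzero first entry, so comparing first entries shows that its
        -- coefficient is one.
        have h2 := congrFun he 0
        simp only [Pi.add_apply, Pi.smul_apply, hinj b hb, shiftMap_zero_apply, hf, firstUnit,
          if_true, add_zero, smul_eq_mul, mul_one, zero_add] at h2
        rw [h2, one_smul, add_comm] at he
        rwa [← add_right_cancel he]
  · rw [if_neg hb, zero_add] at hvec
    simp only [hb, Bool.false_eq_true, if_false, stepSpan]
    rw [hvec, ← hmem, map_add]
    cases P with
    | nil => simp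
    | cons p P =>
      simp only
      constructor
      · exact fun h => Submodule.mem_sup_right h
      · intro h
        obtain ⟨a, ha, b, hb, he⟩ := Submodule.mem_sup.1 h
        obtain ⟨t, rfl⟩ := Submodule.mem_span_singleton.1 ha
        have h2 := congrFun he 0
        simp only [Pi.add_apply, Pi.smul_apply, hinj b hb, shiftMap_zero_apply, firstUnit,
          if_true, add_zero, smul_eq_mul, mul_one] at h2
        rw [h2, zero_smul, zero_add] at he
        rwa [← he]

theorem foldl_elimStep_length {n : ℕ} (l : List Bool) {st : List (List Bool) × List Bool}
    (hR : ∀ r ∈ st.1, r.length = l.length + n) (ht : st.2.length = l.length + n) :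
    (l.foldl (fun st _ => elimStep st) st).2.length = n := by
  induction l generalizing st with
  | nil => simpa using ht
  | cons b l ih =>
    have h := elimStep_length (n := l.length + n) (st := st)
      (fun r hr => by rw [hR r hr, List.length_cons]; omega)
      (by rw [ht, List.length_cons]; omega)
    exact ih h.1 h.2

theorem reaches_foldl_elimStep {n : ℕ} (l : List Bool) {st : List (List Bool) × List Bool}
    (hR : ∀ r ∈ st.1, r.length = l.length + n) (ht : st.2.length = l.length + n)
    (hex : ∃ v, Reaches st ((shiftMap ^ l.length) v)) (v : ℕ → ZMod 2) :
    Reaches (l.foldl (fun st _ => elimStep st) st) v ↔ Reaches st ((shiftMap ^ l.length) v) := by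
  induction l generalizing st with
  | nil => simp
  | cons b l ih =>
    have hR' : ∀ r ∈ st.1, r.length = l.length + n + 1 := fun r hr => by
      rw [hR r hr, List.length_cons]; omega
    have ht' : st.2.length = l.length + n + 1 := by rw [ht, List.length_cons]; omega
    have h := elimStep_length hR' ht'
    simp only [List.length_cons, pow_succ', Module.End.mul_apply] at hex ⊢
    obtain ⟨v₀, hv₀⟩ := hex
    have h1 := reaches_elimStep hR' ht' ⟨_, hv₀⟩
    rw [← h1]
    exact ih h.1 h.2 ⟨v₀, (h1 _).2 hv₀⟩

theorem unitVectors_append {α : Type} (l : List α) (a : α) : unitVectors (l ++ [a]) =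
    (false :: (unitVectors l).1,
      (true :: (unitVectors l).1) :: (unitVectors l).2.map (false :: ·)) := by
  simp [unitVectors, List.foldl_append]

theorem vec_unitVectors_fst {α : Type} (l : List α) : vec (unitVectors l).1 = 0 := by
  induction l using List.reverseRecOn with
  | nil => exact vec_nil
  | append_singleton l a ih => rw [unitVectors_append, vec_cons, ih]; simp

theorem lin_map_false (u : List Bool) (R : List (List Bool)) :
    lin u (R.map (false :: ·)) = shiftMap (lin u R) := by
  induction R generalizing u with
  | nil => simp [lin]
  | cons r R ih =>
    cases u with
    | nil => simp [lin]
    | cons b u =>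
      rw [List.map_cons, lin_cons, lin_cons, ih, map_add, vec_cons]
      cases b <;> simp

theorem lin_unitVectors {α : Type} (l : List α) {u : List Bool} (hu : u.length = l.length) :
    lin u (unitVectors l).2 = vec u := by
  induction l using List.reverseRecOn generalizing u with
  | nil => rw [List.length_eq_zero_iff.1 hu, vec_nil]; rfl
  | append_singleton l a ih =>
    cases u with
    | nil => simp at hu
    | cons b u =>
      rw [unitVectors_append, lin_cons, lin_map_false, ih (by simpa using hu), vec_cons, vec_cons,
        vec_unitVectors_fst]
      simp

theorem lin_zipWith_append {m : ℕ} (u : List Bool) (R E : List (List Bool))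
    (hR : ∀ r ∈ R, r.length = m) (hE : R.length = E.length) (j : ℕ) :
    lin u (List.zipWith (· ++ ·) R E) j = if j < m then lin u R j else lin u E (j - m) := by
  induction R generalizing u E with
  | nil =>
    rw [List.length_eq_zero_iff.1 hE.symm]
    simp [lin]
  | cons r R ih =>
    cases E with
    | nil => simp at hE
    | cons e E =>
      cases u with
      | nil => simp [lin]
      | cons b u =>
        rw [List.zipWith_cons_cons, lin_cons, lin_cons, lin_cons, Pi.add_apply,
          ih u E (fun r' h => hR r' (by simp [h])) (by simpa using hE)]
        have h1 := vec_append r e j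
        rw [hR r (by simp)] at h1
        by_cases h : j < m
        · rw [if_pos h] at h1 ⊢
          rw [if_pos h]
          cases b <;> simp [h1]
        · rw [if_neg h] at h1 ⊢
          rw [if_neg h]
          cases b <;> simp [h1]

theorem length_solve {R : List (List Bool)} {S : List Bool} (hR : ∀ r ∈ R, r.length = S.length) :
    (solve R S).length = R.length := by
  obtain ⟨h1, h2, h3⟩ := length_unitVectors R
  refine foldl_elimStep_length S ?_ (by simp [h1])
  intro r hr
  obtain ⟨i, hi, rfl⟩ := List.getElem_of_mem hr
  rw [List.getElem_zipWith, List.length_append, hR _ (List.getElem_mem _),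
    h3 _ (List.getElem_mem _)]

/-- If the rows have a sum `S`, the elimination finds rows with this sum. -/
theorem lin_solve {R : List (List Bool)} {S : List Bool} (hR : ∀ r ∈ R, r.length = S.length)
    (hex : ∃ u : List Bool, u.length = R.length ∧ lin u R = vec S) :
    lin (solve R S) R = vec S := by
  obtain ⟨h1, h2, h3⟩ := length_unitVectors R
  -- In the augmented table the first `S.length` columns carry the equations and the remaining ones
  -- keep track of the selected rows. So `u` solves the system exactly if `(0, u) + (S, 0)` is the
  -- sum of the augmented rows selected by `u`.
  have key : ∀ u : List Bool, u.length = R.length → (lin u R = vec S ↔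
      (shiftMap ^ S.length) (vec u) + vec (S ++ (unitVectors R).1) =
        lin u (List.zipWith (· ++ ·) R (unitVectors R).2)) := by
    intro u hu
    have hz : ∀ r : List Bool, ∀ j, r.length ≤ j → vec r j = 0 := fun r j h => by
      rw [vec, List.getD_eq_default _ _ h]; rfl
    constructor
    · intro h
      funext j
      rw [lin_zipWith_append u R _ hR h2.symm, Pi.add_apply, shiftMap_pow_apply, vec_append,
        vec_unitVectors_fst, lin_unitVectors R hu]
      split
      · rw [zero_add, h]
      · exact add_zero _
    · intro h
      funext j
      have hj := congrFun h j
      rw [lin_zipWith_append u R _ hR h2.symm, Pi.add_apply, shiftMap_pow_apply, vec_append] at hj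
      by_cases hlt : j < S.length
      · rw [if_pos hlt, if_pos hlt, if_pos hlt, zero_add] at hj
        exact hj.symm
      · rw [hz S j (not_lt.1 hlt), lin_eq_sum, Finset.sum_apply]
        refine Finset.sum_eq_zero fun i hi => ?_
        split
        · refine hz _ _ ?_
          rw [List.getD_eq_getElem _ _ (Finset.mem_range.1 hi), hR _ (List.getElem_mem _)]
          exact not_lt.1 hlt
        · rfl
  set st : List (List Bool) × List Bool :=
    (List.zipWith (· ++ ·) R (unitVectors R).2, S ++ (unitVectors R).1) with hst
  have hrow : ∀ r ∈ st.1, r.length = S.length + R.length := by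
    intro r hr
    obtain ⟨i, hi, rfl⟩ := List.getElem_of_mem hr
    simp only [hst, List.getElem_zipWith, List.length_append]
    rw [hR _ (List.getElem_mem _), h3 _ (List.getElem_mem _)]
  have hlen : st.1.length = R.length := by simp [hst, h2]
  have hreach := reaches_foldl_elimStep S (st := st) hrow (by simp [hst, h1]) (by
    obtain ⟨u, hu, he⟩ := hex
    exact ⟨vec u, mem_rowSpan.2 ⟨u, hu.trans hlen.symm, (key u hu).1 he⟩⟩) (vec (solve R S))
  -- The final target reaches itself because `x + x = 0`. Traced back through the elimination this
  -- yields a selection `u`, and the tracking columns identify it with the final target.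
  have hself : Reaches (S.foldl (fun st _ => elimStep st) st) (vec (solve R S)) := by
    unfold Reaches solve
    rw [add_self_vec]
    exact Submodule.zero_mem _
  obtain ⟨u, hu, he⟩ := mem_rowSpan.1 (hreach.1 hself)
  rw [hlen] at hu
  have hsu : solve R S = u := by
    refine vec_inj ((length_solve hR).trans hu.symm) ?_
    funext j
    have hj := congrFun he (S.length + j)
    simp only [hst] at hj
    rw [lin_zipWith_append u R _ hR h2.symm, Pi.add_apply, shiftMap_pow_apply, vec_append,
      vec_unitVectors_fst, lin_unitVectors R hu] at hj
    simpa using hj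
  rw [hsu] at he ⊢
  exact (key u hu).2 he

end GC

namespace GC

/-! ## Correctness of the treatment of a guess -/

/-- The contribution of the blocks that are not erased. -/
noncomputable def knownSum (I : List Item) : ℕ → ZMod 2 :=
  (I.map fun q => if q.1 = true then 0 else lin q.2.2 q.2.1).sum

theorem knownPart_spec (S : List Bool) (I : List Item)
    (hI : ∀ q ∈ I, ∀ r ∈ q.2.1, r.length = S.length) :
    (knownPart S I).length = S.length ∧ vec (knownPart S I) = vec S + knownSum I := by
  induction I generalizing S with
  | nil => exact ⟨rfl, by simp [knownPart, knownSum]⟩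
  | cons q I ih =>
    have h0 : knownPart S (q :: I) = knownPart (if q.1 = true then S else addRows S q.2.2 q.2.1) I :=
      rfl
    have h1 : knownSum (q :: I) = (if q.1 = true then 0 else lin q.2.2 q.2.1) + knownSum I := by
      simp [knownSum]
    have hq := hI q (by simp)
    have hI' : ∀ q ∈ I, ∀ r ∈ q.2.1, r.length = S.length := fun q' h => hI q' (by simp [h])
    rw [h0, h1]
    by_cases h : q.1 = true
    · rw [if_pos h, if_pos h, zero_add]
      exact ih S hI'
    · rw [if_neg h, if_neg h]
      have h2 := addRows_spec (S := S) q.2.2 hq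
      have h3 := ih (addRows S q.2.2 q.2.1) (by rw [h2.1]; exact hI')
      exact ⟨h3.1.trans h2.1, by rw [h3.2, h2.2, add_assoc]⟩

theorem fill_cons (s : List Bool) (q : Item) (I : List Item) : fill s (q :: I) =
    (q.1, q.2.2, if q.1 = true then s.take q.2.1.length else q.2.2) ::
      fill (if q.1 = true then s.drop q.2.1.length else s) I := rfl

theorem unknownRows_cons (q : Item) (I : List Item) :
    unknownRows (q :: I) = (if q.1 = true then q.2.1 else []) ++ unknownRows I := by
  simp [unknownRows]

/-- The blocks `X` are a way to fill in the erased blocks. -/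
def Fills (I : List Item) (X : List (List Bool)) : Prop :=
  List.Forall₂ (fun q x => x.length = q.2.1.length ∧ (q.1 = false → x = q.2.2)) I X

theorem Fills.flatMap_zipWith {I : List Item} {X : List (List Bool)} (h : Fills I X) :
    (List.zipWith (fun (q : Item) x => (q.1, q.2.2, x)) I X).flatMap (fun q => q.2.2) =
      X.flatten := by
  induction h with
  | nil => rfl
  | cons _ _ ih => rw [List.zipWith_cons_cons, List.flatMap_cons, ih, List.flatten_cons]

theorem exists_fill {I : List Item} {X : List (List Bool)} (h : Fills I X) :
    ∃ s : List Bool, s.length = (unknownRows I).length ∧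
      fill s I = List.zipWith (fun q x => (q.1, q.2.2, x)) I X := by
  induction h with
  | nil => exact ⟨[], rfl, rfl⟩
  | @cons q x I X hq _ ih =>
    obtain ⟨s, hs, hf⟩ := ih
    by_cases h : q.1 = true
    · refine ⟨x ++ s, ?_, ?_⟩
      · rw [unknownRows_cons, if_pos h, List.length_append, List.length_append, hq.1, hs]
      · rw [fill_cons, if_pos h, if_pos h, ← hq.1, List.take_left, List.drop_left, hf]
        rfl
    · refine ⟨s, ?_, ?_⟩
      · rw [unknownRows_cons, if_neg h, List.nil_append, hs]
      · rw [fill_cons, if_neg h, if_neg h, hf, List.zipWith_cons_cons,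
          hq.2 (Bool.eq_false_iff.2 h)]

theorem fills_of_fill {I : List Item} {s : List Bool} (hs : s.length = (unknownRows I).length)
    (hI : ∀ q ∈ I, q.1 = false → q.2.2.length = q.2.1.length) :
    ∃ X, Fills I X ∧ fill s I = List.zipWith (fun q x => (q.1, q.2.2, x)) I X := by
  induction I generalizing s with
  | nil => exact ⟨[], List.Forall₂.nil, rfl⟩
  | cons q I ih =>
    have hI' : ∀ q ∈ I, q.1 = false → q.2.2.length = q.2.1.length := fun q' h => hI q' (by simp [h])
    rw [unknownRows_cons, List.length_append] at hs
    by_cases h : q.1 = true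
    · rw [if_pos h] at hs
      obtain ⟨X, hX, hf⟩ := ih (s := s.drop q.2.1.length) (by rw [List.length_drop]; omega) hI'
      refine ⟨s.take q.2.1.length :: X, List.Forall₂.cons ⟨?_, ?_⟩ hX, ?_⟩
      · rw [List.length_take]; omega
      · intro h'; rw [h] at h'; exact absurd h' (by simp)
      · rw [fill_cons, if_pos h, if_pos h, hf]; rfl
    · rw [if_neg h, List.length_nil, zero_add] at hs
      obtain ⟨X, hX, hf⟩ := ih hs hI'
      refine ⟨q.2.2 :: X, List.Forall₂.cons ⟨hI q (by simp) (Bool.eq_false_iff.2 h),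
        fun _ => rfl⟩ hX, ?_⟩
      rw [fill_cons, if_neg h, if_neg h, hf]; rfl

theorem sum_fill (s : List Bool) (I : List Item) :
    (List.zipWith (fun (q : Item) (f : Bool × List Bool × List Bool) => lin f.2.2 q.2.1) I
      (fill s I)).sum = knownSum I + lin s (unknownRows I) := by
  induction I generalizing s with
  | nil => simp [fill, mapAccum, knownSum, unknownRows, lin]
  | cons q I ih =>
    have h1 : knownSum (q :: I) = (if q.1 = true then 0 else lin q.2.2 q.2.1) + knownSum I := by
      simp [knownSum]
    rw [fill_cons, List.zipWith_cons_cons, List.sum_cons, ih, unknownRows_cons, h1]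
    by_cases h : q.1 = true
    · simp only [if_pos h]
      rw [lin_append_right]
      abel
    · simp only [if_neg h, List.nil_append]
      abel

theorem length_eq_of_mem_unknownRows {m : ℕ} {I : List Item}
    (hI : ∀ q ∈ I, ∀ r ∈ q.2.1, r.length = m) : ∀ r ∈ unknownRows I, r.length = m := by
  intro r hr
  obtain ⟨q, hq, hr⟩ := List.mem_flatMap.1 hr
  split at hr
  · exact hI q hq r hr
  · simp at hr

theorem add_eq_zero_iff_vec {a b : ℕ → ZMod 2} : a + b = 0 ↔ a = b := by
  constructor
  · intro h
    have h1 := add_self_vec b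
    exact add_right_cancel (h.trans h1.symm)
  · rintro rfl
    exact add_self_vec a

/-- The sum of the rows selected by the blocks `X`. -/
noncomputable def blockSum (I : List Item) (X : List (List Bool)) : ℕ → ZMod 2 :=
  (List.zipWith (fun (q : Item) x => lin x q.2.1) I X).sum

theorem sum_fill_eq {I : List Item} {X : List (List Bool)} {s : List Bool}
    (h : fill s I = List.zipWith (fun q x => (q.1, q.2.2, x)) I X) :
    knownSum I + lin s (unknownRows I) = blockSum I X := by
  rw [← sum_fill, h, blockSum]
  congr 1
  clear h
  induction I generalizing X with
  | nil => rfl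
  | cons q I ih =>
    cases X with
    | nil => rfl
    | cons x X => rw [List.zipWith_cons_cons, List.zipWith_cons_cons, List.zipWith_cons_cons, ih]

/-- The outcome of decoding with the given blocks. It is enough that the filling is unique. -/
theorem mem_tryItems {par : List Bool} {I : List Item}
    (hlen : ∀ q ∈ I, ∀ r ∈ q.2.1, r.length = par.length)
    (hseg : ∀ q ∈ I, q.1 = false → q.2.2.length = q.2.1.length)
    (huniq : ∀ X Y, Fills I X → Fills I Y → blockSum I X = vec par → blockSum I Y = vec par → X = Y)
    (x : List Bool) : x ∈ tryItems par I ↔ ∃ X, Fills I X ∧ blockSum I X = vec par ∧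
      runsOk (List.zipWith (fun q x => (q.1, q.2.2, x)) I X) = true ∧ x = X.flatten := by
  have hK := knownPart_spec par I hlen
  have hU : ∀ r ∈ unknownRows I, r.length = (knownPart par I).length := by
    rw [hK.1]; exact length_eq_of_mem_unknownRows hlen
  set s := solve (unknownRows I) (knownPart par I) with hs
  obtain ⟨X, hX, hf⟩ := fills_of_fill (length_solve hU) hseg
  rw [← hs] at hf
  -- Elimination returns a string even if the system has no solution; testing the residue for zero
  -- sorts this case out.
  have hres : ((addRows (knownPart par I) s (unknownRows I)).all fun b => !b) = true ↔
      blockSum I X = vec par := by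
    rw [← vec_eq_zero, (addRows_spec s hU).2, hK.2, add_assoc, sum_fill_eq hf, add_eq_zero_iff_vec]
    exact eq_comm
  have hflat : ((fill s I).flatMap fun q => q.2.2) = X.flatten := by
    rw [hf]
    exact hX.flatMap_zipWith
  have htry : x ∈ tryItems par I ↔ (blockSum I X = vec par ∧
      runsOk (List.zipWith (fun q x => (q.1, q.2.2, x)) I X) = true) ∧ x = X.flatten := by
    unfold tryItems
    rw [← hs, hflat, hf]
    split
    · rename_i h
      rw [Bool.and_eq_true, hres] at h
      simp only [List.mem_singleton, h, and_self, true_and]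
    · rename_i h
      rw [Bool.and_eq_true, hres] at h
      simp only [List.not_mem_nil, h, false_and]
  rw [htry]
  constructor
  · rintro ⟨⟨h1, h2⟩, h3⟩
    exact ⟨X, hX, h1, h2, h3⟩
  · rintro ⟨Y, hY, h1, h2, h3⟩
    -- A filling with the right parities shows that the system is solvable. The elimination then
    -- returns a solution, which by uniqueness is this very filling.
    obtain ⟨t, ht, hft⟩ := exists_fill hY
    have h4 : lin t (unknownRows I) = vec (knownPart par I) := by
      have h5 := sum_fill_eq hft
      rw [h1] at h5
      rw [hK.2, ← h5, add_right_comm, add_self_vec, zero_add]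
    have h5 := lin_solve hU ⟨t, ht, h4⟩
    have h6 : blockSum I X = vec par := by
      rw [← sum_fill_eq hf, hs, h5, hK.2, add_left_comm, add_self_vec, add_zero]
    have h7 := huniq X Y hX hY h6 h1
    exact ⟨⟨h6, h7 ▸ h2⟩, h7 ▸ h3⟩

/-! ### Runs -/

theorem take_drop_append (l : List Bool) {a b d : ℕ} (hab : a ≤ b) (hbd : b ≤ d) :
    (l.take b).drop a ++ (l.drop b).take (d - b) = (l.take d).drop a := by
  obtain ⟨e, rfl⟩ := Nat.exists_eq_add_of_le hbd
  rw [List.take_add, List.drop_append, Nat.add_sub_cancel_left]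
  congr 1
  rcases le_total b l.length with h | h
  · rw [List.length_take, min_eq_left h, Nat.sub_eq_zero_of_le hab, List.drop_zero]
  · rw [List.drop_of_length_le h]
    simp

/-- Consecutive segments telescope. This is used both for the assumed block boundaries in the
received string and for the multiples of `ℓ` in the message. -/
theorem flatMap_segments (l : List Bool) {off : ℕ → ℕ} (hoff : Monotone off) {a b : ℕ}
    (hab : a ≤ b) : ((List.range' a (b - a)).flatMap fun t =>
      (l.drop (off t)).take (off (t + 1) - off t)) = (l.take (off b)).drop (off a) := by
  induction b, hab using Nat.le_induction with
  | base =>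
    rw [Nat.sub_self, List.range'_zero, List.flatMap_nil, List.drop_of_length_le]
    exact List.length_take_le _ _
  | succ b hab ih =>
    rw [show b + 1 - a = (b - a) + 1 by omega, List.range'_1_concat, List.flatMap_append, ih,
      show a + (b - a) = b by omega, List.flatMap_singleton,
      take_drop_append l (hoff hab) (hoff (Nat.le_succ b))]

/-- A maximal run. -/
def IsMaxRun (e : ℕ → Prop) (a b : ℕ) : Prop :=
  a < b ∧ (∀ t, a ≤ t → t < b → e t) ∧ (a = 0 ∨ ¬ e (a - 1)) ∧ ¬ e b

/-- The invariant of the loop: `a` is the beginning of the current run, with `a = n` if there is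
none, and `ok` tells whether the runs that ended before `n` passed the test. -/
theorem foldl_runStep (e : ℕ → Bool) (S K : ℕ → List Bool) (n : ℕ) :
    ∃ a ≤ n, (∀ t, a ≤ t → t < n → e t = true) ∧ (a = 0 ∨ ¬ e (a - 1) = true) ∧
      ∃ ok : Bool, ((List.range n).map fun b => (e b, S b, K b)).foldl runStep (true, [], []) =
        (ok, (List.range' a (n - a)).flatMap S, (List.range' a (n - a)).flatMap K) ∧
      (ok = true ↔ ∀ a' b', b' < n → IsMaxRun (e · = true) a' b' →
        ((List.range' a' (b' - a')).flatMap S).Sublist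
          ((List.range' a' (b' - a')).flatMap K)) := by
  induction n with
  | zero => exact ⟨0, le_rfl, by simp, Or.inl rfl, true, by simp, by simp⟩
  | succ n ih =>
    obtain ⟨a, han, h1, h2, ok, h3, h4⟩ := ih
    rw [List.range_succ, List.map_append, List.foldl_append, h3]
    by_cases h : e n = true
    · refine ⟨a, by omega, fun t h5 h6 => ?_, h2, ok, ?_, ?_⟩
      · rcases Nat.eq_or_lt_of_le (Nat.le_of_lt_succ h6) with rfl | h7
        · exact h
        · exact h1 t h5 h7
      · rw [show n + 1 - a = (n - a) + 1 by omega, List.range'_1_concat,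
          show a + (n - a) = n by omega]
        simp [runStep, h]
      · rw [h4]
        refine forall_congr' fun a' => forall_congr' fun b' => ?_
        constructor
        · intro h5 h6 h7
          refine h5 ?_ h7
          rcases Nat.eq_or_lt_of_le (Nat.le_of_lt_succ h6) with rfl | h8
          · exact absurd h h7.2.2.2
          · exact h8
        · exact fun h5 h6 => h5 (by omega)
    · refine ⟨n + 1, le_rfl, fun t h5 h6 => by omega, Or.inr h, ok &&
        (((List.range' a (n - a)).flatMap S).isSublist ((List.range' a (n - a)).flatMap K)),
        ?_, ?_⟩
      · simp [runStep, h]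
      · rw [Bool.and_eq_true, h4, List.isSublist_iff_sublist]
        constructor
        · rintro ⟨h5, h6⟩ a' b' h7 h8
          rcases Nat.eq_or_lt_of_le (Nat.le_of_lt_succ h7) with rfl | h9
          · have : a' = a := by
              obtain ⟨h10, h11, h12, -⟩ := h8
              rcases lt_trichotomy a' a with h13 | h13 | h13
              · rcases h2 with h2 | h2
                · omega
                · exact absurd (h11 (a - 1) (by omega) (by omega)) h2
              · exact h13
              · rcases h12 with h12 | h12
                · omega
                · exact absurd (h1 (a' - 1) (by omega) (by omega)) h12
            rw [this]
            exact h6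
          · exact h5 a' b' h9 h8
        · intro h5
          refine ⟨fun a' b' h6 => h5 a' b' (by omega), ?_⟩
          rcases Nat.eq_or_lt_of_le han with rfl | h6
          · simp
          · exact h5 a n (Nat.lt_succ_self n) ⟨h6, h1, h2, h⟩

/-- The comparison after the loop has the effect of one more step at a dummy block `B` that is not
erased, so every run ends inside the extended loop. -/
theorem runsOk_iff (e : ℕ → Bool) (S K : ℕ → List Bool) (B : ℕ)
    (he : ∀ b, e b = true → b < B) :
    runsOk ((List.range B).map fun b => (e b, S b, K b)) = true ↔
      ∀ a b, IsMaxRun (e · = true) a b → ((List.range' a (b - a)).flatMap S).Sublist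
        ((List.range' a (b - a)).flatMap K) := by
  have heB : e B = false := by
    by_contra h
    exact absurd (he B (by simpa using h)) (lt_irrefl B)
  obtain ⟨a, -, -, -, ok, h1, h2⟩ := foldl_runStep e S K (B + 1)
  have h3 : runsOk ((List.range B).map fun b => (e b, S b, K b)) = ok := by
    rw [List.range_succ, List.map_append, List.foldl_append] at h1
    unfold runsOk
    generalize ((List.range B).map fun b => (e b, S b, K b)).foldl runStep (true, [], []) = s at h1
    simp only [List.map_cons, List.map_nil, List.foldl_cons, List.foldl_nil, runStep, heB,
      Bool.false_eq_true, if_false, Prod.mk.injEq] at h1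
    exact h1.1
  rw [h3, h2]
  refine forall_congr' fun a' => forall_congr' fun b' => ⟨fun h4 h5 => h4 ?_ h5, fun h4 _ => h4⟩
  have := he (b' - 1) (h5.2.1 _ (by have := h5.1; omega) (by have := h5.1; omega))
  omega

/-! ### Blocks -/

theorem flatten_blocks {B k ℓ : ℕ} (x : ℕ → List Bool) (hk : k ≤ B * ℓ)
    (hx : ∀ b < B, (x b).length = min ℓ (k - b * ℓ)) :
    ((List.range B).map x).flatten.length = k ∧
      ∀ b < B, (((List.range B).map x).flatten.drop (b * ℓ)).take ℓ = x b := by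
  induction B generalizing k x with
  | zero => simp at hk; simp [hk]
  | succ B ih =>
    rw [List.range_succ_eq_map, List.map_cons, List.map_map, List.flatten_cons]
    have h0 := hx 0 (Nat.succ_pos B)
    rw [zero_mul, Nat.sub_zero] at h0
    rw [add_mul, one_mul] at hk
    have h1 := ih (k := k - ℓ) (x ∘ Nat.succ) (by omega) (fun b hb => by
      rw [Function.comp_apply, hx (b + 1) (by omega), add_mul, one_mul]
      congr 1
      omega)
    refine ⟨by rw [List.length_append, h1.1, h0]; omega, ?_⟩
    have hdrop : (x 0 ++ ((List.range B).map (x ∘ Nat.succ)).flatten).drop ℓ =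
        ((List.range B).map (x ∘ Nat.succ)).flatten := by
      rcases le_total ℓ k with h | h
      · rw [min_eq_left h] at h0
        rw [← h0, List.drop_left]
      · rw [List.length_eq_zero_iff.1 (h1.1.trans (by omega)), List.append_nil,
          List.drop_of_length_le (by omega)]
    intro b hb
    cases b with
    | zero =>
      rw [zero_mul, List.drop_zero]
      rcases le_total ℓ k with h | h
      · rw [min_eq_left h] at h0
        rw [← h0, List.take_left]
      · rw [List.length_eq_zero_iff.1 (h1.1.trans (by omega)), List.append_nil,
          List.take_of_length_le (by omega)]
    | succ b =>
      rw [show (b + 1) * ℓ = ℓ + b * ℓ by ring, ← List.drop_drop, hdrop]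
      exact h1.2 b (by omega)

end GC

namespace GC

/-! ## Correctness of the enumeration and of the chunking -/

theorem mapAccum_drop {α β γ : Type} (n : α → ℕ) (out : List β → α → γ) (B : ℕ) (f : ℕ → α)
    (y : List β) : mapAccum (fun y q => y.drop (n q)) out y ((List.range B).map f) =
      (List.range B).map fun b => out (y.drop (∑ i ∈ Finset.range b, n (f i))) (f b) := by
  induction B generalizing f y with
  | zero => rfl
  | succ B ih =>
    rw [List.range_succ_eq_map, List.map_cons, List.map_map, List.map_cons, List.map_map,
      mapAccum, ih]
    congr 1
    refine List.map_congr_left fun b _ => ?_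
    simp only [Function.comp_apply, List.drop_drop]
    rw [Finset.sum_range_succ', add_comm]

theorem mapAccum_drop_const {α β γ : Type} (n : ℕ) (out : List β → γ) (l : List α) (y : List β) :
    mapAccum (fun y _ => y.drop n) (fun y _ => out y) y l =
      (List.range l.length).map fun b => out (y.drop (b * n)) := by
  induction l generalizing y with
  | nil => rfl
  | cons a l ih =>
    rw [mapAccum, ih, List.length_cons, List.range_succ_eq_map, List.map_cons, List.map_map]
    simp only [zero_mul, List.drop_zero, List.cons.injEq, true_and]
    refine List.map_congr_left fun b _ => ?_
    rw [Function.comp_apply, List.drop_drop, Nat.succ_mul, add_comm]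

theorem headD_drop {α : Type} (l : List α) (n : ℕ) (d : α) : (l.drop n).headD d = l.getD n d := by
  rw [List.headD_eq_head?_getD, List.head?_drop, List.getD_eq_getElem?_getD]

theorem readParity_eq (k ℓ z c w : ℕ) {m : List Bool} (hm : m.length = ℓ) (y : List Bool) :
    readParity z c (List.replicate w ()) m (y.drop k) = Code.recoveredParity k ℓ c z w y := by
  unfold readParity Code.recoveredParity
  rw [mapAccum_drop_const _ fun y => y.headD false, length_copies, List.length_cons, length_copies,
    List.length_replicate, hm]
  refine List.ext_getElem (by simp) fun b h1 h2 => ?_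
  rw [List.getElem_map, List.getElem_range, List.getElem_ofFn, List.drop_drop, headD_drop]

/-- The plan with erased blocks `e` and numbers of deletions `n`. -/
def mkPlan (B : ℕ) (e : ℕ → Bool) (n : ℕ → ℕ) : Plan :=
  (List.range B).map fun b => (e b, List.replicate (n b) ())

theorem mkPlan_succ (B : ℕ) (e : ℕ → Bool) (n : ℕ → ℕ) : mkPlan (B + 1) e n =
    (e 0, List.replicate (n 0) ()) :: mkPlan B (fun b => e (b + 1)) fun b => n (b + 1) := by
  unfold mkPlan
  rw [List.range_succ_eq_map, List.map_cons, List.map_map]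
  rfl

theorem mkPlan_congr {B : ℕ} {e e' : ℕ → Bool} {n n' : ℕ → ℕ} (he : ∀ b < B, e b = e' b)
    (hn : ∀ b < B, n b = n' b) : mkPlan B e n = mkPlan B e' n' := by
  refine List.map_congr_left fun b hb => ?_
  rw [he b (List.mem_range.1 hb), hn b (List.mem_range.1 hb)]

theorem combine_mkPlan (B : ℕ) (e e' : ℕ → Bool) (n n' : ℕ → ℕ) :
    combine (mkPlan B e n) (mkPlan B e' n') =
      mkPlan B (fun b => e b || e' b) fun b => n b + n' b := by
  unfold combine mkPlan
  rw [List.zipWith_map, List.zipWith_self]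
  refine List.map_congr_left fun b _ => ?_
  simp only [List.replicate_append_replicate]

theorem singlePlans_cons_aux {α : Type} (w : List Unit) (B : List α) (a : α) :
    singlePlans w (B ++ [a]) = ((false, []) :: (singlePlans w B).1,
      ((dels w).flatMap fun m => if (singlePlans w B).1.isEmpty = true then [] else
        [(true, m) :: (true, []) :: (singlePlans w B).1.tail]) ++
      (singlePlans w B).2.map ((false, []) :: ·)) := by
  simp [singlePlans, List.foldl_append]

theorem singlePlans_fst {α : Type} (w : List Unit) (B : List α) :
    (singlePlans w B).1 = mkPlan B.length (fun _ => false) fun _ => 0 := by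
  induction B using List.reverseRecOn with
  | nil => rfl
  | append_singleton B a ih =>
    rw [singlePlans_cons_aux, ih, List.length_append, List.length_singleton, mkPlan_succ]
    rfl

/-- A new block is put in front. The old plans move up by one place, and the new ones are those
whose window starts at block zero, provided that a second block exists. -/
theorem mem_singlePlans_snd {α : Type} (w : List Unit) (B : List α) (P : Plan) :
    P ∈ (singlePlans w B).2 ↔ ∃ s m : ℕ, s + 1 < B.length ∧ m ≤ w.length ∧
      P = mkPlan B.length (fun b => decide (b = s ∨ b = s + 1)) fun b => if s = b then m else 0 := by
  induction B using List.reverseRecOn generalizing P with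
  | nil => simp [singlePlans]
  | append_singleton B a ih =>
    rw [singlePlans_cons_aux, List.length_append, List.length_singleton]
    simp only [List.mem_append, List.mem_map, List.mem_flatMap]
    have hcons : ∀ s m : ℕ, mkPlan (B.length + 1) (fun b => decide (b = s + 1 ∨ b = s + 1 + 1))
        (fun b => if s + 1 = b then m else 0) = (false, []) :: mkPlan B.length
          (fun b => decide (b = s ∨ b = s + 1)) fun b => if s = b then m else 0 := by
      intro s m
      rw [mkPlan_succ]
      congr 1
      refine mkPlan_congr (fun b _ => ?_) fun b _ => ?_
      · simp
      · simp
    have hzero : ∀ n m : ℕ, mkPlan (n + 1 + 1) (fun b => decide (b = 0 ∨ b = 0 + 1))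
        (fun b => if 0 = b then m else 0) = (true, List.replicate m ()) :: (true, []) ::
          mkPlan n (fun _ => false) fun _ => 0 := by
      intro n m
      rw [mkPlan_succ, mkPlan_succ]
      congr 2
    constructor
    · rintro (⟨m, hm, hP⟩ | ⟨Q, hQ, rfl⟩)
      · rw [singlePlans_fst] at hP
        cases hB : B.length with
        | zero => rw [hB] at hP; simp [mkPlan] at hP
        | succ n =>
          rw [hB, mkPlan_succ] at hP
          simp only [List.isEmpty_cons, Bool.false_eq_true, if_false, List.tail_cons,
            List.mem_singleton] at hP
          refine ⟨0, m.length, by omega, mem_dels.1 hm, ?_⟩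
          rw [hzero, hP]
          congr 2
          exact List.eq_replicate_of_mem fun _ _ => rfl
      · obtain ⟨s, m, h1, h2, rfl⟩ := (ih Q).1 hQ
        exact ⟨s + 1, m, by omega, h2, (hcons s m).symm⟩
    · rintro ⟨s, m, h1, h2, rfl⟩
      cases s with
      | zero =>
        left
        refine ⟨List.replicate m (), mem_dels.2 (by simpa using h2), ?_⟩
        rw [singlePlans_fst]
        obtain ⟨n, hB⟩ := Nat.exists_eq_succ_of_ne_zero (n := B.length) (by omega)
        rw [hB, Nat.succ_eq_add_one, hzero, mkPlan_succ]
        simp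
      | succ s =>
        right
        exact ⟨_, (ih _).2 ⟨s, m, by omega, h2, rfl⟩, (hcons s m).symm⟩

namespace Code

open Classical in
/-- A guess in the form used by the algorithm. -/
noncomputable def Guess.plan {z : ℕ} (B : ℕ) (g : Guess z) : Plan :=
  mkPlan B (fun b => decide (g.Erased b)) fun b => ∑ j, if g.start j = b then g.del j else 0

/-- Adding a window to a guess means superposing its plan: erasures are united and deletions added.
Different guesses may share a plan, which does no harm, as the plan is all that the treatment uses.
-/
theorem mem_plans {α : Type} (w : List Unit) (B : List α) (z : ℕ) (P : Plan) :
    P ∈ plans w B z ↔ ∃ g : Guess z, (∀ j, g.start j + 1 < B.length ∧ g.del j ≤ w.length) ∧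
      P = g.plan B.length := by
  induction z generalizing P with
  | zero =>
    rw [plans, List.mem_singleton, singlePlans_fst]
    have h : ∀ g : Guess 0, g.plan B.length = mkPlan B.length (fun _ => false) fun _ => 0 := by
      intro g
      refine mkPlan_congr (fun b _ => ?_) fun b _ => ?_
      · simp [Guess.Erased]
      · simp
    constructor
    · rintro rfl
      exact ⟨⟨Fin.elim0, Fin.elim0⟩, fun j => j.elim0, (h _).symm⟩
    · rintro ⟨g, -, rfl⟩
      exact h g
  | succ z ih =>
    rw [plans, List.mem_flatMap]
    simp only [List.mem_map, mem_singlePlans_snd, ih]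
    have h : ∀ g : Guess (z + 1), g.plan B.length = combine
        (mkPlan B.length (fun b => decide (b = g.start 0 ∨ b = g.start 0 + 1))
          fun b => if g.start 0 = b then g.del 0 else 0)
        (Guess.plan B.length ⟨fun j => g.start j.succ, fun j => g.del j.succ⟩) := by
      intro g
      unfold Guess.plan
      rw [combine_mkPlan]
      refine mkPlan_congr (fun b _ => ?_) fun b _ => ?_
      · classical
        rw [Bool.eq_iff_iff, Bool.or_eq_true, decide_eq_true_iff, decide_eq_true_iff,
          decide_eq_true_iff]
        exact Fin.exists_fin_succ
      · exact Fin.sum_univ_succ _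
    constructor
    · rintro ⟨Q, ⟨s, m, h1, h2, rfl⟩, Q', ⟨g, hg, rfl⟩, rfl⟩
      refine ⟨⟨Fin.cons s g.start, Fin.cons m g.del⟩, fun j => ?_, ?_⟩
      · refine Fin.cases ?_ (fun j => ?_) j
        · exact ⟨h1, h2⟩
        · exact hg j
      · rw [h]
        rfl
    · rintro ⟨g, hg, rfl⟩
      exact ⟨_, ⟨g.start 0, g.del 0, (hg 0).1, (hg 0).2, rfl⟩, _,
        ⟨⟨fun j => g.start j.succ, fun j => g.del j.succ⟩, fun j => hg j.succ, rfl⟩, (h g).symm⟩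

theorem Guess.shift_eq_sum {z : ℕ} (g : Guess z) (b : ℕ) : g.shift b =
    ∑ i ∈ Finset.range b, ∑ j, if g.start j = i then g.del j else 0 := by
  rw [Finset.sum_comm]
  refine Finset.sum_congr rfl fun j _ => ?_
  rw [Finset.sum_ite_eq]
  simp only [Finset.mem_range]

theorem Guess.length_flatMap_plan {z B : ℕ} (g : Guess z) (hg : ∀ j, g.start j + 1 < B) :
    ((g.plan B).flatMap Prod.snd).length = ∑ j, g.del j := by
  have h : ((g.plan B).flatMap Prod.snd).length = g.shift B := by
    rw [g.shift_eq_sum, List.length_flatMap, plan, mkPlan, List.map_map, Finset.sum_range]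
    rw [← List.sum_ofFn, ← List.map_coe_finRange_eq_range, List.map_map, List.ofFn_eq_map]
    simp [Function.comp_def]
  rw [h]
  refine Finset.sum_congr rfl fun j _ => if_pos ?_
  have := hg j
  omega

end Code

end GC

/-! ### The list algorithm computes the decoder -/

namespace GC

namespace Code

variable {k ℓ c z w : ℕ} (C : Code k ℓ c)

/-- The rows of the binary generator matrix that belong to a block. -/
noncomputable def fullRows (b : ℕ) : List (List Bool) :=
  if h : b < numBlocks k ℓ then blockRows C.modBits (C.genRow ⟨b, h⟩) else []

theorem length_fullRows {b : ℕ} (h : b < numBlocks k ℓ) : (C.fullRows b).length = ℓ := by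
  rw [fullRows, dif_pos h, length_blockRows_genRow]

theorem length_of_mem_fullRows {b : ℕ} {r : List Bool} (hr : r ∈ C.fullRows b) :
    r.length = c * ℓ := by
  unfold fullRows at hr
  split at hr
  · exact C.length_of_mem_blockRows_genRow _ hr
  · simp at hr

theorem map_blockRows_genRow : (List.ofFn C.genRow).map (blockRows C.modBits) =
    (List.range (numBlocks k ℓ)).map C.fullRows := by
  refine List.ext_getElem (by simp) fun b h1 h2 => ?_
  simp only [List.getElem_map, List.getElem_ofFn, List.getElem_range]
  rw [fullRows, dif_pos (by simpa using h2)]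

/-- The rows of the binary generator matrix that belong to a block, without the padding. -/
noncomputable def cutRows (b : ℕ) : List (List Bool) := (C.fullRows b).take (k - b * ℓ)

theorem length_cutRows {b : ℕ} (h : b < numBlocks k ℓ) :
    (C.cutRows b).length = min ℓ (k - b * ℓ) := by
  rw [cutRows, List.length_take, C.length_fullRows h, min_comm]

theorem cutBlocks_eq : cutBlocks (List.replicate k ())
    ((List.ofFn C.genRow).map (blockRows C.modBits)) =
      (List.range (numBlocks k ℓ)).map C.cutRows := by
  rw [map_blockRows_genRow, cutBlocks, mapAccum_drop List.length fun k b => b.take k.length]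
  refine List.map_congr_left fun b hb => ?_
  rw [List.length_drop, List.length_replicate, Finset.sum_congr rfl (g := fun _ => ℓ) fun i hi =>
    C.length_fullRows ((Finset.mem_range.1 hi).trans (List.mem_range.1 hb)), Finset.sum_const,
    Finset.card_range, smul_eq_mul, cutRows]

theorem le_numBlocks_mul (hℓ : 0 < ℓ) : k ≤ numBlocks k ℓ * ℓ := by
  unfold numBlocks
  have h1 := Nat.lt_div_mul_add hℓ (a := k + ℓ - 1)
  omega

theorem length_blockBits (u : Fin k → Bool) (b : ℕ) :
    (blockBits ℓ u b).length = min ℓ (k - b * ℓ) := by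
  simp [blockBits]

theorem lin_take {u : List Bool} {n : ℕ} (hu : u.length ≤ n) (R : List (List Bool)) :
    lin u (R.take n) = lin u R := by
  unfold lin
  congr 1
  induction R generalizing u n with
  | nil => simp
  | cons r R ih =>
    cases u with
    | nil => simp
    | cons b u =>
      cases n with
      | zero => simp at hu
      | succ n => rw [List.take_succ_cons, List.zipWith_cons_cons, List.zipWith_cons_cons,
          ih (by simpa using hu)]

namespace Guess

variable (g : Guess z)

/-- The assumed number of deletions in the windows that start with a block. -/
def delAt (b : ℕ) : ℕ := ∑ j, if g.start j = b then g.del j else 0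

/-- The assumed position of the beginning of a block in the received string. -/
def offset (k ℓ b : ℕ) : ℕ := min (b * ℓ) k - g.shift b

/-- The part of the received string that belongs to a block. -/
def segment (k ℓ : ℕ) (y : List Bool) (b : ℕ) : List Bool :=
  (y.drop (g.offset k ℓ b)).take (g.offset k ℓ (b + 1) - g.offset k ℓ b)

variable {g}

theorem shift_succ (b : ℕ) : g.shift (b + 1) = g.shift b + g.delAt b := by
  rw [shift_eq_sum, shift_eq_sum, Finset.sum_range_succ, delAt]

theorem delAt_eq_zero {b : ℕ} (h : ¬ g.Erased b) : g.delAt b = 0 :=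
  Finset.sum_eq_zero fun j _ => if_neg fun he => h ⟨j, Or.inl he.symm⟩

theorem delAt_le (hdel : ∀ j, g.del j ≤ w) (b : ℕ) : g.delAt b ≤ z * w := by
  refine (Finset.sum_le_card_nsmul _ _ w fun j _ => ?_).trans (by simp)
  split
  · exact hdel j
  · exact Nat.zero_le _

/-- A window starts only at a block that is followed by another one and is therefore complete. Its
`ℓ ≥ z * w` bits suffice for all deletions charged to it, so the subtractions in the offsets are
exact. -/
theorem delAt_add_le (hzw : z * w ≤ ℓ)
    (hg : ∀ j, g.start j + 1 < numBlocks k ℓ ∧ g.del j ≤ w) (b : ℕ) :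
    min (b * ℓ) k + g.delAt b ≤ min ((b + 1) * ℓ) k := by
  by_cases h : ∃ j, g.start j = b
  · obtain ⟨j, rfl⟩ := h
    have h1 := succ_mul_le_of_lt (hg j).1
    have h2 := g.delAt_le (fun j => (hg j).2) (g.start j)
    rw [add_mul, one_mul] at h1 ⊢
    omega
  · have h1 : g.delAt b = 0 := Finset.sum_eq_zero fun j _ => if_neg fun he => h ⟨j, he⟩
    rw [h1, add_zero]
    exact min_le_min_right _ (Nat.mul_le_mul_right _ (Nat.le_succ b))

theorem shift_le_min (hzw : z * w ≤ ℓ)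
    (hg : ∀ j, g.start j + 1 < numBlocks k ℓ ∧ g.del j ≤ w) (b : ℕ) :
    g.shift b ≤ min (b * ℓ) k := by
  induction b with
  | zero => simp [shift]
  | succ b ih =>
    rw [shift_succ]
    have := delAt_add_le hzw hg b
    omega

theorem offset_succ (hzw : z * w ≤ ℓ)
    (hg : ∀ j, g.start j + 1 < numBlocks k ℓ ∧ g.del j ≤ w) (b : ℕ) :
    g.offset k ℓ (b + 1) = g.offset k ℓ b + (min ℓ (k - b * ℓ) - g.delAt b) ∧
      g.delAt b ≤ min ℓ (k - b * ℓ) := by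
  have h1 := delAt_add_le hzw hg b
  have h2 := shift_le_min hzw hg b
  unfold offset
  rw [shift_succ]
  rw [add_mul, one_mul] at h1 ⊢
  omega

theorem offset_mono (hzw : z * w ≤ ℓ)
    (hg : ∀ j, g.start j + 1 < numBlocks k ℓ ∧ g.del j ≤ w) : Monotone (g.offset k ℓ) :=
  monotone_nat_of_le_succ fun b => by rw [(offset_succ hzw hg b).1]; exact Nat.le_add_right _ _

theorem offset_eq_sum (hzw : z * w ≤ ℓ)
    (hg : ∀ j, g.start j + 1 < numBlocks k ℓ ∧ g.del j ≤ w) (b : ℕ) :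
    g.offset k ℓ b = ∑ i ∈ Finset.range b, (min ℓ (k - i * ℓ) - g.delAt i) := by
  induction b with
  | zero => simp [offset]
  | succ b ih => rw [(offset_succ hzw hg b).1, ih, Finset.sum_range_succ]

theorem length_segment (hzw : z * w ≤ ℓ)
    (hg : ∀ j, g.start j + 1 < numBlocks k ℓ ∧ g.del j ≤ w) {y : List Bool} (hy : k ≤ y.length)
    {b : ℕ} (hb : ¬ g.Erased b) : (g.segment k ℓ y b).length = min ℓ (k - b * ℓ) := by
  have h1 := (offset_succ hzw hg b).1
  have h2 : g.offset k ℓ (b + 1) ≤ k := by unfold offset; omega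
  rw [delAt_eq_zero hb] at h1
  rw [segment, List.length_take, List.length_drop]
  omega

theorem agreesOffErasures_iff (hℓ : 0 < ℓ) (hzw : z * w ≤ ℓ)
    (hg : ∀ j, g.start j + 1 < numBlocks k ℓ ∧ g.del j ≤ w) {y : List Bool} (hy : k ≤ y.length)
    (v : Fin k → Bool) : AgreesOffErasures ℓ y g v ↔
      ∀ b < numBlocks k ℓ, ¬ g.Erased b → blockBits ℓ v b = g.segment k ℓ y b := by
  have key : ∀ b i : ℕ, b * ℓ + i < k → i < ℓ → ¬ g.Erased b →
      (g.segment k ℓ y b)[i]? = y[b * ℓ + i - g.shift b]? := by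
    intro b i h1 h2 h3
    have h4 := length_segment hzw hg hy h3
    have h5 : (g.segment k ℓ y b).length ≤ g.offset k ℓ (b + 1) - g.offset k ℓ b :=
      List.length_take_le _ _
    have h6 := shift_le_min hzw hg b
    rw [segment, List.getElem?_take_of_lt (by omega), List.getElem?_drop]
    congr 1
    unfold offset
    omega
  have hbits : ∀ b i : ℕ, ∀ h : b * ℓ + i < k, i < ℓ →
      (blockBits ℓ v b)[i]? = some (v ⟨b * ℓ + i, h⟩) := by
    intro b i h1 h2
    rw [blockBits, List.getElem?_take_of_lt h2, List.getElem?_drop]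
    simp [h1]
  constructor
  · intro h b hb he
    refine List.ext_getElem? fun i => ?_
    by_cases hi : i < min ℓ (k - b * ℓ)
    · have h1 : b * ℓ + i < k := by omega
      have h2 : (b * ℓ + i) / ℓ = b := by
        rw [mul_comm, Nat.mul_add_div hℓ, Nat.div_eq_of_lt (by omega), add_zero]
      have h3 := h ⟨b * ℓ + i, h1⟩ (by rwa [h2])
      simp only [h2] at h3
      rw [key b i h1 (by omega) he, h3, hbits b i h1 (by omega)]
    · rw [List.getElem?_eq_none, List.getElem?_eq_none]
      · rw [length_segment hzw hg hy he]; omega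
      · rw [length_blockBits]; omega
  · intro h p he
    have h1 := Nat.div_add_mod' (p : ℕ) ℓ
    have h2 := Nat.mod_lt (p : ℕ) hℓ
    have h4 := p.2
    have h3 := hbits (p / ℓ) (p % ℓ) (by omega) h2
    rw [h _ (lt_numBlocks p.2 hℓ) he, key _ _ (by omega) h2 he] at h3
    simp only [h1] at h3
    exact h3

open Classical in
/-- The blocks with the received bits that a guess assigns to them. -/
noncomputable def items (g : Guess z) (y : List Bool) : List Item :=
  (List.range (numBlocks k ℓ)).map fun b => (decide (g.Erased b), C.cutRows b, g.segment k ℓ y b)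

theorem chunk_plan (hzw : z * w ≤ ℓ)
    (hg : ∀ j, g.start j + 1 < numBlocks k ℓ ∧ g.del j ≤ w) (y : List Bool) :
    chunk y (g.plan (numBlocks k ℓ)) ((List.range (numBlocks k ℓ)).map C.cutRows) =
      g.items C y := by
  unfold chunk plan mkPlan
  rw [List.zipWith_map, List.zipWith_self]
  rw [mapAccum_drop (fun q : (Bool × List Unit) × List (List Bool) =>
      (q.2.drop q.1.2.length).length)
    fun y q => (q.1.1, q.2, y.take (q.2.drop q.1.2.length).length)]
  refine List.map_congr_left fun b hb => ?_
  have hb' := List.mem_range.1 hb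
  have h1 : ∀ i < numBlocks k ℓ, ((C.cutRows i).drop (List.replicate
      (∑ j, if g.start j = i then g.del j else 0) ()).length).length =
        min ℓ (k - i * ℓ) - g.delAt i := by
    intro i hi
    rw [List.length_drop, List.length_replicate, C.length_cutRows hi, delAt]
  simp only
  rw [Finset.sum_congr rfl fun i hi => h1 i ((Finset.mem_range.1 hi).trans hb'), h1 b hb',
    ← offset_eq_sum hzw hg, segment, (offset_succ hzw hg b).1, Nat.add_sub_cancel_left]

/-- As the rows of the padding have been cut away, the blocks of a filling have exactly the lengths
of the blocks of a message, and their concatenation is a string of `k` bits. -/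
theorem fills_items_iff (hℓ : 0 < ℓ) (hzw : z * w ≤ ℓ)
    (hg : ∀ j, g.start j + 1 < numBlocks k ℓ ∧ g.del j ≤ w) {y : List Bool} (hy : k ≤ y.length)
    (X : List (List Bool)) : Fills (g.items C y) X ↔
      ∃ v : Fin k → Bool, AgreesOffErasures ℓ y g v ∧
        X = (List.range (numBlocks k ℓ)).map (blockBits ℓ v) := by
  unfold Fills items
  rw [List.forall₂_map_left_iff]
  constructor
  · intro h
    have hX : X.length = numBlocks k ℓ := by simpa using h.length_eq.symm
    have hx : ∀ b < numBlocks k ℓ, (X.getD b []).length = min ℓ (k - b * ℓ) ∧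
        (¬ g.Erased b → X.getD b [] = g.segment k ℓ y b) := by
      intro b hb
      have h1 := h.get (by simpa using hb) (by rwa [hX])
      simp only [List.get_eq_getElem, List.getElem_range, decide_eq_false_iff_not] at h1
      rw [C.length_cutRows hb] at h1
      rwa [List.getD_eq_getElem _ _ (by rwa [hX])]
    have hXr : X = (List.range (numBlocks k ℓ)).map fun b => X.getD b [] := by
      refine List.ext_getElem (by simp [hX]) fun b h1 h2 => ?_
      rw [List.getElem_map, List.getElem_range, List.getD_eq_getElem _ _ h1]
    have hfl := flatten_blocks (fun b => X.getD b []) (le_numBlocks_mul hℓ) fun b hb => (hx b hb).1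
    rw [← hXr] at hfl
    have hof : List.ofFn (fun p : Fin k => X.flatten.getD p false) = X.flatten := by
      refine List.ext_getElem (by simp [hfl.1]) fun b h1 h2 => ?_
      rw [List.getElem_ofFn, List.getD_eq_getElem _ _ h2]
    have hbb : ∀ b < numBlocks k ℓ,
        blockBits ℓ (fun p : Fin k => X.flatten.getD p false) b = X.getD b [] := by
      intro b hb
      rw [blockBits, hof, hfl.2 b hb]
    refine ⟨fun p => X.flatten.getD p false, ?_, ?_⟩
    · rw [agreesOffErasures_iff hℓ hzw hg hy]
      intro b hb he
      rw [hbb b hb, (hx b hb).2 he]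
    · conv_lhs => rw [hXr]
      exact List.map_congr_left fun b hb => (hbb b (List.mem_range.1 hb)).symm
  · rintro ⟨v, hv, rfl⟩
    rw [agreesOffErasures_iff hℓ hzw hg hy] at hv
    rw [List.forall₂_map_right_iff, List.forall₂_same]
    intro b hb
    have hb' := List.mem_range.1 hb
    refine ⟨by rw [length_blockBits, C.length_cutRows hb'], fun he => ?_⟩
    exact hv b hb' (by simpa using he)

theorem blockSum_items (g : Guess z) (y : List Bool) (v : Fin k → Bool) :
    blockSum (g.items C y) ((List.range (numBlocks k ℓ)).map (blockBits ℓ v)) =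
      vec (C.parityBits v) := by
  have hsum : ∀ (n : ℕ) (f : ℕ → ℕ → ZMod 2),
      ((List.range n).map f).sum = ∑ i ∈ Finset.range n, f i := by
    intro n f
    induction n with
    | zero => rfl
    | succ n ih => rw [List.range_succ, List.map_append, List.sum_append, ih,
        Finset.sum_range_succ]; simp
  rw [blockSum, items, List.zipWith_map, List.zipWith_self, hsum, vec_parityBits, Finset.sum_range]
  refine Finset.sum_congr rfl fun b _ => ?_
  simp only
  rw [cutRows, lin_take (by rw [length_blockBits]; exact min_le_right _ _), fullRows,
    dif_pos b.2]

theorem runsOk_items (hzw : z * w ≤ ℓ)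
    (hg : ∀ j, g.start j + 1 < numBlocks k ℓ ∧ g.del j ≤ w) (y : List Bool) (v : Fin k → Bool) :
    runsOk (List.zipWith (fun (q : Item) x => (q.1, q.2.2, x)) (g.items C y)
      ((List.range (numBlocks k ℓ)).map (blockBits ℓ v))) = true ↔ IsSupersequence ℓ y g v := by
  classical
  have hE : ∀ b, g.Erased b → b < numBlocks k ℓ := by
    rintro b ⟨j, h⟩
    have := (hg j).1
    omega
  rw [items, List.zipWith_map, List.zipWith_self, runsOk_iff _ _ _ _ fun b hb =>
    hE b (by simpa using hb)]
  unfold IsSupersequence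
  refine forall_congr' fun a => forall_congr' fun b => ?_
  have h1 : IsMaxRun (fun b => decide (g.Erased b) = true) a b ↔ g.IsRun a b := by
    simp only [decide_eq_true_eq]
    rfl
  rw [h1]
  refine forall_congr' fun hrun => ?_
  have hak : a * ℓ ≤ k := by
    have h2 := hE a (hrun.2.1 a le_rfl hrun.1)
    cases a with
    | zero => simp
    | succ a => exact succ_mul_le_of_lt h2
  have h3 := flatMap_segments y (offset_mono hzw hg) hrun.1.le
  have h4 := flatMap_segments (List.ofFn v) (off := fun t => t * ℓ)
    (fun a b h => Nat.mul_le_mul_right _ h) hrun.1.le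
  have h5 : (fun t => ((List.ofFn v).drop (t * ℓ)).take ((t + 1) * ℓ - t * ℓ)) =
      blockBits ℓ v := by
    funext t
    rw [add_mul, one_mul, Nat.add_sub_cancel_left, blockBits]
  rw [h5] at h4
  have h6 : g.offset k ℓ a = a * ℓ - g.shift a := by rw [offset, min_eq_left hak]
  rw [← h6, ← h4]
  unfold offset at h3 ⊢
  rw [← h3]
  rfl

theorem mem_tryItems_items (hzw : z * w ≤ ℓ) (hc : 2 * z ≤ c)
    (hg : ∀ j, g.start j + 1 < numBlocks k ℓ ∧ g.del j ≤ w) {y : List Bool} (hy : k ≤ y.length)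
    {par : List Bool} (hpar : par.length = c * ℓ) (x : List Bool) :
    x ∈ tryItems par (g.items C y) ↔ ∃ v : Fin k → Bool, C.parityBits v = par ∧
      AgreesOffErasures ℓ y g v ∧ IsSupersequence ℓ y g v ∧ x = List.ofFn v := by
  have hℓ := C.length_pos
  have hitem : ∀ q ∈ g.items C y, ∃ b < numBlocks k ℓ, q.2.1 = C.cutRows b ∧
      q.2.2 = g.segment k ℓ y b ∧ (q.1 = false → ¬ g.Erased b) := by
    intro q hq
    obtain ⟨b, hb, rfl⟩ := List.mem_map.1 hq
    exact ⟨b, List.mem_range.1 hb, rfl, rfl, fun h => by simpa using h⟩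
  have hvec : ∀ v : Fin k → Bool, vec (C.parityBits v) = vec par ↔ C.parityBits v = par := fun v =>
    ⟨fun h => vec_inj (by rw [length_parityBits, hpar]) h, fun h => by rw [h]⟩
  have hflat : ∀ v : Fin k → Bool,
      ((List.range (numBlocks k ℓ)).map (blockBits ℓ v)).flatten = List.ofFn v := by
    intro v
    have h := flatten_blocks (blockBits ℓ v) (le_numBlocks_mul hℓ) fun b _ => length_blockBits v b
    have h4 := flatMap_segments (List.ofFn v) (off := fun t => t * ℓ)
      (fun a b h => Nat.mul_le_mul_right _ h) (Nat.zero_le (numBlocks k ℓ))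
    have h5 : (fun t => ((List.ofFn v).drop (t * ℓ)).take ((t + 1) * ℓ - t * ℓ)) =
        blockBits ℓ v := by
      funext t
      rw [add_mul, one_mul, Nat.add_sub_cancel_left, blockBits]
    rw [h5, zero_mul, List.drop_zero, Nat.sub_zero, ← List.range_eq_range',
      List.take_of_length_le (by simpa using le_numBlocks_mul hℓ)] at h4
    exact h4
  rw [mem_tryItems]
  · constructor
    · rintro ⟨X, hX, h1, h2, h3⟩
      obtain ⟨v, hv, rfl⟩ := (fills_items_iff C hℓ hzw hg hy X).1 hX
      rw [blockSum_items, hvec] at h1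
      rw [runsOk_items C hzw hg] at h2
      rw [hflat] at h3
      exact ⟨v, h1, hv, h2, h3⟩
    · rintro ⟨v, h1, hv, h2, h3⟩
      refine ⟨_, (fills_items_iff C hℓ hzw hg hy _).2 ⟨v, hv, rfl⟩, ?_, ?_, ?_⟩
      · rw [blockSum_items, hvec]
        exact h1
      · exact (runsOk_items C hzw hg y v).2 h2
      · rw [hflat]
        exact h3
  · intro q hq r hr
    obtain ⟨b, -, h1, -⟩ := hitem q hq
    rw [h1] at hr
    rw [hpar]
    exact C.length_of_mem_fullRows (List.mem_of_mem_take hr)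
  · intro q hq he
    obtain ⟨b, hb, h1, h2, h3⟩ := hitem q hq
    rw [h1, h2, C.length_cutRows hb, length_segment hzw hg hy (h3 he)]
  -- Two fillings with the same parities differ in at most `2 * z ≤ c` erased blocks, so the MDS
  -- property makes them equal.
  · intro X Y hX hY h1 h2
    obtain ⟨u, hu, rfl⟩ := (fills_items_iff C hℓ hzw hg hy X).1 hX
    obtain ⟨v, hv, rfl⟩ := (fills_items_iff C hℓ hzw hg hy Y).1 hY
    rw [blockSum_items, hvec] at h1 h2
    rw [C.eq_of_parityBits_eq (h1.trans h2.symm) g.erasures (g.card_erasures_le.trans hc)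
      fun p hp => ?_]
    rw [Guess.mem_erasures] at hp
    exact Option.some.inj ((hu p hp).symm.trans (hv p hp))

end Guess

theorem mem_candidates (hzw : z * w ≤ ℓ) (hc : 2 * z ≤ c) {y : List Bool} (hy : k ≤ y.length)
    (x : List Bool) : x ∈ candidates z c (List.replicate w ()) C.modBits (List.ofFn C.genRow)
      (List.replicate k ()) y ↔ ∃ v, C.Possible z w y v ∧ x = List.ofFn v := by
  unfold candidates
  rw [C.cutBlocks_eq, List.length_replicate, readParity_eq k ℓ z c w C.length_modBits,
    List.mem_flatMap]
  have hd : (((List.replicate k ()) ++ (copies c C.modBits).flatMap fun _ =>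
      () :: copies z (List.replicate w ())).drop y.length).length =
        k + c * (z * w + 1) * ℓ - y.length := by
    rw [List.length_drop, List.length_append, List.length_replicate, List.length_flatMap,
      List.map_const', List.sum_replicate, length_copies, length_modBits, List.length_cons,
      length_copies, List.length_replicate, smul_eq_mul]
    congr 2
    ring
  have htry : ∀ g : Guess z, (∀ j, g.start j + 1 < numBlocks k ℓ ∧ g.del j ≤ w) →
      (x ∈ tryPlan ((List.range (numBlocks k ℓ)).map C.cutRows) (recoveredParity k ℓ c z w y)
        (((List.replicate k ()) ++ (copies c C.modBits).flatMap fun _ =>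
          () :: copies z (List.replicate w ())).drop y.length) y (g.plan (numBlocks k ℓ)) ↔
      ∑ j, g.del j ≤ k + c * (z * w + 1) * ℓ - y.length ∧
        ∃ v : Fin k → Bool, C.parityBits v = recoveredParity k ℓ c z w y ∧
          AgreesOffErasures ℓ y g v ∧ IsSupersequence ℓ y g v ∧ x = List.ofFn v) := by
    intro g hg
    rw [← Guess.mem_tryItems_items C hzw hc hg hy (by simp [recoveredParity]),
      ← Guess.chunk_plan C hzw hg, tryPlan, hd]
    have h1 : (((g.plan (numBlocks k ℓ)).flatMap Prod.snd).drop
        (k + c * (z * w + 1) * ℓ - y.length)).isEmpty = true ↔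
          ∑ j, g.del j ≤ k + c * (z * w + 1) * ℓ - y.length := by
      rw [List.isEmpty_iff, List.drop_eq_nil_iff, g.length_flatMap_plan fun j => (hg j).1]
    split
    · rename_i h
      rw [h1] at h
      simp only [h, true_and]
    · rename_i h
      rw [h1] at h
      simp only [h, false_and, List.not_mem_nil]
  have hplans : ∀ P, P ∈ plans (List.replicate w ()) (List.ofFn C.genRow) z ↔ ∃ g : Guess z,
      (∀ j, g.start j + 1 < numBlocks k ℓ ∧ g.del j ≤ w) ∧ P = g.plan (numBlocks k ℓ) := by
    intro P
    rw [mem_plans, List.length_ofFn, List.length_replicate]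
  constructor
  · rintro ⟨P, hP, hx⟩
    obtain ⟨g, hg, rfl⟩ := (hplans P).1 hP
    obtain ⟨h1, v, h2, h3, h4, h5⟩ := (htry g hg).1 hx
    exact ⟨v, ⟨h2, g, ⟨hg, h1⟩, h3, h4⟩, h5⟩
  · rintro ⟨v, ⟨h2, g, ⟨hg, h1⟩, h3, h4⟩, h5⟩
    exact ⟨_, (hplans _).2 ⟨g, hg, rfl⟩, (htry g hg).2 ⟨h1, v, h2, h3, h4, h5⟩⟩

theorem agree_candidates (hzw : z * w ≤ ℓ) (hc : 2 * z ≤ c) {y : List Bool} (hy : k ≤ y.length) :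
    agree (candidates z c (List.replicate w ()) C.modBits (List.ofFn C.genRow)
      (List.replicate k ()) y) = (C.decode z w y).map List.ofFn := by
  have h := C.mem_candidates hzw hc hy
  generalize candidates z c (List.replicate w ()) C.modBits (List.ofFn C.genRow)
    (List.replicate k ()) y = L at h
  cases L with
  | nil =>
    rw [C.decode_eq_none_of_forall fun v hv => by simpa using (h (List.ofFn v)).2 ⟨v, hv, rfl⟩]
    rfl
  | cons a t =>
    obtain ⟨v, hv, rfl⟩ := (h a).1 (by simp)
    by_cases hall : (t.all fun v' => List.ofFn v == v') = true
    · rw [agree, if_pos hall, C.decode_eq_some hv]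
      · rfl
      · intro v' hv'
        have h1 := (h (List.ofFn v')).2 ⟨v', hv', rfl⟩
        rcases List.mem_cons.1 h1 with h1 | h1
        · exact List.ofFn_injective h1
        · have h2 := List.all_eq_true.1 hall _ h1
          exact (List.ofFn_injective (by simpa using h2)).symm
    · rw [agree, if_neg hall]
      rw [List.all_eq_true] at hall
      push Not at hall
      obtain ⟨b, hb, hne⟩ := hall
      obtain ⟨v', hv', rfl⟩ := (h b).1 (by simp [hb])
      rw [C.decode_eq_none hv hv' fun he => hne (by simp [he])]
      rfl

end Code

end GC

namespace GC

/-! ## The final estimates -/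

theorem sq_le_four_mul_two_pow (ℓ : ℕ) : ℓ ^ 2 ≤ 4 * 2 ^ ℓ := by
  induction ℓ with
  | zero => simp
  | succ n ih =>
    have := Nat.lt_two_pow_self (n := n)
    rw [pow_succ 2 n]
    nlinarith

theorem logb_two_pow (ℓ : ℕ) : Real.logb 2 (2 ^ ℓ) = ℓ := by
  rw [Real.logb_pow, Real.logb_self_eq_one (by norm_num), mul_one]

namespace Code

/-- The conditions on the parameters which hold for all long messages. -/
structure Long (z k ℓ w : ℕ) : Prop where
  pow : k = 2 ^ ℓ
  pos : 0 < ℓ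
  windows : z * w ≤ ℓ
  window : w ≤ ℓ
  blocks : 2 ≤ numBlocks k ℓ
  guesses : numBlocks k ℓ * (w + 1) ≤ k
  blocks_le : numBlocks k ℓ * ℓ ≤ 2 * k

/-- With `B` blocks, `4 * w ≤ ℓ` and `2 ≤ ℓ` give `2 * (w + 1) ≤ ℓ`, and the factor two absorbs the
rounding of `B`: `2 * B * (w + 1) ≤ B * ℓ < k + ℓ < 2 * k`. The remaining `z * w` serves for the
bound on the shifts. -/
theorem long_of_le {z ℓ w : ℕ} (hℓ : 2 ≤ ℓ) (hw : (z + 4) * w ≤ ℓ) :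
    Long z (2 ^ ℓ) ℓ w := by
  have h1 := Nat.lt_two_pow_self (n := ℓ)
  have h2 : numBlocks (2 ^ ℓ) ℓ * ℓ ≤ 2 ^ ℓ + ℓ - 1 := Nat.div_mul_le_self _ _
  have h3 : 2 * (w + 1) ≤ ℓ := by
    rw [add_mul] at hw
    rcases Nat.eq_zero_or_pos w with rfl | h
    · omega
    · omega
  rw [add_mul] at hw
  refine ⟨rfl, by omega, by omega, by omega, ?_, ?_, by omega⟩
  · rw [numBlocks, Nat.le_div_iff_mul_le (by omega)]
    omega
  · have h4 := Nat.mul_le_mul_left (numBlocks (2 ^ ℓ) ℓ) h3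
    rw [mul_left_comm] at h4
    omega

theorem eventually_long (z : ℕ) {w : ℕ → ℕ}
    (hw : (fun ℓ : ℕ => (w (2 ^ ℓ) : ℝ)) =o[atTop] fun ℓ : ℕ => Real.logb 2 (2 ^ ℓ)) :
    ∀ᶠ ℓ : ℕ in atTop, Long z (2 ^ ℓ) ℓ (w (2 ^ ℓ)) := by
  have h := hw.def (c := 1 / (z + 4)) (by positivity)
  filter_upwards [h, eventually_ge_atTop 2] with ℓ h hℓ
  refine long_of_le hℓ ?_
  rw [logb_two_pow, Real.norm_natCast, Real.norm_natCast, one_div_mul_eq_div,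
    le_div_iff₀ (by positivity)] at h
  have h' : w (2 ^ ℓ) * (z + 4) ≤ ℓ := by exact_mod_cast h
  rwa [mul_comm]

variable {z c k ℓ w : ℕ} (C : Code k ℓ c)

theorem description_gen : ∀ g ∈ List.ofFn C.genRow, g.length = c ∧ ∀ s ∈ g, s.length = ℓ := by
  intro g hg
  obtain ⟨j, rfl⟩ := List.mem_ofFn.1 hg
  refine ⟨by simp [genRow], fun s hs => ?_⟩
  obtain ⟨r, rfl⟩ := List.mem_ofFn.1 hs
  exact C.length_toBits _

theorem modBits_ne_nil : C.modBits ≠ [] := by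
  rw [← List.length_pos_iff, length_modBits]
  exact C.length_pos

theorem length_deleteAt_encode {D : Finset ℕ} (hD : Localized z w D) (u : Fin k → Bool) :
    (deleteAt D (C.encode z w u)).length ≤ k + c * ℓ * (z * w + 1) ∧
      k + c * ℓ * (z * w + 1) ≤ (deleteAt D (C.encode z w u)).length + z * w := by
  have h1 := kept_add_card D (k + c * ℓ * (z * w + 1))
  have h2 := Finset.card_filter_le D (· < k + c * ℓ * (z * w + 1))
  have h3 := hD.card_le
  rw [length_deleteAt, length_encode]
  omega

theorem decodeSizes (h : Long z k ℓ w) {D : Finset ℕ} (hD : Localized z w D)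
    (u : Fin k → Bool) : DecodeSizes z c
      (C.description w, List.replicate k (), deleteAt D (C.encode z w u)) := by
  have h1 := C.length_deleteAt_encode hD u
  have h2 := le_numBlocks_mul (k := k) h.pos
  have h3 := Nat.mul_le_mul_left z h.window
  rw [description_eq]
  refine ⟨C.modBits_ne_nil, ?_, ?_, ?_, ?_, ?_, ?_, ?_, ?_⟩ <;>
    simp only [List.length_replicate, List.length_ofFn, length_modBits]
  · exact h.window
  · exact h.guesses
  · exact h.blocks_le
  · exact h2
  · rw [h.pow]
    exact sq_le_four_mul_two_pow ℓ
  · exact C.description_gen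
  · exact h1.1
  · omega

theorem decodeList_eq (h : Long z k ℓ w) (hz : 1 < z) (hc : 2 * z ≤ c) {D : Finset ℕ}
    (hD : Localized z w D) (u : Fin k → Bool) :
    agree (candidates z c (C.description w).1 (C.description w).2.1 (C.description w).2.2
      (List.replicate k ()) (deleteAt D (C.encode z w u))) =
      (C.decode z w (deleteAt D (C.encode z w u))).map List.ofFn := by
  rw [description_eq]
  refine C.agree_candidates h.windows hc ?_
  have h1 := C.length_deleteAt_encode hD u
  -- The codeword has at least `z * w + 1` bits behind the message, more than can be deleted, so the
  -- received string still has `k` bits.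
  have h2 : z * w + 1 ≤ c * ℓ * (z * w + 1) :=
    Nat.le_mul_of_pos_left _ (Nat.mul_pos (by omega) h.pos)
  omega

end Code

end GC

/-- Guess & Check codes for `z > 1` windows of size at most `w k = o(log k)`, where `k = 2 ^ ℓ` is
the length of the message and `ℓ = log k`. -/
theorem theorem3 (z c : ℕ) (hz : 1 < z) (hc : 2 * z ≤ c) :
    (∀ᶠ ℓ : ℕ in atTop, ∃ C : GC.Code (2 ^ ℓ) ℓ c, C.IsCauchy) ∧
    (∀ (k ℓ w : ℕ), k = 2 ^ ℓ → ∀ (C : GC.Code k ℓ c) (u : Fin k → Bool),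
      (C.encode z w u).length = k + c * (z * w + 1) * Nat.log 2 k) ∧
    ∃ (Enc : GC.EncProg) (Dec : GC.DecProg), ∀ w : ℕ → ℕ,
      (fun ℓ : ℕ => (w (2 ^ ℓ) : ℝ)) =o[atTop] (fun ℓ : ℕ => Real.logb 2 (2 ^ ℓ)) →
      ∃ A : ℝ, ∀ᶠ ℓ : ℕ in atTop, ∀ k : ℕ, k = 2 ^ ℓ → ∀ C : GC.Code k ℓ c,
        (∀ u : Fin k → Bool,
          Enc.run (C.description (w k), List.ofFn u) = C.encode z (w k) u ∧
          (Enc.steps (C.description (w k), List.ofFn u) : ℝ) ≤ A * (k * Real.logb 2 k)) ∧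
        ∀ D : Finset ℕ, GC.Localized z (w k) D →
          (∀ (u : Fin k → Bool) (y : List Bool), y = GC.deleteAt D (C.encode z (w k) u) →
            (C.decode z (w k) y = some u ∨ C.decode z (w k) y = none) ∧
            Dec.run (C.description (w k), List.replicate k (), y) =
              (C.decode z (w k) y).map List.ofFn ∧
            (Dec.steps (C.description (w k), List.replicate k (), y) : ℝ) ≤
              A * ((k : ℝ) ^ (z + 1) * Real.logb 2 k)) ∧
          C.failureProb z (w k) D ≤ A * (k : ℝ) ^ (-((c : ℤ) - 4 * (z : ℤ))) := by
  refine ⟨?_, ?_, ?_⟩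
  · filter_upwards [eventually_ge_atTop (2 * (c + 1))] with ℓ hℓ
    exact GC.exists_cauchy_code c ℓ (by omega) (hℓ.trans Nat.lt_two_pow_self.le)
  · intro k ℓ w hk C u
    rw [C.length_encode, hk, Nat.log_pow (by omega)]
    ring
  obtain ⟨Enc, a, hEnc⟩ := GC.Eff.encodeList z c
  obtain ⟨Dec, b, hDec⟩ := GC.Eff.decodeList (z := z) (c := c) hz.le
  -- For `T ≥ 1` a bound `a * (T + 1)` is at most `2 * a * T`; the summand two is the constant in
  -- the bound for the failure probability.
  refine ⟨Enc, Dec, fun w hw => ⟨(2 * a + 2 * b + 2 : ℕ), ?_⟩⟩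
  filter_upwards [GC.Code.eventually_long z hw] with ℓ hlong
  intro k hk C
  rw [← hk] at hlong
  have hℓ := C.length_pos
  have hk1 : 1 ≤ k := by rw [hk]; exact Nat.one_le_two_pow
  have hlog : Real.logb 2 k = ℓ := by
    rw [hk, Nat.cast_pow, Nat.cast_ofNat, GC.logb_two_pow]
  have hsteps : ∀ n a' T : ℕ, n ≤ a' * (T + 1) → 2 * a' ≤ 2 * a + 2 * b + 2 → 1 ≤ T →
      n ≤ (2 * a + 2 * b + 2) * T := fun n a' T h1 h2 h3 => by nlinarith
  refine ⟨fun u => ?_, fun D hD => ⟨?_, ?_⟩⟩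
  · have h := hEnc (C.description (w k), List.ofFn u) (by
      rw [GC.Code.description_eq]
      refine ⟨C.modBits_ne_nil, ?_, ?_, ?_, ?_⟩ <;>
        simp only [List.length_replicate, List.length_ofFn, GC.Code.length_modBits]
      · exact hlong.window
      · rw [hk]
        exact GC.sq_le_four_mul_two_pow ℓ
      · exact hlong.blocks_le
      · exact C.description_gen)
    rw [GC.Code.description_eq] at h ⊢
    simp only [List.length_ofFn, GC.Code.length_modBits] at h
    refine ⟨h.1.trans (C.encodeList_eq z (w k) u), ?_⟩
    rw [hlog]
    exact_mod_cast hsteps _ a (k * ℓ) h.2 (by omega) (Nat.mul_pos hk1 hℓ)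
  · rintro u y rfl
    refine ⟨C.decode_eq_or (C.possible_self (by omega) hD hlong.window hlong.blocks u), ?_⟩
    have h := hDec _ (C.decodeSizes hlong hD u)
    refine ⟨h.1.trans (C.decodeList_eq hlong hz hc hD u), ?_⟩
    have h2 := h.2
    rw [GC.Code.description_eq] at h2 ⊢
    simp only [List.length_replicate, GC.Code.length_modBits] at h2
    rw [hlog]
    exact_mod_cast hsteps _ b (k ^ (z + 1) * ℓ) h2 (by omega) (Nat.mul_pos (Nat.pow_pos hk1) hℓ)
  · refine (C.failureProb_le hk (by omega) hlong.windows hlong.window hc hlong.blocks hlong.guesses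
      hD).trans ?_
    refine mul_le_mul_of_nonneg_right ?_ (by positivity)
    push_cast
    have h1 : (0 : ℝ) ≤ a := Nat.cast_nonneg a
    have h2 : (0 : ℝ) ≤ b := Nat.cast_nonneg b
    linarith
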